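/- Let $0\le m\le n$ be integers. Let $G(n,m)$ be the Grassmannian of $m$-dimensional linear subspaces of $\mathbb{R}^n$, with the metric $d(V,W)=\|P_V-P_W\|$, where $P_V:\mathbb{R}^n\to V$ denotes the orthogonal projection onto $V$, and let $\gamma_{n,m}$ be the Haar measure on $G(n,m)$, i.e. the $O(n)$-invariant Borel probability measure, obtained as the image of the Haar probability measure of $O(n)$ under $g\mapsto gV_0$ for a fixed $V_0\in G(n,m)$. Let $\dim$ denote Hausdorff dimension (with $\dim\emptyset=0$) and $\mathcal{H}^m$ the $m$-dimensional Hausdorff measure; for a set that is not known to be measurable, $\gamma_{n,m}$ is understood as an outer measure. Let $A,B\subset\mathbb{R}^n$ be Borel sets. (i) If $\dim A>m$ and $\dim B>m$, then $$\gamma_{n,m}\big(\{V\in G(n,m):\ \mathcal{H}^m(P_V(A)\cap P_V(B))>0\}\big)>0.$$ (ii) If $\dim A>2m$ and $\dim B>2m$, then $$\gamma_{n,m}\big(\{V\in G(n,m):\ \operatorname{Int}(P_V(A)\cap P_V(B))\neq\emptyset\}\big)>0,$$ where $\operatorname{Int}$ denotes the interior relative to $V$. (iii) If $\dim A>m$,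 $\dim B\le m$ and $\dim A+\dim B>2m$, then for every $\varepsilon>0$, $$\gamma_{n,m}\big(\{V\in G(n,m):\ \dim(P_V(A)\cap P_V(B))>\dim B-\varepsilon\}\big)>0.$$ -/

import Mathlib

open MeasureTheory Topology
open scoped ENNReal

namespace ProjInter

/-- Euclidean space `ℝⁿ`. -/
abbrev E (n : ℕ) : Type := EuclideanSpace ℝ (Fin n)

/-- The orthogonal group `O(n)`: the linear maps `g` of `ℝⁿ` with `g* g = g g* = 1`, with the
topology of the operator norm. -/
abbrev OrthGroup (n : ℕ) : Type := unitary (E n →L[ℝ] E n)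

instance continuousStar_clm (n : ℕ) : ContinuousStar (E n →L[ℝ] E n) :=
  ⟨(ContinuousLinearMap.adjoint (𝕜 := ℝ) (E := E n) (F := E n)).continuous⟩

instance compactSpace_orthGroup (n : ℕ) : CompactSpace (OrthGroup n) := by
  have : ProperSpace (E n →L[ℝ] E n) := FiniteDimensional.proper ℝ _
  refine isCompact_iff_compactSpace.mp (Metric.isCompact_of_isClosed_isBounded
    (isClosed_unitary (R := E n →L[ℝ] E n)) ?_)
  refine (Metric.isBounded_closedBall (x := (0 : E n →L[ℝ] E n)) (r := 1)).subset fun g hg => ?_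
  rw [mem_closedBall_zero_iff]
  refine ContinuousLinearMap.opNorm_le_bound _ zero_le_one fun x => ?_
  rw [one_mul]
  exact ((Unitary.linearIsometryEquiv ⟨g, hg⟩).norm_map x).le

/-- The Haar probability measure `θ_n` on `O(n)`. -/
noncomputable def haarO (n : ℕ) : Measure (OrthGroup n) :=
  Measure.haarMeasure ⊤

instance isProbabilityMeasure_haarO (n : ℕ) : IsProbabilityMeasure (haarO n) :=
  ⟨by simpa [haarO] using Measure.haarMeasure_self (K₀ := (⊤ : TopologicalSpace.PositiveCompacts
    (OrthGroup n)))⟩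

/-- The Grassmannian `G(n,m)` of `m`-dimensional linear subspaces of `ℝⁿ`. -/
def Grass (n m : ℕ) : Type :=
  {V : Submodule ℝ (E n) // Module.finrank ℝ V = m}

/-- The topology of `G(n,m)` is the one of the metric `d(V, W) = ‖P_V - P_W‖`. -/
noncomputable instance topologicalSpace_grass (n m : ℕ) : TopologicalSpace (Grass n m) :=
  TopologicalSpace.induced (fun V => V.1.starProjection) inferInstance

noncomputable instance measurableSpace_grass (n m : ℕ) : MeasurableSpace (Grass n m) := borel _

instance borelSpace_grass (n m : ℕ) : BorelSpace (Grass n m) := ⟨rfl⟩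

/-- The image `g V` of an `m`-plane `V` under `g ∈ O(n)`. -/
noncomputable def rotate {n m : ℕ} (g : OrthGroup n) (V : Grass n m) : Grass n m :=
  ⟨V.1.map ((Unitary.linearIsometryEquiv g).toLinearEquiv : E n →ₗ[ℝ] E n), by
    rw [LinearEquiv.finrank_map_eq]; exact V.2⟩

/-- The coordinate `m`-plane spanned by the first `m` standard basis vectors of `ℝⁿ`. -/
noncomputable def coordPlane {n m : ℕ} (hm : m ≤ n) : Grass n m :=
  ⟨Submodule.span ℝ (Set.range fun i : Fin m =>
      EuclideanSpace.basisFun (Fin n) ℝ (Fin.castLE hm i)), by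
    rw [finrank_span_eq_card, Fintype.card_fin]
    exact (EuclideanSpace.basisFun (Fin n) ℝ).orthonormal.linearIndependent.comp _
      (Fin.castLE_injective hm)⟩

/-- The Haar measure `γ_{n,m}` of `G(n,m)`: the image of the Haar probability measure of `O(n)`
under `g ↦ g V₀`, where `V₀` is the coordinate `m`-plane. -/
noncomputable def gammaMeas {n m : ℕ} (hm : m ≤ n) : Measure (Grass n m) :=
  (haarO n).map fun g => rotate g (coordPlane hm)

theorem starProjection_rotate {n m : ℕ} (g : OrthGroup n) (V : Grass n m) :
    (rotate g V).1.starProjection = (g : E n →L[ℝ] E n) * V.1.starProjection *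
      ((g⁻¹ : OrthGroup n) : E n →L[ℝ] E n) := by
  ext1 x
  have h := Submodule.starProjection_map_apply (Unitary.linearIsometryEquiv g) V.1 x
  have h2 : (Unitary.linearIsometryEquiv g).symm x = ((g⁻¹ : OrthGroup n) : E n →L[ℝ] E n) x := by
    rfl
  rw [h2] at h
  exact h

theorem continuous_rotate {n m : ℕ} (V : Grass n m) :
    Continuous fun g : OrthGroup n => rotate g V := by
  refine continuous_induced_rng.mpr ?_
  simp only [Function.comp_def, starProjection_rotate]
  exact (continuous_subtype_val.mul continuous_const).mul
    (continuous_subtype_val.comp continuous_inv)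

theorem continuous_rotate_right {n m : ℕ} (g : OrthGroup n) :
    Continuous fun V : Grass n m => rotate g V := by
  refine continuous_induced_rng.mpr ?_
  simp only [Function.comp_def, starProjection_rotate]
  have : Continuous fun V : Grass n m => V.1.starProjection := continuous_induced_dom
  exact (continuous_const.mul this).mul continuous_const

instance isProbabilityMeasure_gammaMeas {n m : ℕ} (hm : m ≤ n) :
    IsProbabilityMeasure (gammaMeas hm) :=
  Measure.isProbabilityMeasure_map (continuous_rotate _).measurable.aemeasurable

/-- `γ_{n,m}` is invariant under the action of `O(n)`. -/
theorem map_rotate_gammaMeas {n m : ℕ} (hm : m ≤ n) (g : OrthGroup n) :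
    (gammaMeas hm).map (rotate g) = gammaMeas hm := by
  have hmul : ∀ h : OrthGroup n, rotate g (rotate h (coordPlane hm)) =
      rotate (g * h) (coordPlane hm) := fun h => by
    refine Subtype.ext ?_
    simp only [rotate, ← Submodule.map_comp]
    congr 1
  rw [gammaMeas, Measure.map_map (continuous_rotate_right g).measurable
    (continuous_rotate _).measurable]
  have h1 : rotate g ∘ (fun h => rotate h (coordPlane hm)) =
      (fun h => rotate h (coordPlane hm)) ∘ fun h => g * h := funext hmul
  rw [h1, ← Measure.map_map (continuous_rotate _).measurable (measurable_const_mul g)]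
  congr 1
  exact map_mul_left_eq_self (Measure.haarMeasure ⊤) g

/-- The orthogonal projection `P_V(A) ⊆ V` of a set `A ⊆ ℝⁿ`, as a subset of `V`. -/
noncomputable def proj {n m : ℕ} (V : Grass n m) (A : Set (E n)) : Set V.1 :=
  (fun x => V.1.orthogonalProjectionOnto x) '' A

end ProjInter

/-!
By Frostman's lemma, `A` and `B` carry compactly supported probability measures `μ` and `ν` with
finite energies of orders `s` and `t`, where `s + t = 2m`. For a linear map `L : ℝⁿ → ℝᵐ` with
independent standard Gaussian entries the plane `(ker L)ᗮ` has law `γ_{n,m}`, and `L` is an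
isomorphism on it which takes the projections of `A` and `B` to `L A` and `L B`; so it suffices to
show that the intersection of `L A` and `L B` is large with positive probability.

Write `f` and `g` for the Fourier transforms of `L μ` and `L ν`. The mutual Gaussian energy
`E_a = Re ∫ exp(-a|ξ|²) f(ξ) conj(g(ξ)) dξ` is controlled on both sides. Its mean over `L` has a
positive lower bound as `a → 0`. On the other hand it is bounded, uniformly in `a`, by the sum of
the Fourier energies `∫ |f(ξ)|² |ξ|^{s-m} dξ` and `∫ |g(ξ)|² |ξ|^{t-m} dξ`, whose means are finite.
By dominated convergence `E_a` therefore cannot tend to zero for almost every `L`. But it does tend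
to zero if `L ν` gives no mass to a compact carrier of `L μ`, or, when `dim A, dim B > 2m` and `f`
and `g` are integrable, if the intersection of the carriers has empty interior.
-/

namespace ProjInter

/-! ### Dyadic net contents -/

section Dyadic

variable {n : ℕ}

/-- A dyadic cube: the pair `(k, z)` stands for the half-open cube `∏ᵢ [2⁻ᵏ zᵢ, 2⁻ᵏ (zᵢ + 1))`. Only
the cubes of side at most `1` are used, so that `k` is a natural number. -/
abbrev DyadicCube (n : ℕ) : Type := ℕ × (Fin n → ℤ)

/-- The position `z` of the dyadic cube `(k, z)` that contains `x`. -/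
noncomputable def dyadicIndex (k : ℕ) (x : E n) : Fin n → ℤ := fun i => ⌊(2 : ℝ) ^ k * x i⌋

/-- The position of the dyadic cube of twice the side that contains a given dyadic cube. -/
def parent (z : Fin n → ℤ) : Fin n → ℤ := fun i => z i / 2

theorem parent_dyadicIndex (k : ℕ) (x : E n) :
    parent (dyadicIndex (k + 1) x) = dyadicIndex k x := by
  funext i
  have h := Int.floor_div_natCast ((2 : ℝ) ^ (k + 1) * x i) 2
  rw [Nat.cast_ofNat, Nat.cast_ofNat, pow_succ, mul_right_comm, mul_div_cancel_right₀ _ two_ne_zero]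
    at h
  rw [dyadicIndex, h, parent, dyadicIndex, pow_succ, mul_right_comm]

theorem parent_iterate_dyadicIndex (j l : ℕ) (x : E n) :
    parent^[l] (dyadicIndex (j + l) x) = dyadicIndex j x := by
  induction l with
  | zero => rfl
  | succ l ih => rw [← add_assoc, Function.iterate_succ_apply, parent_dyadicIndex, ih]

theorem dyadicIndex_eq_of_le {j k : ℕ} (hjk : j ≤ k) {x y : E n}
    (h : dyadicIndex k x = dyadicIndex k y) : dyadicIndex j x = dyadicIndex j y := by
  obtain ⟨l, rfl⟩ := Nat.exists_eq_add_of_le hjk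
  rw [← parent_iterate_dyadicIndex j l, h, parent_iterate_dyadicIndex]

/-- The union of a family of dyadic cubes. -/
def cubeUnion (C : Set (DyadicCube n)) : Set (E n) := {x | ∃ k, (k, dyadicIndex k x) ∈ C}

theorem cubeUnion_mono {C D : Set (DyadicCube n)} (h : C ⊆ D) : cubeUnion C ⊆ cubeUnion D :=
  fun _ ⟨k, hk⟩ => ⟨k, h hk⟩

/-- The cubes of a family that are contained in no larger cube of the family. -/
def maxCubes (C : Set (DyadicCube n)) : Set (DyadicCube n) :=
  {c ∈ C | ∀ x : E n, dyadicIndex c.1 x = c.2 → ∀ j < c.1, (j, dyadicIndex j x) ∉ C}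

theorem maxCubes_subset (C : Set (DyadicCube n)) : maxCubes C ⊆ C := fun _ hc => hc.1

theorem cubeUnion_maxCubes (C : Set (DyadicCube n)) : cubeUnion (maxCubes C) = cubeUnion C := by
  classical
  refine (cubeUnion_mono (maxCubes_subset C)).antisymm fun x (hx : ∃ k, (k, dyadicIndex k x) ∈ C) =>
    ⟨Nat.find hx, Nat.find_spec hx, fun y hy j hj => ?_⟩
  rw [dyadicIndex_eq_of_le hj.le hy]
  exact Nat.find_min hx hj

theorem maxCubes_iUnion_subset (C : ℕ → Set (DyadicCube n)) :
    maxCubes (⋃ i, C i) ⊆ ⋃ k, ⋂ N ≥ k, maxCubes (⋃ i ≤ N, C i) := fun c hc => by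
  obtain ⟨i, hi⟩ := Set.mem_iUnion.1 hc.1
  refine Set.mem_iUnion.2 ⟨i, Set.mem_iInter₂.2 fun N hN => ⟨Set.mem_iUnion₂.2 ⟨i, hN, hi⟩,
    fun x hx j hj hmem => hc.2 x hx j hj ?_⟩⟩
  exact Set.iUnion₂_subset_iUnion _ _ hmem

/-- The measure on the set of dyadic cubes in `ℝⁿ` that gives the mass `2^(-k s)`, the `s`-th power
of the side, to the cube `(k, z)`. Sums over families of cubes become measures of sets. -/
noncomputable def cubeWeight (n : ℕ) (s : ℝ) : Measure (DyadicCube n) :=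
  Measure.count.withDensity fun c => ENNReal.ofReal ((2 : ℝ) ^ (-(c.1 * s)))

theorem cubeWeight_singleton (s : ℝ) (c : DyadicCube n) :
    cubeWeight n s {c} = ENNReal.ofReal ((2 : ℝ) ^ (-(c.1 * s))) := by
  rw [cubeWeight, withDensity_apply _ .of_discrete, lintegral_singleton, Measure.count_singleton,
    mul_one]

theorem cubeWeight_apply (s : ℝ) (C : Set (DyadicCube n)) :
    cubeWeight n s C = ∑' c, C.indicator (fun c => ENNReal.ofReal ((2 : ℝ) ^ (-(c.1 * s)))) c := by
  rw [cubeWeight, withDensity_apply _ .of_discrete, ← lintegral_indicator .of_discrete,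
    lintegral_count]

/-- The `s`-dimensional dyadic net content: the infimum of `∑ ℓ(Q)ˢ` over all coverings by dyadic
cubes `Q` of side `ℓ(Q) ≤ 1`. -/
noncomputable def netContent (s : ℝ) (S : Set (E n)) : ℝ≥0∞ :=
  ⨅ (C : Set (DyadicCube n)) (_ : S ⊆ cubeUnion C), cubeWeight n s C

theorem netContent_le {s : ℝ} {S : Set (E n)} {C : Set (DyadicCube n)} (h : S ⊆ cubeUnion C) :
    netContent s S ≤ cubeWeight n s C := iInf₂_le C h

theorem netContent_mono {s : ℝ} {S T : Set (E n)} (h : S ⊆ T) :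
    netContent s S ≤ netContent s T :=
  le_iInf₂ fun _ hC => netContent_le (h.trans hC)

theorem exists_cubeWeight_lt {s : ℝ} {S : Set (E n)} {c : ℝ≥0∞} (h : netContent s S < c) :
    ∃ C, S ⊆ cubeUnion C ∧ cubeWeight n s C < c := by
  simpa only [netContent, iInf_lt_iff, exists_prop] using h

theorem netContent_iUnion_le {ι : Type*} [Countable ι] {s : ℝ} (S : ι → Set (E n)) :
    netContent s (⋃ i, S i) ≤ ∑' i, netContent s (S i) := by
  refine ENNReal.le_of_forall_pos_le_add fun ε hε hfin => ?_
  obtain ⟨δ, hδ, hδε⟩ := ENNReal.exists_pos_sum_of_countable (ENNReal.coe_pos.2 hε).ne' ι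
  have hlt : ∀ i, netContent s (S i) < netContent s (S i) + δ i := fun i =>
    ENNReal.lt_add_right (ne_top_of_le_ne_top hfin.ne (ENNReal.le_tsum i))
      (ENNReal.coe_pos.2 (hδ i)).ne'
  choose C hC hCw using fun i => exists_cubeWeight_lt (hlt i)
  have hcov : (⋃ i, S i) ⊆ cubeUnion (⋃ i, C i) :=
    Set.iUnion_subset fun i => (hC i).trans (cubeUnion_mono (Set.subset_iUnion C i))
  calc netContent s (⋃ i, S i) ≤ cubeWeight n s (⋃ i, C i) := netContent_le hcov
    _ ≤ ∑' i, cubeWeight n s (C i) := measure_iUnion_le _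
    _ ≤ ∑' i, (netContent s (S i) + δ i) := ENNReal.tsum_le_tsum fun i => (hCw i).le
    _ = ∑' i, netContent s (S i) + ∑' i, (δ i : ℝ≥0∞) := ENNReal.tsum_add
    _ ≤ _ := by gcongr

theorem cubeWeight_maxCubes_union_add_netContent_le {s : ℝ} {S : Set (E n)}
    {C D : Set (DyadicCube n)} (hC : S ⊆ cubeUnion C) (hD : S ⊆ cubeUnion D) :
    cubeWeight n s (maxCubes (D ∪ C)) + netContent s S ≤
      cubeWeight n s (maxCubes D) + cubeWeight n s C := by
  set D' := maxCubes D
  set M := maxCubes (D ∪ C)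
  have hM : M ⊆ D' ∪ C := fun c hc =>
    hc.1.imp_left fun h => ⟨h, fun x hx j hj hjD => hc.2 x hx j hj (Or.inl hjD)⟩
  -- If the cubes of the two families that contain a point differ, the smaller one is not maximal.
  have hS : S ⊆ cubeUnion (((D' ∪ C) \ M) ∪ (D' ∩ C)) := fun x hx => by
    obtain ⟨k, hk⟩ := hC hx
    obtain ⟨j, hj⟩ : x ∈ cubeUnion D' := by rw [cubeUnion_maxCubes]; exact hD hx
    rcases lt_trichotomy j k with h | rfl | h
    · exact ⟨k, Or.inl ⟨Or.inr hk, fun hm => hm.2 x rfl j h (Or.inl hj.1)⟩⟩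
    · exact ⟨j, Or.inr ⟨hj, hk⟩⟩
    · exact ⟨j, Or.inl ⟨Or.inl hj, fun hm => hm.2 x rfl k h (Or.inr hk)⟩⟩
  calc cubeWeight n s M + netContent s S
      ≤ cubeWeight n s M + (cubeWeight n s ((D' ∪ C) \ M) + cubeWeight n s (D' ∩ C)) := by
        gcongr
        exact (netContent_le hS).trans (measure_union_le _ _)
    _ = cubeWeight n s (D' ∪ C) + cubeWeight n s (D' ∩ C) := by
        rw [← add_assoc, ← measure_union Set.disjoint_sdiff_right .of_discrete,
          Set.union_sdiff_cancel hM]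
    _ = _ := measure_union_add_inter _ .of_discrete

theorem cubeWeight_maxCubes_biUnion_le {s : ℝ} {S : ℕ → Set (E n)} (hS : Monotone S)
    (hfin : ∀ i, netContent s (S i) ≠ ∞) {C : ℕ → Set (DyadicCube n)}
    (hC : ∀ i, S i ⊆ cubeUnion (C i)) {δ : ℕ → ℝ≥0∞}
    (hCδ : ∀ i, cubeWeight n s (C i) ≤ netContent s (S i) + δ i) (N : ℕ) :
    cubeWeight n s (maxCubes (⋃ i ≤ N, C i)) ≤
      netContent s (S N) + ∑ i ∈ Finset.range (N + 1), δ i := by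
  induction N with
  | zero =>
    simp only [Nat.le_zero, Set.iUnion_iUnion_eq_left, zero_add, Finset.sum_range_one]
    exact (measure_mono (maxCubes_subset _)).trans (hCδ 0)
  | succ N ih =>
    have hcov : S N ⊆ cubeUnion (⋃ i ≤ N, C i) :=
      (hC N).trans (cubeUnion_mono (Set.subset_iUnion₂_of_subset N le_rfl subset_rfl))
    rw [Set.biUnion_le_succ C N, Finset.sum_range_succ]
    refine (ENNReal.add_le_add_iff_right (hfin N)).1 ?_
    calc _ ≤ cubeWeight n s (maxCubes (⋃ i ≤ N, C i)) + cubeWeight n s (C (N + 1)) :=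
          cubeWeight_maxCubes_union_add_netContent_le ((hS N.le_succ).trans (hC (N + 1))) hcov
      _ ≤ (netContent s (S N) + ∑ i ∈ Finset.range (N + 1), δ i) +
          (netContent s (S (N + 1)) + δ (N + 1)) := add_le_add ih (hCδ _)
      _ = _ := by ring

theorem netContent_iUnion_le_of_monotone {s : ℝ} {S : ℕ → Set (E n)} (hS : Monotone S)
    {c : ℝ≥0∞} (hc : ∀ i, netContent s (S i) ≤ c) : netContent s (⋃ i, S i) ≤ c := by
  refine ENNReal.le_of_forall_pos_le_add fun ε hε hfin => ?_
  obtain ⟨δ, hδ, hδε⟩ := ENNReal.exists_pos_sum_of_countable (ENNReal.coe_pos.2 hε).ne' ℕ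
  have hne : ∀ i, netContent s (S i) ≠ ∞ := fun i => ne_top_of_le_ne_top hfin.ne (hc i)
  choose C hC hCw using fun i => exists_cubeWeight_lt
    (ENNReal.lt_add_right (hne i) (ENNReal.coe_pos.2 (hδ i)).ne')
  have hcov : (⋃ i, S i) ⊆ cubeUnion (maxCubes (⋃ i, C i)) := by
    rw [cubeUnion_maxCubes]
    exact Set.iUnion_subset fun i => (hC i).trans (cubeUnion_mono (Set.subset_iUnion C i))
  have hbound : ∀ N, cubeWeight n s (maxCubes (⋃ i ≤ N, C i)) ≤ c + ε := fun N =>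
    (cubeWeight_maxCubes_biUnion_le hS hne hC (fun i => (hCw i).le) N).trans
      (add_le_add (hc N) ((ENNReal.sum_le_tsum _).trans hδε.le))
  calc netContent s (⋃ i, S i)
      ≤ cubeWeight n s (⋃ k, ⋂ N ≥ k, maxCubes (⋃ i ≤ N, C i)) :=
        (netContent_le hcov).trans (measure_mono (maxCubes_iUnion_subset C))
    _ = ⨆ k, cubeWeight n s (⋂ N ≥ k, maxCubes (⋃ i ≤ N, C i)) :=
        Monotone.measure_iUnion fun a b hab => Set.biInter_subset_biInter_left
          fun N (hN : N ≥ b) => hab.trans hN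
    _ ≤ c + ε := iSup_le fun k =>
        (measure_mono (Set.biInter_subset_of_mem (Set.mem_ofPred.2 le_rfl))).trans (hbound k)

/-- The positions of the cubes of the same side that touch a given dyadic cube, itself included. -/
noncomputable def neighbors (z : Fin n → ℤ) : Finset (Fin n → ℤ) :=
  Fintype.piFinset fun i => Finset.Icc (z i - 1) (z i + 1)

theorem card_neighbors (z : Fin n → ℤ) : (neighbors z).card = 3 ^ n := by
  have h : ∀ i, (Finset.Icc (z i - 1) (z i + 1)).card = 3 := fun i => by
    rw [Int.card_Icc]; omega
  rw [neighbors, Fintype.card_piFinset, Finset.prod_congr rfl fun i _ => h i, Finset.prod_const,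
    Finset.card_univ, Fintype.card_fin]

theorem dyadicIndex_mem_neighbors {k : ℕ} {x y : E n} (h : dist x y ≤ (2 : ℝ)⁻¹ ^ k) :
    dyadicIndex k y ∈ neighbors (dyadicIndex k x) := by
  refine Fintype.mem_piFinset.2 fun i => Finset.mem_Icc.2 ?_
  have hi : |x i - y i| ≤ (2 : ℝ)⁻¹ ^ k := by
    rw [dist_eq_norm] at h
    exact (PiLp.norm_apply_le (x - y) i).trans h
  have hscaled : |(2 : ℝ) ^ k * x i - 2 ^ k * y i| ≤ 1 := by
    rw [← mul_sub, abs_mul, abs_of_pos (by positivity)]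
    calc (2 : ℝ) ^ k * |x i - y i| ≤ 2 ^ k * 2⁻¹ ^ k := by gcongr
      _ = 1 := by rw [← mul_pow, mul_inv_cancel₀ two_ne_zero, one_pow]
  rw [abs_le] at hscaled
  simp only [dyadicIndex, sub_le_iff_le_add, ← Int.floor_add_one]
  exact ⟨Int.floor_le_floor (by linarith), Int.floor_le_floor (by linarith)⟩

/-- The cubes that touch a cube of the same side of the family `C`. -/
def touchingCubes (C : Set (DyadicCube n)) : Set (DyadicCube n) :=
  {c | ∃ z, (c.1, z) ∈ C ∧ c.2 ∈ neighbors z}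

theorem cubeWeight_preimage_add (s : ℝ) (C : Set (DyadicCube n)) (e : Fin n → ℤ) :
    cubeWeight n s ((fun c => (c.1, c.2 + e)) ⁻¹' C) = cubeWeight n s C := by
  rw [cubeWeight_apply, cubeWeight_apply,
    ← ((Equiv.refl ℕ).prodCongr (Equiv.addRight e)).tsum_eq
      (C.indicator fun c => ENNReal.ofReal ((2 : ℝ) ^ (-(c.1 * s))))]
  rfl

theorem cubeWeight_touchingCubes_le (s : ℝ) (C : Set (DyadicCube n)) :
    cubeWeight n s (touchingCubes C) ≤ 3 ^ n * cubeWeight n s C := by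
  have hsub : touchingCubes C ⊆
      ⋃ e ∈ neighbors (0 : Fin n → ℤ), (fun c => (c.1, c.2 + e)) ⁻¹' C := by
    rintro ⟨k, w⟩ ⟨z, hz, hw⟩
    refine Set.mem_iUnion₂.2 ⟨z - w, ?_, by simpa using hz⟩
    simp only [neighbors, Fintype.mem_piFinset, Finset.mem_Icc, Pi.sub_apply, Pi.zero_apply] at hw ⊢
    exact fun i => by have := hw i; omega
  calc cubeWeight n s (touchingCubes C)
      ≤ ∑ e ∈ neighbors (0 : Fin n → ℤ), cubeWeight n s ((fun c => (c.1, c.2 + e)) ⁻¹' C) :=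
        (measure_mono hsub).trans (measure_biUnion_finset_le _ _)
    _ = 3 ^ n * cubeWeight n s C := by
        simp only [cubeWeight_preimage_add, Finset.sum_const, card_neighbors, nsmul_eq_mul,
          Nat.cast_pow, Nat.cast_ofNat]

theorem exists_isOpen_subset_cubeUnion_touchingCubes (C : Set (DyadicCube n)) :
    ∃ O : Set (E n), IsOpen O ∧ cubeUnion C ⊆ O ∧ O ⊆ cubeUnion (touchingCubes C) := by
  refine ⟨⋃ x : E n, ⋃ k : ℕ, ⋃ _ : (k, dyadicIndex k x) ∈ C, Metric.ball x ((2 : ℝ)⁻¹ ^ k),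
    isOpen_iUnion fun x => isOpen_iUnion fun k => isOpen_iUnion fun _ => Metric.isOpen_ball,
    fun x ⟨k, hk⟩ => ?_, fun y hy => ?_⟩
  · simp only [Set.mem_iUnion]
    exact ⟨x, k, hk, Metric.mem_ball_self (by positivity)⟩
  · simp only [Set.mem_iUnion] at hy
    obtain ⟨x, k, hk, hy⟩ := hy
    exact ⟨k, _, hk, dyadicIndex_mem_neighbors (Metric.mem_ball'.1 hy).le⟩

end Dyadic

/-! ### Compact subsets of positive net content -/

section Capacity

variable {n : ℕ}

/-- The set of points of a dyadic cube. -/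
def DyadicCube.toSet (c : DyadicCube n) : Set (E n) := {x | dyadicIndex c.1 x = c.2}

theorem cubeUnion_eq_iUnion (C : Set (DyadicCube n)) :
    cubeUnion C = ⋃ c : C, DyadicCube.toSet c.1 := by
  ext x
  simp only [cubeUnion, DyadicCube.toSet, Set.mem_ofPred_eq, Set.mem_iUnion, Subtype.exists,
    Prod.exists, exists_prop, exists_eq_right']

theorem ediam_toSet_le (c : DyadicCube n) :
    Metric.ediam c.toSet ≤ n * ENNReal.ofReal ((2 : ℝ)⁻¹ ^ c.1) := by
  refine Metric.ediam_le fun x hx y hy => ?_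
  have hxy : ∀ i, dist (x i) (y i) ≤ (2 : ℝ)⁻¹ ^ c.1 := fun i => by
    have hfloor : ⌊(2 : ℝ) ^ c.1 * x i⌋ = ⌊(2 : ℝ) ^ c.1 * y i⌋ :=
      congrFun (hx.trans hy.symm) i
    have habs := (Int.abs_sub_lt_one_of_floor_eq_floor hfloor).le
    rwa [← mul_sub, abs_mul, abs_of_pos (by positivity), ← le_div_iff₀' (by positivity), one_div,
      ← inv_pow, ← Real.dist_eq] at habs
  rw [edist_dist, ← ENNReal.ofReal_natCast, ← ENNReal.ofReal_mul (by positivity),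
    EuclideanSpace.dist_eq]
  refine ENNReal.ofReal_le_ofReal (Real.sqrt_le_iff.2 ⟨by positivity, ?_⟩)
  calc ∑ i, dist (x i) (y i) ^ 2 ≤ ∑ _i : Fin n, ((2 : ℝ)⁻¹ ^ c.1) ^ 2 :=
        Finset.sum_le_sum fun i _ => pow_le_pow_left₀ dist_nonneg (hxy i) 2
    _ = n * ((2 : ℝ)⁻¹ ^ c.1) ^ 2 := by
        rw [Finset.sum_const, Finset.card_univ, Fintype.card_fin, nsmul_eq_mul]
    _ ≤ n ^ 2 * ((2 : ℝ)⁻¹ ^ c.1) ^ 2 := by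
        gcongr
        exact_mod_cast Nat.le_self_pow two_ne_zero n
    _ = (n * (2 : ℝ)⁻¹ ^ c.1) ^ 2 := (mul_pow _ _ 2).symm

theorem ofReal_two_inv_pow_eq_cubeWeight_rpow {s : ℝ} (hs : 0 < s) (c : DyadicCube n) :
    ENNReal.ofReal ((2 : ℝ)⁻¹ ^ c.1) = cubeWeight n s {c} ^ s⁻¹ := by
  rw [cubeWeight_singleton, ENNReal.ofReal_rpow_of_nonneg (by positivity) (by positivity),
    ← Real.rpow_mul (by positivity), neg_mul, mul_assoc, mul_inv_cancel₀ hs.ne', mul_one,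
    Real.rpow_neg (by positivity), Real.rpow_natCast, inv_pow]

theorem ediam_toSet_le_cubeWeight_rpow {s : ℝ} (hs : 0 < s) {C : Set (DyadicCube n)}
    {c : DyadicCube n} (hc : c ∈ C) : Metric.ediam c.toSet ≤ n * cubeWeight n s C ^ s⁻¹ := by
  refine (ediam_toSet_le c).trans ?_
  rw [ofReal_two_inv_pow_eq_cubeWeight_rpow hs]
  gcongr
  exact Set.singleton_subset_iff.2 hc

theorem tsum_ediam_toSet_rpow_le {s : ℝ} (hs : 0 < s) (C : Set (DyadicCube n)) :
    ∑' c : C, Metric.ediam c.1.toSet ^ s ≤ (n : ℝ≥0∞) ^ s * cubeWeight n s C := by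
  calc ∑' c : C, Metric.ediam c.1.toSet ^ s ≤ ∑' c : C, (n : ℝ≥0∞) ^ s * cubeWeight n s {c.1} := by
        refine ENNReal.tsum_le_tsum fun c => ?_
        refine (ENNReal.rpow_le_rpow (ediam_toSet_le_cubeWeight_rpow hs
          (Set.mem_singleton c.1)) hs.le).trans_eq ?_
        rw [ENNReal.mul_rpow_of_nonneg _ _ hs.le, ← ENNReal.rpow_mul, inv_mul_cancel₀ hs.ne',
          ENNReal.rpow_one]
    _ = (n : ℝ≥0∞) ^ s * cubeWeight n s C := by
        rw [ENNReal.tsum_mul_left, cubeWeight_apply, ← tsum_subtype C]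
        simp only [cubeWeight_singleton]

theorem hausdorffMeasure_eq_zero_of_netContent_eq_zero {s : ℝ} (hs : 0 < s) {S : Set (E n)}
    (h : netContent s S = 0) : μH[s] S = 0 := by
  have hlt : ∀ j : ℕ, netContent s S < (2 : ℝ≥0∞)⁻¹ ^ j := fun j => by
    rw [h]; exact ENNReal.pow_pos (ENNReal.inv_pos.2 ENNReal.ofNat_ne_top) j
  choose C hC hCw using fun j => exists_cubeWeight_lt (hlt j)
  have hlim : Filter.Tendsto (fun j => cubeWeight n s (C j)) Filter.atTop (𝓝 0) :=
    tendsto_of_tendsto_of_tendsto_of_le_of_le tendsto_const_nhds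
      (ENNReal.tendsto_pow_atTop_nhds_zero_of_lt_one ENNReal.one_half_lt_one)
      (fun _ => zero_le) fun j => (hCw j).le
  have hdiam : Filter.Tendsto (fun j => n * cubeWeight n s (C j) ^ s⁻¹) Filter.atTop (𝓝 0) := by
    simpa only [ENNReal.zero_rpow_of_pos (inv_pos.2 hs), mul_zero, Function.comp_def] using
      ENNReal.Tendsto.const_mul ((ENNReal.continuous_rpow_const (y := s⁻¹)).tendsto 0 |>.comp hlim)
        (Or.inr (ENNReal.natCast_ne_top n))
  have hsum : Filter.Tendsto (fun j => (n : ℝ≥0∞) ^ s * cubeWeight n s (C j)) Filter.atTop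
      (𝓝 0) := by
    simpa only [mul_zero] using ENNReal.Tendsto.const_mul hlim
      (Or.inr (ENNReal.rpow_ne_top_of_nonneg hs.le (ENNReal.natCast_ne_top n)))
  refine nonpos_iff_eq_zero.1 ?_
  calc μH[s] S
      ≤ Filter.liminf (fun j => ∑' c : C j, Metric.ediam c.1.toSet ^ s) Filter.atTop :=
        Measure.hausdorffMeasure_le_liminf_tsum s S _ hdiam (fun j (c : C j) => c.1.toSet)
          (.of_forall fun j c => ediam_toSet_le_cubeWeight_rpow hs c.2)
          (.of_forall fun j => (hC j).trans (cubeUnion_eq_iUnion _).subset)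
    _ ≤ Filter.liminf (fun j => (n : ℝ≥0∞) ^ s * cubeWeight n s (C j)) Filter.atTop :=
        Filter.liminf_le_liminf (.of_forall fun j => tsum_ediam_toSet_rpow_le hs (C j))
    _ = 0 := hsum.liminf_eq

section Choquet

variable {β : Type*} [LinearOrder β] {φ : Set (ℕ → ℕ) → β} {c : β}

theorem exists_update_lt_apply_box (hφ : Monotone φ)
    (hsup : ∀ S : ℕ → Set (ℕ → ℕ), Monotone S → (∀ j, φ (S j) ≤ c) → φ (⋃ j, S j) ≤ c)
    {k : ℕ} {v : ℕ → ℕ} (hv : c < φ {σ | ∀ i < k, σ i ≤ v i}) :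
    ∃ j, c < φ {σ | ∀ i < k + 1, σ i ≤ Function.update v k j i} := by
  by_contra! hcon
  have hmono : Monotone fun j => {σ : ℕ → ℕ | ∀ i < k + 1, σ i ≤ Function.update v k j i} :=
    fun a b hab σ hσ i hi =>
      (hσ i hi).trans (update_le_update_iff.2 ⟨hab, fun _ _ => le_rfl⟩ i)
  refine hv.not_ge ((hφ fun σ hσ => ?_).trans (hsup _ hmono hcon))
  refine Set.mem_iUnion.2 ⟨σ k, fun i hi => ?_⟩
  rcases eq_or_ne i k with rfl | hik
  · rw [Function.update_self]
  · rw [Function.update_of_ne hik]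
    exact hσ i (by omega)

/-- Choquet's argument: the bounds `N i` are chosen one coordinate at a time. -/
theorem exists_forall_lt_apply_box (hφ : Monotone φ)
    (hsup : ∀ S : ℕ → Set (ℕ → ℕ), Monotone S → (∀ j, φ (S j) ≤ c) → φ (⋃ j, S j) ≤ c)
    (hc : c < φ Set.univ) : ∃ N : ℕ → ℕ, ∀ k, c < φ {σ | ∀ i < k, σ i ≤ N i} := by
  choose! j hj using fun k v => exists_update_lt_apply_box hφ hsup (k := k) (v := v)
  let v : ℕ → ℕ → ℕ := fun k => Nat.rec 0 (fun k v => Function.update v k (j k v)) k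
  have hv : ∀ k, c < φ {σ | ∀ i < k, σ i ≤ v k i} := fun k => by
    induction k with
    | zero => simpa only [Nat.not_lt_zero, IsEmpty.forall_iff, implies_true, Set.ofPred_true]
    | succ k ih => exact hj k (v k) ih
  have hstab : ∀ i k, i < k → v k i = v (i + 1) i := fun i k hik => by
    induction k, Nat.succ_le_of_lt hik using Nat.le_induction with
    | base => rfl
    | succ k hk ih => exact (Function.update_of_ne (by omega) _ _).trans (ih (by omega))
  refine ⟨fun i => v (i + 1) i, fun k => ?_⟩
  have hbox : {σ : ℕ → ℕ | ∀ i < k, σ i ≤ v (i + 1) i} = {σ | ∀ i < k, σ i ≤ v k i} :=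
    Set.ext fun σ => forall₂_congr fun i hi => by rw [hstab i k hi]
  rw [hbox]
  exact hv k

end Choquet

theorem isCompact_Iic_nat_pi (N : ℕ → ℕ) : IsCompact (Set.Iic N) := by
  rw [← Set.pi_univ_Iic]
  exact isCompact_univ_pi fun i => (Set.finite_Iic (N i)).isCompact

theorem exists_box_subset_of_isOpen {N : ℕ → ℕ} {U : Set (ℕ → ℕ)} (hU : IsOpen U)
    (h : Set.Iic N ⊆ U) : ∃ k, {σ : ℕ → ℕ | ∀ i < k, σ i ≤ N i} ⊆ U := by
  let _ : MetricSpace (ℕ → ℕ) := PiNat.metricSpaceNatNat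
  obtain ⟨δ, hδ, hδU⟩ := (isCompact_Iic_nat_pi N).exists_thickening_subset_open hU h
  obtain ⟨k, hk⟩ := exists_pow_lt_of_lt_one hδ (one_half_lt_one (α := ℝ))
  refine ⟨k, fun σ hσ => hδU (Metric.mem_thickening_iff.2 ⟨σ ⊓ N,
    Set.mem_Iic.2 inf_le_right,
    lt_of_le_of_lt ?_ hk⟩)⟩
  exact PiNat.mem_cylinder_iff_dist_le.1 fun i hi => (min_eq_left (hσ i hi)).symm

theorem exists_isCompact_netContent_pos {s : ℝ} {A : Set (E n)} (hA : AnalyticSet A)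
    (h : 0 < netContent s A) : ∃ K ⊆ A, IsCompact K ∧ 0 < netContent s K := by
  obtain ⟨c, hc0, hc⟩ := exists_between h
  rw [AnalyticSet] at hA
  rcases hA with rfl | ⟨f, hf, rfl⟩
  · exact ⟨∅, subset_rfl, isCompact_empty, h⟩
  obtain ⟨N, hN⟩ := exists_forall_lt_apply_box (c := c) (φ := fun S => netContent s (f '' S))
    (fun _ _ hST => netContent_mono (Set.image_mono hST))
    (fun S hS hSc => by
      simp only [Set.image_iUnion]
      exact netContent_iUnion_le_of_monotone (fun _ _ hij => Set.image_mono (hS hij)) hSc)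
    (by rwa [Set.image_univ])
  refine ⟨f '' Set.Iic N, Set.image_subset_range _ _, (isCompact_Iic_nat_pi N).image hf,
    (ENNReal.div_pos hc0.ne' (ENNReal.pow_ne_top ENNReal.ofNat_ne_top)).trans_le
      (le_iInf₂ fun C hC => ENNReal.div_le_of_le_mul' (b := 3 ^ n) ?_)⟩
  obtain ⟨O, hO, hCO, hOC⟩ := exists_isOpen_subset_cubeUnion_touchingCubes C
  obtain ⟨k, hk⟩ := exists_box_subset_of_isOpen (hO.preimage hf)
    (Set.image_subset_iff.1 (hC.trans hCO))
  calc c ≤ netContent s (f '' {σ | ∀ i < k, σ i ≤ N i}) := (hN k).le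
    _ ≤ cubeWeight n s (touchingCubes C) := netContent_le ((Set.image_subset_iff.2 hk).trans hOC)
    _ ≤ 3 ^ n * cubeWeight n s C := cubeWeight_touchingCubes_le s C

theorem exists_isCompact_netContent_pos_of_lt_dimH {s : ℝ} (hs : 0 < s) {A : Set (E n)}
    (hA : AnalyticSet A) (h : ENNReal.ofReal s < dimH A) :
    ∃ K ⊆ A, IsCompact K ∧ 0 < netContent s K := by
  refine exists_isCompact_netContent_pos hA (pos_iff_ne_zero.2 fun h0 => ?_)
  have htop := hausdorffMeasure_of_lt_dimH (d := s.toNNReal) h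
  rw [Real.coe_toNNReal s hs.le, hausdorffMeasure_eq_zero_of_netContent_eq_zero hs h0] at htop
  exact ENNReal.zero_ne_top htop

end Capacity

/-! ### Frostman measures -/

section MassDistribution

variable {n : ℕ} {c : DyadicCube n → ℝ≥0∞} {z₀ : Fin n → ℤ}

/-- The positions of the dyadic cubes of half the side that a given dyadic cube contains. -/
noncomputable def children (p : Fin n → ℤ) : Finset (Fin n → ℤ) :=
  Fintype.piFinset fun i => Finset.Icc (2 * p i) (2 * p i + 1)

theorem mem_children {p z : Fin n → ℤ} : z ∈ children p ↔ parent z = p := by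
  simp only [children, Fintype.mem_piFinset, Finset.mem_Icc, parent, funext_iff]
  exact forall_congr' fun i => by omega

/-- Finite weights on the dyadic cubes that are subadditive under subdivision, such as the net
contents of the parts of a set that lie in the cubes. -/
structure IsSubadditiveWeight (c : DyadicCube n → ℝ≥0∞) : Prop where
  ne_top : ∀ Q, c Q ≠ ∞
  le_sum_children : ∀ k p, c (k, p) ≤ ∑ z ∈ children p, c (k + 1, z)

/-- The distribution of a unit mass over the dyadic cubes of side `2⁻ᵏ`, starting at the unit cube
at `z₀` and passing from a cube to its children proportionally to the weights `c`. A cube all of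
whose children have weight zero loses its mass, as `0 / 0 = 0`. -/
noncomputable def splitMass (c : DyadicCube n → ℝ≥0∞) (z₀ : Fin n → ℤ) :
    ℕ → (Fin n → ℤ) → ℝ≥0∞
  | 0 => Pi.single z₀ 1
  | k + 1 => fun z => splitMass c z₀ k (parent z) *
      (c (k + 1, z) / ∑ w ∈ children (parent z), c (k + 1, w))

theorem splitMass_le (hc : IsSubadditiveWeight c) (h0 : c (0, z₀) ≠ 0) (k : ℕ) (z : Fin n → ℤ) :
    splitMass c z₀ k z ≤ c (k, z) / c (0, z₀) := by
  induction k generalizing z with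
  | zero =>
    rcases eq_or_ne z z₀ with rfl | hz
    · rw [splitMass, Pi.single_eq_same, ENNReal.div_self h0 (hc.ne_top _)]
    · rw [splitMass, Pi.single_eq_of_ne hz]
      exact zero_le
  | succ k ih =>
    set total := ∑ w ∈ children (parent z), c (k + 1, w)
    calc splitMass c z₀ k (parent z) * (c (k + 1, z) / total)
        ≤ (total / c (0, z₀)) * (c (k + 1, z) / total) := by
          gcongr
          exact (ih _).trans (ENNReal.div_le_div_right (hc.le_sum_children k _) _)
      _ = (total / total) * (c (k + 1, z) / c (0, z₀)) := by
          simp only [div_eq_mul_inv]; ring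
      _ ≤ c (k + 1, z) / c (0, z₀) := mul_le_of_le_one_left zero_le ENNReal.div_self_le_one

theorem sum_splitMass (hc : IsSubadditiveWeight c) (h0 : c (0, z₀) ≠ 0) (k : ℕ)
    (p : Fin n → ℤ) : ∑ z ∈ children p, splitMass c z₀ (k + 1) z = splitMass c z₀ k p := by
  have hsplit : ∀ z ∈ children p, splitMass c z₀ (k + 1) z =
      splitMass c z₀ k p * (c (k + 1, z) * (∑ w ∈ children p, c (k + 1, w))⁻¹) := fun z hz => by
    simp only [splitMass, mem_children.1 hz, div_eq_mul_inv]
  rw [Finset.sum_congr rfl hsplit, ← Finset.mul_sum, ← Finset.sum_mul, ← div_eq_mul_inv]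
  by_cases htotal : ∑ w ∈ children p, c (k + 1, w) = 0
  · have hp : c (k, p) = 0 := nonpos_iff_eq_zero.1 ((hc.le_sum_children k p).trans_eq htotal)
    have hmass : splitMass c z₀ k p = 0 :=
      nonpos_iff_eq_zero.1 ((splitMass_le hc h0 k p).trans_eq (by rw [hp, ENNReal.zero_div]))
    rw [hmass, zero_mul]
  · rw [ENNReal.div_self htotal (ENNReal.sum_ne_top.2 fun w _ => hc.ne_top _), mul_one]

/-- The masses of the cubes of side `2⁻ᵏ`, as a measure on the set of their positions. -/
noncomputable def levelMeasure (c : DyadicCube n → ℝ≥0∞) (z₀ : Fin n → ℤ) (k : ℕ) :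
    Measure (Fin n → ℤ) := Measure.count.withDensity (splitMass c z₀ k)

theorem levelMeasure_finset (k : ℕ) (F : Finset (Fin n → ℤ)) :
    levelMeasure c z₀ k F = ∑ z ∈ F, splitMass c z₀ k z := by
  rw [← sum_measure_singleton]
  refine Finset.sum_congr rfl fun z _ => ?_
  rw [levelMeasure, withDensity_apply _ .of_discrete, lintegral_singleton, Measure.count_singleton,
    mul_one]

theorem map_parent_levelMeasure (hc : IsSubadditiveWeight c) (h0 : c (0, z₀) ≠ 0) (k : ℕ) :
    (levelMeasure c z₀ (k + 1)).map parent = levelMeasure c z₀ k := by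
  refine Measure.ext_of_singleton fun p => ?_
  have hpre : parent ⁻¹' {p} = (children p : Set (Fin n → ℤ)) :=
    Set.ext fun z => mem_children.symm
  rw [Measure.map_apply .of_discrete .of_discrete, hpre, levelMeasure_finset,
    sum_splitMass hc h0, ← Finset.coe_singleton, levelMeasure_finset, Finset.sum_singleton]

theorem map_parent_iterate_levelMeasure (hc : IsSubadditiveWeight c) (h0 : c (0, z₀) ≠ 0)
    (j l : ℕ) : (levelMeasure c z₀ (j + l)).map parent^[l] = levelMeasure c z₀ j := by
  induction l with
  | zero => exact Measure.map_id
  | succ l ih =>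
    rw [Function.iterate_succ, ← Measure.map_map .of_discrete .of_discrete, ← add_assoc,
      map_parent_levelMeasure hc h0, ih]

theorem isProbabilityMeasure_levelMeasure (hc : IsSubadditiveWeight c) (h0 : c (0, z₀) ≠ 0)
    (k : ℕ) : IsProbabilityMeasure (levelMeasure c z₀ k) := by
  have hzero : levelMeasure c z₀ 0 Set.univ = 1 := by
    rw [levelMeasure, withDensity_apply _ .of_discrete, Measure.restrict_univ, lintegral_count,
      splitMass, tsum_pi_single]
  have hmap := map_parent_iterate_levelMeasure hc h0 0 k
  rw [zero_add] at hmap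
  exact ⟨by rw [← hzero, ← hmap, Measure.map_apply .of_discrete .univ, Set.preimage_univ]⟩

theorem map_levelMeasure_ball_le (hc : IsSubadditiveWeight c) (h0 : c (0, z₀) ≠ 0) {j l : ℕ}
    {pt : (Fin n → ℤ) → E n} (hpt : ∀ z, c (j + l, z) ≠ 0 → dyadicIndex (j + l) (pt z) = z)
    (x : E n) : (levelMeasure c z₀ (j + l)).map pt (Metric.ball x ((2 : ℝ)⁻¹ ^ j)) ≤
      ∑ z ∈ neighbors (dyadicIndex j x), splitMass c z₀ j z := by
  have hae : ∀ᵐ z ∂levelMeasure c z₀ (j + l), splitMass c z₀ (j + l) z ≠ 0 := by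
    rw [levelMeasure, ae_withDensity_iff .of_discrete]
    exact .of_forall fun z hz => hz
  have hmem : ∀ z, splitMass c z₀ (j + l) z ≠ 0 → pt z ∈ Metric.ball x ((2 : ℝ)⁻¹ ^ j) →
      parent^[l] z ∈ neighbors (dyadicIndex j x) := fun z hz hzx => by
    have hcz : c (j + l, z) ≠ 0 := fun h =>
      hz (nonpos_iff_eq_zero.1 ((splitMass_le hc h0 _ z).trans_eq (by rw [h, ENNReal.zero_div])))
    rw [← hpt z hcz, parent_iterate_dyadicIndex]
    refine dyadicIndex_mem_neighbors ?_
    rw [dist_comm]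
    exact (Metric.mem_ball.1 hzx).le
  calc (levelMeasure c z₀ (j + l)).map pt (Metric.ball x ((2 : ℝ)⁻¹ ^ j))
      = levelMeasure c z₀ (j + l) (pt ⁻¹' Metric.ball x ((2 : ℝ)⁻¹ ^ j)) :=
        Measure.map_apply .of_discrete Metric.isOpen_ball.measurableSet
    _ ≤ levelMeasure c z₀ (j + l) (parent^[l] ⁻¹' neighbors (dyadicIndex j x)) :=
        measure_mono_ae (hae.mono fun z hz hzx => hmem z hz hzx)
    _ = ∑ z ∈ neighbors (dyadicIndex j x), splitMass c z₀ j z := by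
        rw [← Measure.map_apply .of_discrete .of_discrete, map_parent_iterate_levelMeasure hc h0,
          levelMeasure_finset]

end MassDistribution

section Frostman

variable {n : ℕ} {s : ℝ} {K : Set (E n)}

/-- The net content of the part of `K` in a dyadic cube. -/
noncomputable def cubeContent (s : ℝ) (K : Set (E n)) (Q : DyadicCube n) : ℝ≥0∞ :=
  netContent s (K ∩ Q.toSet)

theorem cubeContent_le (s : ℝ) (K : Set (E n)) (Q : DyadicCube n) :
    cubeContent s K Q ≤ ENNReal.ofReal ((2 : ℝ) ^ (-(Q.1 * s))) := by
  rw [← cubeWeight_singleton s Q]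
  exact netContent_le fun x hx => ⟨Q.1, Set.mem_singleton_iff.2 (Prod.ext rfl hx.2)⟩

theorem isSubadditiveWeight_cubeContent (s : ℝ) (K : Set (E n)) :
    IsSubadditiveWeight (cubeContent s K) where
  ne_top Q := ne_top_of_le_ne_top ENNReal.ofReal_ne_top (cubeContent_le s K Q)
  le_sum_children k p := by
    have hcover : K ∩ DyadicCube.toSet (k, p) ⊆
        ⋃ z : children p, K ∩ DyadicCube.toSet (k + 1, (z : Fin n → ℤ)) := fun x hx =>
      Set.mem_iUnion.2 ⟨⟨dyadicIndex (k + 1) x,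
        mem_children.2 ((parent_dyadicIndex k x).trans hx.2)⟩, hx.1, rfl⟩
    rw [← Finset.sum_coe_sort, ← tsum_fintype (L := .unconditional _)]
    exact (netContent_mono hcover).trans (netContent_iUnion_le _)

theorem exists_cubeContent_zero_ne_zero (hK : 0 < netContent s K) :
    ∃ z, cubeContent s K (0, z) ≠ 0 := by
  by_contra! hzero
  have hcover : K ⊆ ⋃ z, K ∩ DyadicCube.toSet (0, z) := fun x hx => 
    Set.mem_iUnion.2 ⟨dyadicIndex 0 x, hx, rfl⟩
  refine hK.not_ge (((netContent_mono hcover).trans (netContent_iUnion_le _)).trans_eq ?_)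
  exact ENNReal.tsum_eq_zero.2 hzero

theorem nonempty_inter_of_cubeContent_ne_zero {Q : DyadicCube n} (h : cubeContent s K Q ≠ 0) :
    (K ∩ Q.toSet).Nonempty := by
  by_contra! hempty
  refine h (nonpos_iff_eq_zero.1 ((netContent_le (C := ∅) ?_).trans_eq measure_empty))
  rw [hempty]
  exact Set.empty_subset _

theorem sum_neighbors_splitMass_cubeContent_le {z₀ : Fin n → ℤ} (h0 : cubeContent s K (0, z₀) ≠ 0)
    (j : ℕ) (w : Fin n → ℤ) : ∑ z ∈ neighbors w, splitMass (cubeContent s K) z₀ j z ≤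
      3 ^ n / cubeContent s K (0, z₀) * ENNReal.ofReal ((2 : ℝ) ^ (-(j * s))) := by
  calc ∑ z ∈ neighbors w, splitMass (cubeContent s K) z₀ j z
      ≤ ∑ _z ∈ neighbors w, ENNReal.ofReal ((2 : ℝ) ^ (-(j * s))) / cubeContent s K (0, z₀) :=
        Finset.sum_le_sum fun z _ =>
          (splitMass_le (isSubadditiveWeight_cubeContent s K) h0 j z).trans
            (ENNReal.div_le_div_right (cubeContent_le s K (j, z)) _)
    _ = 3 ^ n / cubeContent s K (0, z₀) * ENNReal.ofReal ((2 : ℝ) ^ (-(j * s))) := by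
        rw [Finset.sum_const, card_neighbors, nsmul_eq_mul, div_eq_mul_inv, div_eq_mul_inv,
          Nat.cast_pow, Nat.cast_ofNat]
        ring

theorem exists_limit_probabilityMeasure {X : Type*} [TopologicalSpace X]
    [TopologicalSpace.PseudoMetrizableSpace X] [T2Space X] [CompactSpace X] [MeasurableSpace X]
    [BorelSpace X] (μ : ℕ → ProbabilityMeasure X) :
    ∃ ν : ProbabilityMeasure X, ∀ U : Set X, IsOpen U → ∀ b : ℝ≥0∞,
      (∀ᶠ k in Filter.atTop, (μ k : Measure X) U ≤ b) → (ν : Measure X) U ≤ b := by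
  obtain ⟨ν, -, hν⟩ := isCompact_univ.ultrafilter_le_nhds ((Filter.hyperfilter ℕ).map μ)
    (Filter.le_principal_iff.2 Filter.univ_mem)
  have hlim : Filter.Tendsto μ (Filter.hyperfilter ℕ : Filter ℕ) (𝓝 ν) := hν
  refine ⟨ν, fun U hU b hb => ?_⟩
  refine (ProbabilityMeasure.le_liminf_measure_open_of_tendsto hlim hU).trans ?_
  exact Filter.liminf_le_of_frequently_le
    (hb.filter_mono Nat.hyperfilter_le_atTop).frequently

/-- **Frostman's lemma**: the measure is a weak limit of discrete measures that distribute a unit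
mass according to the net contents of the parts of `K` in the dyadic cubes. -/
theorem exists_frostman (hK : IsCompact K) (hpos : 0 < netContent s K) :
    ∃ μ : Measure (E n), IsProbabilityMeasure μ ∧ μ Kᶜ = 0 ∧ ∃ C : ℝ≥0∞, C ≠ ∞ ∧
      ∀ (x : E n) (j : ℕ), μ (Metric.ball x ((2 : ℝ)⁻¹ ^ j)) ≤
        C * ENNReal.ofReal ((2 : ℝ) ^ (-(j * s))) := by
  have hc := isSubadditiveWeight_cubeContent s K
  obtain ⟨z₀, h0⟩ := exists_cubeContent_zero_ne_zero hpos
  have : CompactSpace K := isCompact_iff_compactSpace.1 hK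
  have : Nonempty K :=
    ((nonempty_inter_of_cubeContent_ne_zero h0).mono Set.inter_subset_left).to_subtype
  have hpoint : ∀ k z, ∃ x : K, cubeContent s K (k, z) ≠ 0 → dyadicIndex k (x : E n) = z :=
    fun k z => by
      by_cases hz : cubeContent s K (k, z) = 0
      · exact ⟨Classical.arbitrary K, fun h => (h hz).elim⟩
      · obtain ⟨x, hxK, hxz⟩ := nonempty_inter_of_cubeContent_ne_zero hz
        exact ⟨⟨x, hxK⟩, fun _ => hxz⟩
  choose pt hpt using hpoint
  have := isProbabilityMeasure_levelMeasure hc h0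
  obtain ⟨ν, hν⟩ := exists_limit_probabilityMeasure fun k =>
    ⟨(levelMeasure (cubeContent s K) z₀ k).map (pt k),
      Measure.isProbabilityMeasure_map Measurable.of_discrete.aemeasurable⟩
  refine ⟨(ν : Measure K).map Subtype.val,
    Measure.isProbabilityMeasure_map measurable_subtype_coe.aemeasurable, ?_,
    3 ^ n / cubeContent s K (0, z₀),
    ENNReal.div_ne_top (ENNReal.pow_ne_top ENNReal.ofNat_ne_top) h0, fun x j => ?_⟩
  · rw [Measure.map_apply measurable_subtype_coe hK.measurableSet.compl, Set.preimage_compl,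
      Subtype.coe_preimage_self, Set.compl_univ, measure_empty]
  rw [Measure.map_apply measurable_subtype_coe Metric.isOpen_ball.measurableSet]
  refine hν _ (Metric.isOpen_ball.preimage continuous_subtype_val) _
    ((Filter.eventually_ge_atTop j).mono fun k hjk => ?_)
  obtain ⟨l, rfl⟩ := Nat.exists_eq_add_of_le hjk
  rw [ProbabilityMeasure.coe_mk, ← Measure.map_apply measurable_subtype_coe
    Metric.isOpen_ball.measurableSet, Measure.map_map measurable_subtype_coe .of_discrete]
  exact (map_levelMeasure_ball_le hc h0 (hpt (j + l)) x).trans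
    (sum_neighbors_splitMass_cubeContent_le h0 j _)

end Frostman

section Energy

/-- The `p`-energy `∫∫ |x - y|⁻ᵖ dμ dμ` of a measure; atoms make it infinite for `p > 0`. -/
noncomputable def energy {X : Type*} [PseudoEMetricSpace X] [MeasurableSpace X] (p : ℝ)
    (μ : Measure X) : ℝ≥0∞ := ∫⁻ x, ∫⁻ y, edist x y ^ (-p) ∂μ ∂μ

theorem exists_two_inv_pow_le_lt {d : ℝ} (h0 : 0 < d) (h1 : d < 1) :
    ∃ i : ℕ, (2 : ℝ)⁻¹ ^ (i + 2) ≤ d ∧ d < (2 : ℝ)⁻¹ ^ i := by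
  obtain ⟨j, hj, hdj⟩ := exists_nat_pow_near_of_lt_one h0 h1.le (y := 2⁻¹) (by norm_num)
    (by norm_num)
  rcases j with - | j
  · exact ⟨0, le_trans (by norm_num) hj.le, by rwa [pow_zero]⟩
  · exact ⟨j, hj.le, hdj.trans_lt
      (pow_lt_pow_right_of_lt_one₀ (by norm_num) (by norm_num) j.lt_succ_self)⟩

theorem tsum_indicator_ball_eq_top {X : Type*} [PseudoMetricSpace X] {p : ℝ} (hp : 0 < p)
    {x y : X} (h : dist y x = 0) :
    ∑' j : ℕ, (Metric.ball x ((2 : ℝ)⁻¹ ^ j)).indicator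
      (fun _ => ENNReal.ofReal ((2 : ℝ) ^ ((j + 2) * p))) y = ∞ := by
  have hone : ∀ j : ℕ, (1 : ℝ≥0∞) ≤ (Metric.ball x ((2 : ℝ)⁻¹ ^ j)).indicator
      (fun _ => ENNReal.ofReal ((2 : ℝ) ^ ((j + 2) * p))) y := fun j => by
    rw [Set.indicator_of_mem (by rw [Metric.mem_ball, h]; positivity), ← ENNReal.ofReal_one]
    exact ENNReal.ofReal_le_ofReal (Real.one_le_rpow one_le_two (by positivity))
  refine top_le_iff.1 (le_trans ?_ (ENNReal.tsum_le_tsum hone))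
  rw [ENNReal.tsum_const_eq_top_of_ne_zero one_ne_zero]

theorem edist_rpow_neg_le_tsum {X : Type*} [PseudoMetricSpace X] {p : ℝ} (hp : 0 < p) (x y : X) :
    edist x y ^ (-p) ≤ 1 + ∑' j : ℕ, (Metric.ball x ((2 : ℝ)⁻¹ ^ j)).indicator
      (fun _ => ENNReal.ofReal ((2 : ℝ) ^ ((j + 2) * p))) y := by
  rcases eq_or_ne (dist y x) 0 with h0 | h0
  · rw [tsum_indicator_ball_eq_top hp h0, add_top]
    exact le_top
  have hd : 0 < dist y x := dist_nonneg.lt_of_ne' h0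
  rw [edist_comm, edist_dist, ENNReal.ofReal_rpow_of_pos hd]
  rcases le_or_gt 1 (dist y x) with h1 | h1
  · refine le_trans ?_ le_self_add
    rw [← ENNReal.ofReal_one]
    exact ENNReal.ofReal_le_ofReal (Real.rpow_le_one_of_one_le_of_nonpos h1 (by linarith))
  obtain ⟨i, hi, hdi⟩ := exists_two_inv_pow_le_lt hd h1
  refine le_trans ?_ (le_add_left (ENNReal.le_tsum i))
  rw [Set.indicator_of_mem (Metric.mem_ball.2 hdi)]
  refine ENNReal.ofReal_le_ofReal ?_
  calc dist y x ^ (-p) ≤ ((2 : ℝ)⁻¹ ^ (i + 2)) ^ (-p) :=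
        Real.rpow_le_rpow_of_nonpos (by positivity) hi (by linarith)
    _ = (2 : ℝ) ^ ((i + 2) * p) := by
        rw [inv_pow, Real.inv_rpow (by positivity), Real.rpow_neg (by positivity), inv_inv,
          ← Real.rpow_natCast, ← Real.rpow_mul (by positivity), Nat.cast_add, Nat.cast_ofNat]

theorem lintegral_edist_rpow_neg_le {X : Type*} [PseudoMetricSpace X] [MeasurableSpace X]
    [OpensMeasurableSpace X] {μ : Measure X} [IsProbabilityMeasure μ] {p s : ℝ} (hp : 0 < p)
    {C : ℝ≥0∞} (hball : ∀ (x : X) (j : ℕ), μ (Metric.ball x ((2 : ℝ)⁻¹ ^ j)) ≤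
      C * ENNReal.ofReal ((2 : ℝ) ^ (-(j * s)))) (x : X) :
    ∫⁻ y, edist x y ^ (-p) ∂μ ≤
      1 + C * ENNReal.ofReal (2 ^ (2 * p)) * (1 - ENNReal.ofReal (2 ^ (p - s)))⁻¹ := by
  have hterm : ∀ j : ℕ, ENNReal.ofReal ((2 : ℝ) ^ ((j + 2) * p)) *
      (C * ENNReal.ofReal ((2 : ℝ) ^ (-(j * s)))) =
      C * ENNReal.ofReal (2 ^ (2 * p)) * ENNReal.ofReal (2 ^ (p - s)) ^ j := fun j => by
    rw [mul_left_comm, mul_assoc, ← ENNReal.ofReal_pow (by positivity),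
      ← ENNReal.ofReal_mul (by positivity), ← ENNReal.ofReal_mul (by positivity),
      ← Real.rpow_natCast, ← Real.rpow_mul (by positivity), ← Real.rpow_add (by positivity),
      ← Real.rpow_add (by positivity)]
    congr 3; ring
  calc ∫⁻ y, edist x y ^ (-p) ∂μ
      ≤ ∫⁻ y, (1 + ∑' j : ℕ, (Metric.ball x ((2 : ℝ)⁻¹ ^ j)).indicator
        (fun _ => ENNReal.ofReal ((2 : ℝ) ^ ((j + 2) * p))) y) ∂μ :=
        lintegral_mono fun y => edist_rpow_neg_le_tsum hp x y
    _ = 1 + ∑' j : ℕ, ENNReal.ofReal ((2 : ℝ) ^ ((j + 2) * p)) *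
          μ (Metric.ball x ((2 : ℝ)⁻¹ ^ j)) := by
        rw [lintegral_add_left measurable_const, lintegral_const, measure_univ, mul_one,
          lintegral_tsum fun j => (measurable_const.indicator
            Metric.isOpen_ball.measurableSet).aemeasurable]
        simp_rw [lintegral_indicator_const Metric.isOpen_ball.measurableSet]
    _ ≤ 1 + ∑' j : ℕ, C * ENNReal.ofReal (2 ^ (2 * p)) * ENNReal.ofReal (2 ^ (p - s)) ^ j := by
        gcongr 1 + ∑' j, ?_ with j
        exact (mul_le_mul_right (hball x j) _).trans_eq (hterm j)
    _ = _ := by rw [ENNReal.tsum_mul_left, ENNReal.tsum_geometric]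

theorem exists_measure_energy_ne_top {n : ℕ} {p : ℝ} (hp : 0 < p) {A : Set (E n)}
    (hA : AnalyticSet A) (h : ENNReal.ofReal p < dimH A) :
    ∃ K ⊆ A, IsCompact K ∧ ∃ μ : Measure (E n),
      IsProbabilityMeasure μ ∧ μ Kᶜ = 0 ∧ energy p μ ≠ ∞ := by
  obtain ⟨s, hs, hsA⟩ := ENNReal.lt_iff_exists_nnreal_btwn.1 h
  have hps : p < s := by
    rwa [← ENNReal.ofReal_coe_nnreal, ENNReal.ofReal_lt_ofReal_iff_of_nonneg hp.le] at hs
  obtain ⟨K, hKA, hK, hKpos⟩ := exists_isCompact_netContent_pos_of_lt_dimH (hp.trans hps) hA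
    (by rwa [ENNReal.ofReal_coe_nnreal])
  obtain ⟨μ, hμ, hμK, C, hC, hball⟩ := exists_frostman hK hKpos
  refine ⟨K, hKA, hK, μ, hμ, hμK,
    ne_top_of_le_ne_top ?_ (lintegral_mono (lintegral_edist_rpow_neg_le hp hball))⟩
  rw [lintegral_const, measure_univ, mul_one]
  refine ENNReal.add_ne_top.2 ⟨ENNReal.one_ne_top, ENNReal.mul_ne_top
    (ENNReal.mul_ne_top hC ENNReal.ofReal_ne_top) ?_⟩
  rw [ENNReal.inv_ne_top, ← pos_iff_ne_zero, tsub_pos_iff_lt, ← ENNReal.ofReal_one]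
  exact (ENNReal.ofReal_lt_ofReal_iff one_pos).2
    (Real.rpow_lt_one_of_one_lt_of_neg one_lt_two (by linarith))

end Energy

/-! ### Gaussian kernels and Fourier transforms of measures -/

section GaussKernel

variable {F : Type*} [NormedAddCommGroup F] [InnerProductSpace ℝ F]

/-- The Fourier transform of `ξ ↦ exp (-a ‖ξ‖²)`, without normalization: its mass is `(2π)ᵈ`. -/
noncomputable def gaussKernel (a : ℝ) (w : F) : ℝ :=
  (Real.pi / a) ^ ((Module.finrank ℝ F : ℝ) / 2) * Real.exp (-‖w‖ ^ 2 / (4 * a))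

theorem gaussKernel_nonneg {a : ℝ} (ha : 0 < a) (w : F) : 0 ≤ gaussKernel a w := by
  unfold gaussKernel; positivity

theorem continuous_gaussKernel (a : ℝ) : Continuous (gaussKernel a : F → ℝ) := by
  unfold gaussKernel; fun_prop

theorem gaussKernel_le {a : ℝ} (ha : 0 < a) (w : F) :
    gaussKernel a w ≤ (Real.pi / a) ^ ((Module.finrank ℝ F : ℝ) / 2) := by
  refine mul_le_of_le_one_right (by positivity) (Real.exp_le_one_iff.2 ?_)
  rw [neg_div]
  exact neg_nonpos.2 (by positivity)

theorem norm_cexp_neg_mul_sq_norm_add (a : ℝ) (v w : F) :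
    ‖Complex.exp (-a * ‖v‖ ^ 2 + Complex.I * inner ℝ w v)‖ = Real.exp (-a * ‖v‖ ^ 2) := by
  rw [Complex.norm_exp]
  congr 1
  simp [← Complex.ofReal_pow]

variable [MeasurableSpace F]

/-- The mutual Gaussian energy `∫∫ k_a(x - y) dμ(x) dν(y)` of two measures, where `k_a` is the
Gaussian kernel; as `a → 0` it tends formally to a multiple of the integral of the product of the
densities. -/
noncomputable def gaussEnergy (a : ℝ) (μ ν : Measure F) : ℝ≥0∞ :=
  ∫⁻ z, ENNReal.ofReal (gaussKernel a (z.1 - z.2)) ∂(μ.prod ν)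

variable [FiniteDimensional ℝ F]

theorem charFun_mul_conj_charFun (μ ν : Measure F) [IsFiniteMeasure μ] [IsFiniteMeasure ν]
    (ξ : F) : charFun μ ξ * (starRingEnd ℂ) (charFun ν ξ) =
      ∫ z, Complex.exp (Complex.I * inner ℝ (z.1 - z.2) ξ) ∂(μ.prod ν) := by
  rw [← charFun_neg, charFun_apply, charFun_apply, ← integral_prod_mul]
  congr with z
  rw [← Complex.exp_add, inner_sub_left, inner_neg_right]
  push_cast
  ring_nf

variable [BorelSpace F]

theorem integral_cexp_eq_gaussKernel {a : ℝ} (ha : 0 < a) (w : F) :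
    ∫ v : F, Complex.exp (-a * ‖v‖ ^ 2 + Complex.I * inner ℝ w v) = gaussKernel a w := by
  rw [GaussianFourier.integral_cexp_neg_mul_sq_norm_add (by rwa [Complex.ofReal_re]), gaussKernel]
  push_cast
  rw [Complex.I_sq, Complex.ofReal_cpow (by positivity)]
  push_cast
  congr 2
  ring

theorem integrable_exp_neg_mul_sq_norm {a : ℝ} (ha : 0 < a) :
    Integrable fun v : F => Real.exp (-a * ‖v‖ ^ 2) :=
  (GaussianFourier.integrable_cexp_neg_mul_sq_norm_add (b := a) (by rwa [Complex.ofReal_re])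
    Complex.I (0 : F)).norm.congr (.of_forall fun v => norm_cexp_neg_mul_sq_norm_add a v 0)

theorem integrable_gaussKernel_sub {a : ℝ} (ha : 0 < a) (μ ν : Measure F) [IsFiniteMeasure μ]
    [IsFiniteMeasure ν] : Integrable (fun z : F × F => gaussKernel a (z.1 - z.2)) (μ.prod ν) := by
  refine Integrable.of_bound ((continuous_gaussKernel a).comp
    (continuous_fst.sub continuous_snd)).aestronglyMeasurable
    ((Real.pi / a) ^ ((Module.finrank ℝ F : ℝ) / 2)) (.of_forall fun z => ?_)
  rw [Real.norm_of_nonneg (gaussKernel_nonneg ha _)]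
  exact gaussKernel_le ha _

theorem integral_gaussKernel_prod {a : ℝ} (ha : 0 < a) (μ ν : Measure F) [IsFiniteMeasure μ]
    [IsFiniteMeasure ν] :
    ((∫ z, gaussKernel a (z.1 - z.2) ∂(μ.prod ν) : ℝ) : ℂ) =
      ∫ ξ : F, (Real.exp (-a * ‖ξ‖ ^ 2) : ℂ) * (charFun μ ξ * (starRingEnd ℂ) (charFun ν ξ)) := by
  have hfourier : ∀ ξ : F,
      (Real.exp (-a * ‖ξ‖ ^ 2) : ℂ) * (charFun μ ξ * (starRingEnd ℂ) (charFun ν ξ)) =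
      ∫ z, Complex.exp (-a * ‖ξ‖ ^ 2 + Complex.I * inner ℝ (z.1 - z.2) ξ) ∂(μ.prod ν) := fun ξ => by
    rw [charFun_mul_conj_charFun, ← integral_const_mul]
    congr with z
    rw [Complex.exp_add]
    push_cast
    rfl
  simp_rw [hfourier]
  rw [integral_integral_swap]
  · simp_rw [integral_cexp_eq_gaussKernel ha]
    rw [integral_complex_ofReal]
  · refine Integrable.mono' ((integrable_exp_neg_mul_sq_norm (F := F) ha).comp_fst (μ.prod ν)) ?_
      (.of_forall fun z => (norm_cexp_neg_mul_sq_norm_add a z.1 _).le)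
    refine Continuous.aestronglyMeasurable ?_
    simp only [Function.uncurry_def]
    fun_prop

theorem gaussEnergy_eq_ofReal {a : ℝ} (ha : 0 < a) (μ ν : Measure F) [IsFiniteMeasure μ]
    [IsFiniteMeasure ν] :
    gaussEnergy a μ ν = ENNReal.ofReal (∫ z, gaussKernel a (z.1 - z.2) ∂(μ.prod ν)) :=
  (ofReal_integral_eq_lintegral_ofReal (integrable_gaussKernel_sub ha μ ν)
    (.of_forall fun _ => gaussKernel_nonneg ha _)).symm

theorem gaussEnergy_eq_enorm_integral {a : ℝ} (ha : 0 < a) (μ ν : Measure F) [IsFiniteMeasure μ]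
    [IsFiniteMeasure ν] : gaussEnergy a μ ν = ‖∫ ξ : F, (Real.exp (-a * ‖ξ‖ ^ 2) : ℂ) *
      (charFun μ ξ * (starRingEnd ℂ) (charFun ν ξ))‖ₑ := by
  rw [← integral_gaussKernel_prod ha, gaussEnergy_eq_ofReal ha, ← ofReal_norm, Complex.norm_real,
    Real.norm_of_nonneg (integral_nonneg fun _ => gaussKernel_nonneg ha _)]

theorem gaussEnergy_le {a : ℝ} (ha : 0 < a) (μ ν : Measure F) [IsFiniteMeasure μ]
    [IsFiniteMeasure ν] : gaussEnergy a μ ν ≤ ∫⁻ ξ, ‖charFun μ ξ‖ₑ * ‖charFun ν ξ‖ₑ := by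
  have hexp : ∀ ξ : F, ‖(Real.exp (-a * ‖ξ‖ ^ 2) : ℂ)‖ₑ ≤ 1 := fun ξ => by
    rw [← ofReal_norm, Complex.norm_real, Real.norm_of_nonneg (Real.exp_nonneg _),
      ENNReal.ofReal_le_one, Real.exp_le_one_iff, neg_mul]
    exact neg_nonpos.2 (by positivity)
  calc gaussEnergy a μ ν
      ≤ ∫⁻ ξ : F, ‖(Real.exp (-a * ‖ξ‖ ^ 2) : ℂ) *
          (charFun μ ξ * (starRingEnd ℂ) (charFun ν ξ))‖ₑ := by
        rw [gaussEnergy_eq_enorm_integral ha]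
        exact enorm_integral_le_lintegral_enorm _
    _ ≤ ∫⁻ ξ, ‖charFun μ ξ‖ₑ * ‖charFun ν ξ‖ₑ := lintegral_mono fun ξ => by
        rw [enorm_mul, enorm_mul, RCLike.enorm_conj]
        exact mul_le_of_le_one_left' (hexp ξ)

theorem gaussEnergy_self {a : ℝ} (ha : 0 < a) (μ : Measure F) [IsFiniteMeasure μ] :
    gaussEnergy a μ μ =
      ∫⁻ ξ, ENNReal.ofReal (Real.exp (-a * ‖ξ‖ ^ 2)) * ‖charFun μ ξ‖ₑ ^ 2 := by
  have hreal : ∀ ξ : F,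
      (Real.exp (-a * ‖ξ‖ ^ 2) : ℂ) * (charFun μ ξ * (starRingEnd ℂ) (charFun μ ξ)) =
      ((Real.exp (-a * ‖ξ‖ ^ 2) * ‖charFun μ ξ‖ ^ 2 : ℝ) : ℂ) := fun ξ => by
    rw [Complex.mul_conj, Complex.normSq_eq_norm_sq, Complex.ofReal_mul]
  have hparseval := integral_gaussKernel_prod ha μ μ
  simp_rw [hreal] at hparseval
  rw [integral_complex_ofReal, Complex.ofReal_inj] at hparseval
  rw [gaussEnergy_eq_ofReal ha, hparseval, ofReal_integral_eq_lintegral_ofReal]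
  · refine lintegral_congr fun ξ => ?_
    rw [ENNReal.ofReal_mul (Real.exp_nonneg _), ENNReal.ofReal_pow (norm_nonneg _), ofReal_norm]
  · refine (integrable_exp_neg_mul_sq_norm ha).mul_bdd (c := μ.real Set.univ ^ 2)
      ((measurable_charFun (μ := μ)).norm.pow_const 2).aestronglyMeasurable (.of_forall fun ξ => ?_)
    rw [Real.norm_of_nonneg (by positivity)]
    exact pow_le_pow_left₀ (norm_nonneg _) (norm_charFun_le ξ) 2
  · exact .of_forall fun ξ => by positivity

/-- The Fourier side `∫ |μ̂(ξ)|² |ξ|ᵖ⁻ᵈ dξ` of the `p`-energy of a measure in dimension `d`. -/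
noncomputable def fourierEnergy (p : ℝ) (μ : Measure F) : ℝ≥0∞ :=
  ∫⁻ ξ : F, ‖charFun μ ξ‖ₑ ^ 2 * ‖ξ‖ₑ ^ (p - Module.finrank ℝ F)

theorem mul_le_mul_sq_add_inv_mul_sq {x y c : ℝ≥0∞} (h0 : c ≠ 0) (htop : c ≠ ∞) :
    x * y ≤ c * x ^ 2 + c⁻¹ * y ^ 2 := by
  rcases le_total y (c * x) with h | h
  · refine le_add_right ?_
    calc x * y ≤ x * (c * x) := by gcongr
      _ = c * x ^ 2 := by ring
  · refine le_add_left ?_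
    have hx : x ≤ c⁻¹ * y := by
      rwa [mul_comm, ← div_eq_mul_inv, ENNReal.le_div_iff_mul_le (Or.inl h0) (Or.inl htop),
        mul_comm]
    calc x * y ≤ (c⁻¹ * y) * y := by gcongr
      _ = c⁻¹ * y ^ 2 := by ring

theorem lintegral_charFun_mul_le [Nontrivial F] {s t : ℝ} (hst : s + t = 2 * Module.finrank ℝ F)
    {c : ℝ≥0∞} (h0 : c ≠ 0) (htop : c ≠ ∞) (μ ν : Measure F) [IsFiniteMeasure μ] :
    ∫⁻ ξ, ‖charFun μ ξ‖ₑ * ‖charFun ν ξ‖ₑ ≤ c * fourierEnergy s μ + c⁻¹ * fourierEnergy t ν := by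
  have hpoint : ∀ ξ : F, ξ ≠ 0 → ‖charFun μ ξ‖ₑ * ‖charFun ν ξ‖ₑ ≤
      c * (‖charFun μ ξ‖ₑ ^ 2 * ‖ξ‖ₑ ^ (s - Module.finrank ℝ F)) +
        c⁻¹ * (‖charFun ν ξ‖ₑ ^ 2 * ‖ξ‖ₑ ^ (t - Module.finrank ℝ F)) := fun ξ hξ => by
    have hξ0 : ‖ξ‖ₑ ≠ 0 := enorm_ne_zero.2 hξ
    have hinv : ‖ξ‖ₑ ^ (t - Module.finrank ℝ F) = (‖ξ‖ₑ ^ (s - Module.finrank ℝ F))⁻¹ := by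
      rw [← ENNReal.rpow_neg]; congr 1; linarith
    refine (mul_le_mul_sq_add_inv_mul_sq (c := c * ‖ξ‖ₑ ^ (s - Module.finrank ℝ F))
      (mul_ne_zero h0 (ENNReal.rpow_pos (pos_iff_ne_zero.2 hξ0) enorm_ne_top).ne')
      (ENNReal.mul_ne_top htop (ENNReal.rpow_ne_top_of_ne_zero hξ0 enorm_ne_top))).trans_eq ?_
    rw [hinv, ENNReal.mul_inv (Or.inl h0) (Or.inl htop)]
    ring
  refine (lintegral_mono_ae ((Measure.ae_ne volume 0).mono hpoint)).trans_eq ?_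
  rw [lintegral_add_left, lintegral_const_mul' _ _ htop,
    lintegral_const_mul' _ _ (ENNReal.inv_ne_top.2 h0), fourierEnergy, fourierEnergy]
  exact (((measurable_charFun (μ := μ)).enorm.pow_const 2).mul
    (measurable_enorm.pow_const _)).const_mul c

end GaussKernel

/-! ### Energies and Fourier transforms -/

section Subordination

theorem lintegral_ofReal_of_integral_pos {f : ℝ → ℝ} {S : Set ℝ} (hS : MeasurableSet S)
    (hf : ∀ x ∈ S, 0 ≤ f x) (h : 0 < ∫ x in S, f x) :
    ∫⁻ x in S, ENNReal.ofReal (f x) = ENNReal.ofReal (∫ x in S, f x) :=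
  (ofReal_integral_eq_lintegral_ofReal (Integrable.of_integral_ne_zero h.ne')
    ((ae_restrict_iff' hS).2 (.of_forall hf))).symm

theorem lintegral_rpow_mul_exp_neg {q r : ℝ} (hq : 0 < q) (hr : 0 < r) :
    ∫⁻ a in Set.Ioi 0, ENNReal.ofReal (a ^ (q - 1) * Real.exp (-(r * a))) =
      ENNReal.ofReal ((1 / r) ^ q * Real.Gamma q) := by
  have h := Real.integral_rpow_mul_exp_neg_mul_Ioi hq hr
  rw [lintegral_ofReal_of_integral_pos measurableSet_Ioi, h]
  · intro x (hx : 0 < x); positivity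
  · rw [h]; positivity

theorem integral_rpow_mul_exp_neg_div {q r : ℝ} (hq : 0 < q) (hr : 0 < r) :
    ∫ a in Set.Ioi 0, a ^ (-q - 1) * Real.exp (-(r / a)) = (1 / r) ^ q * Real.Gamma q := by
  rw [← Real.integral_rpow_mul_exp_neg_mul_Ioi hq hr,
    ← integral_comp_rpow_Ioi (fun t => t ^ (q - 1) * Real.exp (-(r * t)))
      (neg_ne_zero.2 one_ne_zero : (-1 : ℝ) ≠ 0)]
  refine setIntegral_congr_fun measurableSet_Ioi fun x (hx : 0 < x) => ?_
  rw [smul_eq_mul, ← Real.rpow_mul hx.le, abs_neg, abs_one, one_mul, ← mul_assoc,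
    ← Real.rpow_add hx, Real.rpow_neg_one, div_eq_mul_inv]
  congr 2
  ring

theorem lintegral_rpow_mul_exp_neg_div {q r : ℝ} (hq : 0 < q) (hr : 0 < r) :
    ∫⁻ a in Set.Ioi 0, ENNReal.ofReal (a ^ (-q - 1) * Real.exp (-(r / a))) =
      ENNReal.ofReal ((1 / r) ^ q * Real.Gamma q) := by
  have h := integral_rpow_mul_exp_neg_div hq hr
  rw [lintegral_ofReal_of_integral_pos measurableSet_Ioi, h]
  · intro x (hx : 0 < x); positivity
  · rw [h]; positivity

theorem lintegral_rpow_Ioi_eq_top (r : ℝ) :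
    ∫⁻ a in Set.Ioi (0 : ℝ), ENNReal.ofReal (a ^ r) = ∞ := by
  by_contra hfin
  refine not_integrableOn_Ioi_rpow r ⟨by fun_prop, ?_⟩
  rw [hasFiniteIntegral_iff_ofReal]
  · exact lt_top_iff_ne_top.2 hfin
  · exact (ae_restrict_iff' measurableSet_Ioi).2
      (.of_forall fun x (hx : 0 < x) => (Real.rpow_pos_of_pos hx _).le)

variable {F : Type*} [NormedAddCommGroup F]

theorem lintegral_rpow_mul_exp_neg_sq_norm {q : ℝ} (hq : 0 < q) {ξ : F} (hξ : ξ ≠ 0) :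
    ∫⁻ a in Set.Ioi 0, ENNReal.ofReal (a ^ (q - 1) * Real.exp (-a * ‖ξ‖ ^ 2)) =
      ENNReal.ofReal (Real.Gamma q) * ‖ξ‖ₑ ^ (-(2 * q)) := by
  have hn : 0 < ‖ξ‖ := norm_pos_iff.2 hξ
  have h := lintegral_rpow_mul_exp_neg hq (pow_pos hn 2)
  simp only [mul_comm (‖ξ‖ ^ 2)] at h
  simp only [neg_mul]
  rw [h, mul_comm, ENNReal.ofReal_mul (by positivity), ← ofReal_norm, ENNReal.ofReal_rpow_of_pos hn,
    one_div, Real.inv_rpow (by positivity), ← Real.rpow_natCast, ← Real.rpow_mul hn.le,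
    Real.rpow_neg hn.le, Nat.cast_ofNat]

theorem lintegral_rpow_mul_exp_neg_sq_norm_div {p : ℝ} (hp : 0 < p) (w : F) :
    ∫⁻ a in Set.Ioi 0, ENNReal.ofReal (a ^ (-(p / 2) - 1) * Real.exp (-(‖w‖ ^ 2 / 4 / a))) =
      ENNReal.ofReal (4 ^ (p / 2) * Real.Gamma (p / 2)) * ‖w‖ₑ ^ (-p) := by
  rcases eq_or_ne w 0 with rfl | hw
  · have hpos : 0 < 4 ^ (p / 2) * Real.Gamma (p / 2) := by positivity
    rw [enorm_zero, ENNReal.zero_rpow_of_neg (neg_lt_zero.2 hp),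
      ENNReal.mul_top (ENNReal.ofReal_pos.2 hpos).ne']
    simp only [norm_zero, ne_eq, OfNat.ofNat_ne_zero, not_false_eq_true, zero_pow, zero_div,
      neg_zero, Real.exp_zero, mul_one]
    exact lintegral_rpow_Ioi_eq_top _
  · have hn : 0 < ‖w‖ := norm_pos_iff.2 hw
    rw [lintegral_rpow_mul_exp_neg_div (by positivity) (by positivity), ← ofReal_norm,
      ENNReal.ofReal_rpow_of_pos hn, ← ENNReal.ofReal_mul (by positivity), one_div_div,
      Real.div_rpow (by positivity) (by positivity), ← Real.rpow_natCast ‖w‖ 2,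
      ← Real.rpow_mul hn.le, Real.rpow_neg hn.le, Nat.cast_ofNat, mul_div_cancel₀ p two_ne_zero]
    congr 1
    ring

variable [InnerProductSpace ℝ F]

theorem rpow_mul_gaussKernel {a : ℝ} (ha : 0 < a) (p : ℝ) (w : F) :
    a ^ ((Module.finrank ℝ F - p) / 2 - 1) * gaussKernel a w =
      Real.pi ^ ((Module.finrank ℝ F : ℝ) / 2) *
        (a ^ (-(p / 2) - 1) * Real.exp (-(‖w‖ ^ 2 / 4 / a))) := by
  set d : ℝ := (Module.finrank ℝ F : ℝ) with hd
  have hsplit : a ^ ((d - p) / 2 - 1) = a ^ (-(p / 2) - 1) * a ^ (d / 2) := by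
    rw [← Real.rpow_add ha]; congr 1; ring
  have hne : a ^ (d / 2) ≠ 0 := (Real.rpow_pos_of_pos ha _).ne'
  rw [gaussKernel, Real.div_rpow Real.pi_pos.le ha.le, ← hd, hsplit, neg_div, ← div_div]
  field_simp

theorem lintegral_rpow_mul_gaussKernel {p : ℝ} (hp : 0 < p) (w : F) :
    ∫⁻ a in Set.Ioi 0, ENNReal.ofReal (a ^ ((Module.finrank ℝ F - p) / 2 - 1)) *
        ENNReal.ofReal (gaussKernel a w) =
      ENNReal.ofReal (Real.pi ^ ((Module.finrank ℝ F : ℝ) / 2) *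
        (4 ^ (p / 2) * Real.Gamma (p / 2))) * ‖w‖ₑ ^ (-p) := by
  rw [ENNReal.ofReal_mul (by positivity), mul_assoc, ← lintegral_rpow_mul_exp_neg_sq_norm_div hp,
    ← lintegral_const_mul' _ _ ENNReal.ofReal_ne_top]
  refine setLIntegral_congr_fun measurableSet_Ioi fun a (ha : 0 < a) => ?_
  rw [← ENNReal.ofReal_mul (by positivity), ← ENNReal.ofReal_mul (by positivity),
    rpow_mul_gaussKernel ha]

variable [FiniteDimensional ℝ F] [MeasurableSpace F] [BorelSpace F]

theorem energy_eq_lintegral_prod (p : ℝ) (μ : Measure F) [SFinite μ] :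
    energy p μ = ∫⁻ z, ‖z.1 - z.2‖ₑ ^ (-p) ∂(μ.prod μ) := by
  rw [lintegral_prod _ (by fun_prop)]
  simp only [energy, edist_eq_enorm_sub]

theorem lintegral_rpow_mul_gaussEnergy {p : ℝ} (hp : 0 < p) (μ : Measure F) [SFinite μ] :
    ∫⁻ a in Set.Ioi (0 : ℝ), ENNReal.ofReal (a ^ ((Module.finrank ℝ F - p) / 2 - 1)) *
        gaussEnergy a μ μ =
      ENNReal.ofReal (Real.pi ^ ((Module.finrank ℝ F : ℝ) / 2) *
        (4 ^ (p / 2) * Real.Gamma (p / 2))) * energy p μ := by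
  have hmeas : Measurable fun z : ℝ × (F × F) =>
      ENNReal.ofReal (z.1 ^ ((Module.finrank ℝ F - p) / 2 - 1)) *
        ENNReal.ofReal (gaussKernel z.1 (z.2.1 - z.2.2)) := by
    unfold gaussKernel
    fun_prop
  simp only [gaussEnergy, ← lintegral_const_mul' _ _ ENNReal.ofReal_ne_top]
  rw [lintegral_lintegral_swap hmeas.aemeasurable, energy_eq_lintegral_prod,
    ← lintegral_const_mul' _ _ ENNReal.ofReal_ne_top]
  exact lintegral_congr fun z => lintegral_rpow_mul_gaussKernel hp _

theorem ofReal_Gamma_mul_fourierEnergy [Nontrivial F] {p : ℝ} (hp : p < Module.finrank ℝ F)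
    (μ : Measure F) [IsFiniteMeasure μ] :
    ENNReal.ofReal (Real.Gamma ((Module.finrank ℝ F - p) / 2)) * fourierEnergy p μ =
      ∫⁻ a in Set.Ioi (0 : ℝ), ENNReal.ofReal (a ^ ((Module.finrank ℝ F - p) / 2 - 1)) *
        gaussEnergy a μ μ := by
  set q : ℝ := (Module.finrank ℝ F - p) / 2 with hq
  have hmeas : Measurable fun z : F × ℝ => ENNReal.ofReal (z.2 ^ (q - 1)) *
      (ENNReal.ofReal (Real.exp (-z.2 * ‖z.1‖ ^ 2)) * ‖charFun μ z.1‖ₑ ^ 2) := by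
    have := measurable_charFun (μ := μ)
    fun_prop
  have hfreq : ∀ ξ : F, ξ ≠ 0 →
      ENNReal.ofReal (Real.Gamma q) * (‖charFun μ ξ‖ₑ ^ 2 * ‖ξ‖ₑ ^ (p - Module.finrank ℝ F)) =
      ∫⁻ a in Set.Ioi (0 : ℝ), ENNReal.ofReal (a ^ (q - 1)) *
        (ENNReal.ofReal (Real.exp (-a * ‖ξ‖ ^ 2)) * ‖charFun μ ξ‖ₑ ^ 2) := fun ξ hξ => by
    rw [show p - Module.finrank ℝ F = -(2 * q) by rw [hq]; ring, mul_left_comm,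
      ← lintegral_rpow_mul_exp_neg_sq_norm (by linarith) hξ,
      ← lintegral_const_mul' _ _ (by finiteness)]
    refine setLIntegral_congr_fun measurableSet_Ioi fun a (ha : 0 < a) => ?_
    rw [ENNReal.ofReal_mul (by positivity)]
    ring
  rw [fourierEnergy, ← lintegral_const_mul' _ _ ENNReal.ofReal_ne_top,
    lintegral_congr_ae ((Measure.ae_ne volume 0).mono hfreq),
    lintegral_lintegral_swap hmeas.aemeasurable]
  refine setLIntegral_congr_fun measurableSet_Ioi fun a (ha : 0 < a) => ?_
  rw [lintegral_const_mul' _ _ ENNReal.ofReal_ne_top, ← gaussEnergy_self ha]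

/-- Both sides are obtained by integrating the Gaussian self-energies against powers of `a`. -/
theorem exists_fourierEnergy_eq [Nontrivial F] {p : ℝ} (hp : 0 < p)
    (hpd : p < Module.finrank ℝ F) : ∃ C : ℝ≥0∞, C ≠ 0 ∧ C ≠ ∞ ∧
      ∀ (μ : Measure F) [IsFiniteMeasure μ], fourierEnergy p μ = C * energy p μ := by
  set C₁ := ENNReal.ofReal (Real.Gamma ((Module.finrank ℝ F - p) / 2))
  set C₂ := ENNReal.ofReal (Real.pi ^ ((Module.finrank ℝ F : ℝ) / 2) *
    (4 ^ (p / 2) * Real.Gamma (p / 2)))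
  have hC₁ : C₁ ≠ 0 := (ENNReal.ofReal_pos.2 (Real.Gamma_pos_of_pos (by linarith))).ne'
  have hC₁_top : C₁ ≠ ∞ := ENNReal.ofReal_ne_top
  have hC₂ : C₂ ≠ 0 := (ENNReal.ofReal_pos.2 (by positivity)).ne'
  refine ⟨C₁⁻¹ * C₂, mul_ne_zero (ENNReal.inv_ne_zero.2 hC₁_top) hC₂,
    ENNReal.mul_ne_top (ENNReal.inv_ne_top.2 hC₁) ENNReal.ofReal_ne_top, fun μ _ => ?_⟩
  have heq : C₁ * fourierEnergy p μ = C₂ * energy p μ :=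
    (ofReal_Gamma_mul_fourierEnergy hpd μ).trans (lintegral_rpow_mul_gaussEnergy hp μ)
  rw [mul_assoc, ← heq, ← mul_assoc, ENNReal.inv_mul_cancel hC₁ hC₁_top, one_mul]

end Subordination

/-! ### Smoothing by Gaussian kernels -/

section Smoothing

open Filter

variable {F : Type*} [NormedAddCommGroup F] [InnerProductSpace ℝ F]

theorem gaussKernel_neg (a : ℝ) (w : F) : gaussKernel a (-w) = gaussKernel a w := by
  simp [gaussKernel]

theorem sqrt_pow_finrank_mul_gaussKernel_smul {a : ℝ} (ha : 0 < a) (w : F) :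
    √a ^ Module.finrank ℝ F * gaussKernel a (√a • w) = gaussKernel 1 w := by
  have hsqrt : √a ^ Module.finrank ℝ F = a ^ ((Module.finrank ℝ F : ℝ) / 2) := by
    rw [Real.sqrt_eq_rpow, ← Real.rpow_natCast, ← Real.rpow_mul ha.le]
    congr 1; ring
  rw [hsqrt, gaussKernel, gaussKernel, norm_smul, mul_pow, Real.norm_of_nonneg (Real.sqrt_nonneg _),
    Real.sq_sqrt ha.le, Real.div_rpow Real.pi_pos.le ha.le, div_one, ← mul_assoc,
    mul_div_cancel₀ _ (Real.rpow_pos_of_pos ha _).ne']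
  congr 2
  field_simp

theorem gaussKernel_le_of_le_norm {a r : ℝ} (ha : 0 < a) (hr : 0 ≤ r) {w : F} (h : r ≤ ‖w‖) :
    gaussKernel a w ≤ Real.pi ^ ((Module.finrank ℝ F : ℝ) / 2) *
      (a⁻¹ ^ ((Module.finrank ℝ F : ℝ) / 2) * Real.exp (-(r ^ 2 / 4) * a⁻¹)) := by
  rw [gaussKernel, div_eq_mul_inv, Real.mul_rpow Real.pi_pos.le (by positivity), mul_assoc]
  have hexp : -‖w‖ ^ 2 / (4 * a) = -(‖w‖ ^ 2 / 4) * a⁻¹ := by field_simp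
  rw [hexp]
  gcongr

theorem indicator_le_liminf_indicator_add_sqrt_smul {U : Set F} (hU : IsOpen U) (x w : F) :
    U.indicator (1 : F → ℝ≥0∞) x ≤ liminf (fun a : ℝ => U.indicator 1 (x + √a • w)) (𝓝[>] 0) := by
  by_cases hx : x ∈ U
  · have hcont : Continuous fun a : ℝ => x + √a • w := by fun_prop
    have ht : Tendsto (fun a : ℝ => x + √a • w) (𝓝[>] 0) (𝓝 x) := by
      simpa using (hcont.tendsto 0).mono_left nhdsWithin_le_nhds
    refine le_liminf_of_le (by isBoundedDefault)
      ((ht.eventually (hU.mem_nhds hx)).mono fun a ha => ?_)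
    rw [Set.indicator_of_mem hx, Set.indicator_of_mem ha, Pi.one_apply, Pi.one_apply]
  · simp [hx]

variable [MeasurableSpace F]

theorem tendsto_gaussEnergy_of_le_dist {μ ν : Measure F} [IsFiniteMeasure μ] [IsFiniteMeasure ν]
    {r : ℝ} (hr : 0 < r) (h : ∀ᵐ z ∂(μ.prod ν), r ≤ dist z.1 z.2) :
    Tendsto (fun a => gaussEnergy a μ ν) (𝓝[>] 0) (𝓝 0) := by
  set d : ℝ := (Module.finrank ℝ F : ℝ)
  have hlim : Tendsto (fun a : ℝ => ENNReal.ofReal (Real.pi ^ (d / 2) *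
      (a⁻¹ ^ (d / 2) * Real.exp (-(r ^ 2 / 4) * a⁻¹))) * (μ.prod ν) Set.univ) (𝓝[>] 0) (𝓝 0) := by
    have hreal := ((tendsto_rpow_mul_exp_neg_mul_atTop_nhds_zero (d / 2) (r ^ 2 / 4)
      (by positivity)).comp tendsto_inv_nhdsGT_zero).const_mul (Real.pi ^ (d / 2))
    have hofReal := ENNReal.tendsto_ofReal hreal
    rw [mul_zero, ENNReal.ofReal_zero] at hofReal
    simpa using ENNReal.Tendsto.mul_const hofReal (Or.inr (measure_ne_top (μ.prod ν) Set.univ))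
  refine tendsto_of_tendsto_of_tendsto_of_le_of_le' tendsto_const_nhds hlim
    (.of_forall fun _ => zero_le) ?_
  filter_upwards [self_mem_nhdsWithin] with a (ha : 0 < a)
  rw [← lintegral_const]
  refine lintegral_mono_ae (h.mono fun z hz => ENNReal.ofReal_le_ofReal ?_)
  exact gaussKernel_le_of_le_norm ha hr.le (by rwa [← dist_eq_norm])

theorem tendsto_ofReal_exp_neg_mul (b : ℝ) :
    Tendsto (fun a => ENNReal.ofReal (Real.exp (-a * b))) (𝓝[>] 0) (𝓝 1) := by
  have hcont : Continuous fun a : ℝ => ENNReal.ofReal (Real.exp (-a * b)) :=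
    ENNReal.continuous_ofReal.comp (by fun_prop)
  simpa using (hcont.tendsto 0).mono_left nhdsWithin_le_nhds

variable [FiniteDimensional ℝ F] [BorelSpace F]

theorem ofReal_pow_mul_lintegral_comp_smul {r : ℝ} (hr : 0 < r) {g : F → ℝ≥0∞}
    (hg : Measurable g) :
    ENNReal.ofReal (r ^ Module.finrank ℝ F) * ∫⁻ w, g (r • w) = ∫⁻ w, g w := by
  rw [← lintegral_map hg (measurable_const_smul r), Measure.map_addHaar_smul volume hr.ne',
    lintegral_smul_measure, smul_eq_mul, ← mul_assoc, ← ENNReal.ofReal_mul (by positivity),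
    abs_of_pos (by positivity), mul_inv_cancel₀ (by positivity), ENNReal.ofReal_one, one_mul]

theorem lintegral_mul_gaussKernel {a : ℝ} (ha : 0 < a) {h : F → ℝ≥0∞} (hh : Measurable h) (x : F) :
    ∫⁻ z, h z * ENNReal.ofReal (gaussKernel a (x - z)) =
      ∫⁻ w, h (x + √a • w) * ENNReal.ofReal (gaussKernel 1 w) := by
  have hK : Measurable (gaussKernel a : F → ℝ) := (continuous_gaussKernel a).measurable
  rw [← lintegral_add_left_eq_self _ x, ← ofReal_pow_mul_lintegral_comp_smul (Real.sqrt_pos.2 ha)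
    (by fun_prop), ← lintegral_const_mul' _ _ ENNReal.ofReal_ne_top]
  refine lintegral_congr fun w => ?_
  rw [← sqrt_pow_finrank_mul_gaussKernel_smul ha w, sub_add_cancel_left, gaussKernel_neg,
    ENNReal.ofReal_mul (by positivity)]
  ring

variable (F) in
/-- The common mass of the Gaussian kernels `gaussKernel a`, `a > 0`. -/
noncomputable def gaussMass : ℝ≥0∞ := ∫⁻ w : F, ENNReal.ofReal (gaussKernel 1 w)

theorem gaussMass_ne_zero : gaussMass F ≠ 0 := by
  intro h
  rw [gaussMass, lintegral_eq_zero_iff (continuous_gaussKernel 1).measurable.ennreal_ofReal] at h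
  obtain ⟨w, hw⟩ := h.exists
  have hpos : 0 < gaussKernel 1 w := by unfold gaussKernel; positivity
  simp [hpos.not_ge] at hw

theorem gaussMass_ne_top : gaussMass F ≠ ∞ := by
  have h : Integrable (gaussKernel 1 : F → ℝ) := by
    refine ((integrable_exp_neg_mul_sq_norm (F := F) (a := 1 / 4) (by norm_num)).const_mul
      ((Real.pi / 1) ^ ((Module.finrank ℝ F : ℝ) / 2))).congr (.of_forall fun w => ?_)
    simp only [gaussKernel]
    congr 2; ring
  exact h.lintegral_lt_top.ne

theorem measurable_ofReal_gaussKernel_sub (a : ℝ) :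
    Measurable fun z : F × F => ENNReal.ofReal (gaussKernel a (z.1 - z.2)) :=
  ((continuous_gaussKernel a).comp (continuous_fst.sub continuous_snd)).measurable.ennreal_ofReal

theorem gaussEnergy_dirac (a : ℝ) (μ : Measure F) [SFinite μ] (u : F) :
    gaussEnergy a μ (Measure.dirac u) = ∫⁻ x, ENNReal.ofReal (gaussKernel a (x - u)) ∂μ := by
  rw [gaussEnergy, lintegral_prod _ (measurable_ofReal_gaussKernel_sub a).aemeasurable]
  exact lintegral_congr fun x =>
    lintegral_dirac' u ((measurable_ofReal_gaussKernel_sub a).comp measurable_prodMk_left)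

theorem measurable_gaussEnergy_dirac (a : ℝ) (μ : Measure F) [SFinite μ] :
    Measurable fun u => gaussEnergy a μ (Measure.dirac u) := by
  simp_rw [gaussEnergy_dirac]
  exact (measurable_ofReal_gaussKernel_sub a).lintegral_prod_left'

theorem gaussEnergy_eq_lintegral_dirac (a : ℝ) (μ ν : Measure F) [SFinite μ] [SFinite ν] :
    gaussEnergy a μ ν = ∫⁻ u, gaussEnergy a μ (Measure.dirac u) ∂ν := by
  rw [gaussEnergy, lintegral_prod_symm _ (measurable_ofReal_gaussKernel_sub a).aemeasurable]
  simp_rw [gaussEnergy_dirac]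

theorem gaussEnergy_restrict_volume {a : ℝ} (ha : 0 < a) (μ : Measure F) [SFinite μ] {U : Set F}
    (hU : MeasurableSet U) : gaussEnergy a μ (volume.restrict U) =
      ∫⁻ x, (∫⁻ w, U.indicator 1 (x + √a • w) * ENNReal.ofReal (gaussKernel 1 w)) ∂μ := by
  rw [gaussEnergy, lintegral_prod _ (measurable_ofReal_gaussKernel_sub a).aemeasurable]
  refine lintegral_congr fun x => ?_
  rw [← lintegral_mul_gaussKernel ha (measurable_one.indicator hU), ← lintegral_indicator hU]
  refine lintegral_congr fun z => ?_
  by_cases hz : z ∈ U <;> simp [hz]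

theorem gaussMass_mul_le_liminf_gaussEnergy (μ : Measure F) [SFinite μ] {U : Set F}
    (hU : IsOpen U) :
    gaussMass F * μ U ≤ liminf (fun a => gaussEnergy a μ (volume.restrict U)) (𝓝[>] 0) := by
  set f : ℝ → F → F → ℝ≥0∞ := fun a x w =>
    U.indicator 1 (x + √a • w) * ENNReal.ofReal (gaussKernel 1 w) with hf
  have hK : Measurable (gaussKernel 1 : F → ℝ) := (continuous_gaussKernel 1).measurable
  have hfm : ∀ a, Measurable (Function.uncurry (f a)) := fun a => by
    have hind : Measurable (U.indicator (1 : F → ℝ≥0∞)) := measurable_one.indicator hU.measurableSet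
    simp only [hf, Function.uncurry_def]
    fun_prop
  calc gaussMass F * μ U
      = ∫⁻ x, (∫⁻ w, U.indicator 1 x * ENNReal.ofReal (gaussKernel 1 w)) ∂μ := by
        have hinner : ∀ x, ∫⁻ w : F, U.indicator 1 x * ENNReal.ofReal (gaussKernel 1 w) =
            U.indicator 1 x * gaussMass F := fun x => lintegral_const_mul _ hK.ennreal_ofReal
        rw [lintegral_congr hinner, lintegral_mul_const _
            (measurable_one.indicator hU.measurableSet),
          lintegral_indicator_one hU.measurableSet, mul_comm]
    _ ≤ ∫⁻ x, (∫⁻ w, liminf (fun a => f a x w) (𝓝[>] 0)) ∂μ := by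
        refine lintegral_mono fun x => lintegral_mono fun w => ?_
        rw [ENNReal.liminf_mul_const_of_ne_top ENNReal.ofReal_ne_top, mul_comm]
        gcongr
        exact indicator_le_liminf_indicator_add_sqrt_smul hU x w
    _ ≤ ∫⁻ x, liminf (fun a => ∫⁻ w, f a x w) (𝓝[>] 0) ∂μ :=
        lintegral_mono fun x => lintegral_liminf_le fun a => (hfm a).comp measurable_prodMk_left
    _ ≤ liminf (fun a => ∫⁻ x, (∫⁻ w, f a x w) ∂μ) (𝓝[>] 0) :=
        lintegral_liminf_le fun a => (hfm a).lintegral_prod_right'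
    _ = liminf (fun a => gaussEnergy a μ (volume.restrict U)) (𝓝[>] 0) := by
        refine liminf_congr ?_
        filter_upwards [self_mem_nhdsWithin] with a ha
        rw [gaussEnergy_restrict_volume ha μ hU.measurableSet]

theorem gaussEnergy_restrict_volume_le {a : ℝ} (ha : 0 < a) (μ : Measure F) [SFinite μ] {U : Set F}
    (hU : MeasurableSet U) :
    gaussEnergy a μ (volume.restrict U) ≤ gaussMass F * μ Set.univ := by
  rw [gaussEnergy_restrict_volume ha μ hU, ← lintegral_const]
  exact lintegral_mono fun x => lintegral_mono fun w =>
    mul_le_of_le_one_left' (Set.indicator_le_self' (fun _ _ => zero_le) _)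

/-- One half of Plancherel's theorem, for the indicator function of `U`. -/
theorem fourierEnergy_restrict_volume_le {U : Set F} (hU : MeasurableSet U) (hfin : volume U ≠ ∞) :
    fourierEnergy (Module.finrank ℝ F) (volume.restrict U) ≤ gaussMass F * volume U := by
  have : IsFiniteMeasure (volume.restrict U) := ⟨by simpa using hfin.lt_top⟩
  set ν : Measure F := volume.restrict U
  calc fourierEnergy (Module.finrank ℝ F) ν
      = ∫⁻ ξ : F, liminf (fun a => ENNReal.ofReal (Real.exp (-a * ‖ξ‖ ^ 2)) *
          ‖charFun ν ξ‖ₑ ^ 2) (𝓝[>] 0) := by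
        refine lintegral_congr fun ξ => ?_
        rw [sub_self, ENNReal.rpow_zero, mul_one]
        simpa using (ENNReal.Tendsto.mul_const (tendsto_ofReal_exp_neg_mul (‖ξ‖ ^ 2))
          (Or.inl one_ne_zero)).liminf_eq.symm
    _ ≤ liminf (fun a => ∫⁻ ξ : F, ENNReal.ofReal (Real.exp (-a * ‖ξ‖ ^ 2)) *
          ‖charFun ν ξ‖ₑ ^ 2) (𝓝[>] 0) := by
        refine lintegral_liminf_le fun a => ?_
        have := measurable_charFun (μ := ν)
        fun_prop
    _ ≤ gaussMass F * volume U := by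
        refine liminf_le_of_frequently_le' (Eventually.frequently ?_)
        filter_upwards [self_mem_nhdsWithin] with a ha
        rw [← gaussEnergy_self ha, ← Measure.restrict_apply_univ U]
        exact gaussEnergy_restrict_volume_le ha ν hU

theorem gaussMass_mul_le_of_fourierEnergy [Nontrivial F] (μ : Measure F) [IsFiniteMeasure μ]
    {U : Set F} (hU : IsOpen U) (hfin : volume U ≠ ∞) {c : ℝ≥0∞} (h0 : c ≠ 0) (htop : c ≠ ∞) :
    gaussMass F * μ U ≤
      c * fourierEnergy (Module.finrank ℝ F) μ + c⁻¹ * (gaussMass F * volume U) := by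
  have : IsFiniteMeasure (volume.restrict U) := ⟨by simpa using hfin.lt_top⟩
  calc gaussMass F * μ U
      ≤ liminf (fun a => gaussEnergy a μ (volume.restrict U)) (𝓝[>] 0) :=
        gaussMass_mul_le_liminf_gaussEnergy μ hU
    _ ≤ ∫⁻ ξ, ‖charFun μ ξ‖ₑ * ‖charFun (volume.restrict U) ξ‖ₑ := by
        refine liminf_le_of_frequently_le' (Eventually.frequently ?_)
        filter_upwards [self_mem_nhdsWithin] with a ha using gaussEnergy_le ha _ _
    _ ≤ c * fourierEnergy (Module.finrank ℝ F) μ +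
          c⁻¹ * fourierEnergy (Module.finrank ℝ F) (volume.restrict U) :=
        lintegral_charFun_mul_le (by ring) h0 htop _ _
    _ ≤ _ := by grw [fourierEnergy_restrict_volume_le hU.measurableSet hfin]

theorem absolutelyContinuous_of_fourierEnergy_ne_top [Nontrivial F] {μ : Measure F}
    [IsFiniteMeasure μ] (h : fourierEnergy (Module.finrank ℝ F) μ ≠ ∞) : μ ≪ volume := by
  intro S hS
  refine (mul_eq_zero.1 (le_antisymm (ENNReal.le_of_forall_pos_le_add fun ε hε _ => ?_)
    zero_le : gaussMass F * μ S = 0)).resolve_left gaussMass_ne_zero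
  have hε2 : (ε : ℝ≥0∞) / 2 ≠ 0 := by simpa using hε.ne'
  obtain ⟨c, hc, hcμ⟩ := ENNReal.exists_nnreal_pos_mul_lt h hε2
  have hc0 : (c : ℝ≥0∞) ≠ 0 := by simpa using hc.ne'
  obtain ⟨θ, hθ, hθε⟩ := ENNReal.exists_nnreal_pos_mul_lt
    (ENNReal.mul_ne_top (ENNReal.inv_ne_top.2 hc0) (gaussMass_ne_top (F := F))) hε2
  obtain ⟨U, hSU, hU, hUθ⟩ := S.exists_isOpen_lt_of_lt (μ := volume) θ
    (by rw [hS]; exact_mod_cast hθ)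
  rw [zero_add]
  calc gaussMass F * μ S ≤ gaussMass F * μ U := by gcongr
    _ ≤ c * fourierEnergy (Module.finrank ℝ F) μ + (c : ℝ≥0∞)⁻¹ * (gaussMass F * volume U) :=
        gaussMass_mul_le_of_fourierEnergy μ hU (ne_top_of_lt hUθ) hc0 ENNReal.coe_ne_top
    _ ≤ ε / 2 + ε / 2 := by
        refine add_le_add hcμ.le (le_trans ?_ hθε.le)
        rw [← mul_assoc, mul_comm (θ : ℝ≥0∞)]
        gcongr
    _ = ε := ENNReal.add_halves _

end Smoothing

/-! ### Vanishing of the mutual Gaussian energy -/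

section Vanishing

open Filter

section Metric

variable {X : Type*} [PseudoEMetricSpace X] [MeasurableSpace X]

theorem energy_restrict_le (p : ℝ) (ν : Measure X) (S : Set X) :
    energy p (ν.restrict S) ≤ ∫⁻ x in S, ∫⁻ y, edist x y ^ (-p) ∂ν ∂ν :=
  lintegral_mono fun _ => lintegral_mono' Measure.restrict_le_self le_rfl

theorem exists_thickening_setLIntegral_le [OpensMeasurableSpace X] {ν : Measure X}
    [IsFiniteMeasure ν] {φ : X → ℝ≥0∞} (hφ : ∫⁻ x, φ x ∂ν ≠ ∞) {C : Set X} (hC : IsClosed C)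
    (hνC : ν C = 0) {ε : ℝ≥0∞} (hε : ε ≠ 0) :
    ∃ r > 0, ∫⁻ x in Metric.thickening r C, φ x ∂ν ≤ ε := by
  have hlim := tendsto_measure_thickening_of_isClosed (μ := ν)
    ⟨1, one_pos, measure_ne_top ν (Metric.thickening 1 C)⟩ hC
  rw [hνC] at hlim
  obtain ⟨r, hrε, hr⟩ := ((ENNReal.tendsto_nhds_zero.1 (tendsto_setLIntegral_zero hφ hlim) ε
    (pos_iff_ne_zero.2 hε)).and self_mem_nhdsWithin).exists
  exact ⟨r, hr, hrε⟩

end Metric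

variable {F : Type*} [NormedAddCommGroup F] [InnerProductSpace ℝ F] [MeasurableSpace F]

theorem tendsto_gaussEnergy_of_forall_le_dist {μ ν : Measure F} [IsFiniteMeasure μ]
    [IsFiniteMeasure ν] {C D : Set F} (hμC : μ Cᶜ = 0) (hνD : ν Dᶜ = 0) {r : ℝ} (hr : 0 < r)
    (h : ∀ x ∈ C, ∀ y ∈ D, r ≤ dist x y) :
    Tendsto (fun a => gaussEnergy a μ ν) (𝓝[>] 0) (𝓝 0) := by
  refine tendsto_gaussEnergy_of_le_dist hr ?_
  have hfst : ∀ᵐ z ∂(μ.prod ν), z.1 ∈ C := Measure.quasiMeasurePreserving_fst.ae hμC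
  have hsnd : ∀ᵐ z ∂(μ.prod ν), z.2 ∈ D := Measure.quasiMeasurePreserving_snd.ae hνD
  filter_upwards [hfst, hsnd] with z hzC hzD using h z.1 hzC z.2 hzD

theorem tendsto_gaussEnergy_restrict_compl_thickening [OpensMeasurableSpace F] {μ ν : Measure F}
    [IsFiniteMeasure μ] [IsFiniteMeasure ν] {C : Set F} (hμC : μ Cᶜ = 0) {r : ℝ} (hr : 0 < r) :
    Tendsto (fun a => gaussEnergy a μ (ν.restrict (Metric.thickening r C)ᶜ)) (𝓝[>] 0) (𝓝 0) := by
  refine tendsto_gaussEnergy_of_forall_le_dist (D := (Metric.thickening r C)ᶜ) hμC ?_ hr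
    fun x hx y hy => ?_
  · rw [compl_compl, Measure.restrict_apply Metric.isOpen_thickening.measurableSet,
      Set.inter_compl_self, measure_empty]
  · by_contra! hxy
    exact hy (Metric.mem_thickening_iff.2 ⟨x, hx, by rwa [dist_comm]⟩)

theorem norm_charFun_mul_conj_charFun_dirac_le {μ : Measure F} (u ξ : F) :
    ‖charFun μ ξ * (starRingEnd ℂ) (charFun (Measure.dirac u) ξ)‖ ≤ ‖charFun μ ξ‖ := by
  rw [norm_mul, RCLike.norm_conj]
  exact mul_le_of_le_one_right (norm_nonneg _) (norm_charFun_le_one ξ)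

variable [FiniteDimensional ℝ F] [BorelSpace F]

theorem gaussEnergy_add_right (a : ℝ) (μ ν ν' : Measure F) [SFinite μ] [SFinite ν] [SFinite ν'] :
    gaussEnergy a μ (ν + ν') = gaussEnergy a μ ν + gaussEnergy a μ ν' := by
  rw [gaussEnergy_eq_lintegral_dirac, lintegral_add_measure, ← gaussEnergy_eq_lintegral_dirac,
    ← gaussEnergy_eq_lintegral_dirac]

/-- The part of `ν` away from `C` does not contribute in the limit; the part near `C` has small
`t`-energy, hence a small mutual energy with `μ` by Cauchy-Schwarz on the Fourier side. -/
theorem tendsto_gaussEnergy_of_energy_ne_top [Nontrivial F] {μ ν : Measure F} [IsFiniteMeasure μ]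
    [IsFiniteMeasure ν] {s t : ℝ} (hst : s + t = 2 * Module.finrank ℝ F) (ht : 0 < t)
    (htd : t < Module.finrank ℝ F) (hμ : fourierEnergy s μ ≠ ∞) (hν : energy t ν ≠ ∞)
    {C : Set F} (hC : IsClosed C) (hμC : μ Cᶜ = 0) (hνC : ν C = 0) :
    Tendsto (fun a => gaussEnergy a μ ν) (𝓝[>] 0) (𝓝 0) := by
  obtain ⟨A, -, hA, hfourier⟩ := exists_fourierEnergy_eq (F := F) ht htd
  refine ENNReal.tendsto_nhds_zero.2 fun ε hε => ?_
  have hε3 : ε / 3 ≠ 0 := by simpa using hε.ne'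
  obtain ⟨c, hc, hcμ⟩ := ENNReal.exists_nnreal_pos_mul_lt hμ hε3
  have hc0 : (c : ℝ≥0∞) ≠ 0 := by simpa using hc.ne'
  obtain ⟨r, hr, hnear⟩ := exists_thickening_setLIntegral_le
    (φ := fun x => (c : ℝ≥0∞)⁻¹ * A * ∫⁻ y, edist x y ^ (-t) ∂ν) (ν := ν)
    (by
      rw [lintegral_const_mul' _ _ (by finiteness)]
      exact ENNReal.mul_ne_top (by finiteness) hν) hC hνC hε3
  rw [lintegral_const_mul' _ _ (by finiteness)] at hnear
  set T := Metric.thickening r C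
  have hfar : ∀ᶠ a in 𝓝[>] 0, gaussEnergy a μ (ν.restrict Tᶜ) ≤ ε / 3 :=
    ENNReal.tendsto_nhds_zero.1 (tendsto_gaussEnergy_restrict_compl_thickening hμC hr) _
      (pos_iff_ne_zero.2 hε3)
  filter_upwards [hfar, self_mem_nhdsWithin] with a hfar (ha : 0 < a)
  calc gaussEnergy a μ ν
      = gaussEnergy a μ (ν.restrict T) + gaussEnergy a μ (ν.restrict Tᶜ) := by
        rw [← gaussEnergy_add_right,
          Measure.restrict_add_restrict_compl Metric.isOpen_thickening.measurableSet]
    _ ≤ (c * fourierEnergy s μ + (c : ℝ≥0∞)⁻¹ * fourierEnergy t (ν.restrict T)) + ε / 3 := by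
        gcongr
        exact (gaussEnergy_le ha _ _).trans
          (lintegral_charFun_mul_le hst hc0 ENNReal.coe_ne_top _ _)
    _ ≤ (ε / 3 + ε / 3) + ε / 3 := by
        gcongr
        refine le_trans ?_ hnear
        rw [hfourier, mul_assoc]
        gcongr
        exact energy_restrict_le t ν T
    _ = ε := ENNReal.add_thirds ε

/-- The inverse Fourier integral of `charFun μ` without normalization: when `charFun μ` is
integrable, it is `(2π)ᵈ` times the continuous density of `μ`. -/
noncomputable def fourierDensity (μ : Measure F) (u : F) : ℂ :=
  ∫ ξ, charFun μ ξ * (starRingEnd ℂ) (charFun (Measure.dirac u) ξ)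

section FourierDensity

variable {μ : Measure F}

theorem measurable_charFun_mul_conj_charFun [SFinite μ] (ν : Measure F) [SFinite ν] :
    Measurable fun ξ => charFun μ ξ * (starRingEnd ℂ) (charFun ν ξ) :=
  measurable_charFun.mul (Complex.continuous_conj.measurable.comp measurable_charFun)

variable [IsFiniteMeasure μ]

theorem continuous_fourierDensity (h : Integrable (charFun μ)) : Continuous (fourierDensity μ) := by
  refine continuous_of_dominated
    (fun _ => (measurable_charFun_mul_conj_charFun _).aestronglyMeasurable)
    (fun u => .of_forall (norm_charFun_mul_conj_charFun_dirac_le u)) h.norm (.of_forall fun ξ => ?_)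
  simp only [charFun_dirac]
  fun_prop

theorem tendsto_gaussEnergy_dirac (h : Integrable (charFun μ)) (u : F) :
    Tendsto (fun a => gaussEnergy a μ (Measure.dirac u)) (𝓝[>] 0) (𝓝 ‖fourierDensity μ u‖ₑ) := by
  have hpos : ∀ᶠ a : ℝ in 𝓝[>] 0, 0 < a := self_mem_nhdsWithin
  refine Tendsto.congr' (hpos.mono fun a ha => (gaussEnergy_eq_enorm_integral ha _ _).symm) ?_
  refine (continuous_enorm.tendsto _).comp (tendsto_integral_filter_of_dominated_convergence
    (fun ξ => ‖charFun μ ξ‖) (.of_forall fun a => ?_) (hpos.mono fun a ha => .of_forall fun ξ => ?_)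
    h.norm (.of_forall fun ξ => ?_))
  · exact (by fun_prop : Continuous fun ξ : F => (Real.exp (-a * ‖ξ‖ ^ 2) : ℂ)
      ).aestronglyMeasurable.mul (measurable_charFun_mul_conj_charFun _).aestronglyMeasurable
  · rw [norm_mul, Complex.norm_real, Real.norm_of_nonneg (Real.exp_nonneg _)]
    refine (mul_le_of_le_one_left (norm_nonneg _) (Real.exp_le_one_iff.2 ?_)).trans
      (norm_charFun_mul_conj_charFun_dirac_le u ξ)
    rw [neg_mul]
    exact neg_nonpos.2 (by positivity)
  · have hcont : Continuous fun a : ℝ => (Real.exp (-a * ‖ξ‖ ^ 2) : ℂ) *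
        (charFun μ ξ * (starRingEnd ℂ) (charFun (Measure.dirac u) ξ)) := by fun_prop
    simpa using (hcont.tendsto 0).mono_left nhdsWithin_le_nhds

theorem fourierDensity_eq_zero_of_notMem (h : Integrable (charFun μ)) {C : Set F}
    (hC : IsClosed C) (hμC : μ Cᶜ = 0) {u : F} (hu : u ∉ C) : fourierDensity μ u = 0 := by
  obtain ⟨r, hr, hball⟩ := Metric.isOpen_iff.1 hC.isOpen_compl u hu
  refine enorm_eq_zero.1 (tendsto_nhds_unique (tendsto_gaussEnergy_dirac h u)
    (tendsto_gaussEnergy_of_forall_le_dist (D := {u}) hμC (by simp) hr fun x hx y hy => ?_))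
  by_contra! hxy
  rw [Set.mem_singleton_iff.1 hy] at hxy
  exact hball hxy hx

theorem gaussEnergy_dirac_le_lintegral {a : ℝ} (ha : 0 < a) (u : F) :
    gaussEnergy a μ (Measure.dirac u) ≤ ∫⁻ ξ, ‖charFun μ ξ‖ₑ := by
  refine (gaussEnergy_le ha _ _).trans (lintegral_mono fun ξ => mul_le_of_le_one_right' ?_)
  rw [← ofReal_norm, ← ENNReal.ofReal_one]
  exact ENNReal.ofReal_le_ofReal (norm_charFun_le_one ξ)

theorem tendsto_gaussEnergy_lintegral_fourierDensity (h : Integrable (charFun μ)) (ν : Measure F)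
    [IsFiniteMeasure ν] :
    Tendsto (fun a => gaussEnergy a μ ν) (𝓝[>] 0) (𝓝 (∫⁻ u, ‖fourierDensity μ u‖ₑ ∂ν)) := by
  simp_rw [gaussEnergy_eq_lintegral_dirac _ μ ν]
  refine tendsto_lintegral_filter_of_dominated_convergence (fun _ => ∫⁻ ξ, ‖charFun μ ξ‖ₑ)
    (.of_forall fun a => measurable_gaussEnergy_dirac a μ) ?_ ?_
    (.of_forall (tendsto_gaussEnergy_dirac h))
  · filter_upwards [self_mem_nhdsWithin] with a ha
    exact .of_forall (gaussEnergy_dirac_le_lintegral ha)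
  · rw [lintegral_const]
    exact ENNReal.mul_ne_top h.2.ne (measure_ne_top _ _)

theorem measure_eq_zero_of_fourierDensity_eq_zero (h : Integrable (charFun μ)) {U : Set F}
    (hU : IsOpen U) (hfin : volume U ≠ ∞) (hμU : ∀ u ∈ U, fourierDensity μ u = 0) : μ U = 0 := by
  have : IsFiniteMeasure (volume.restrict U) := ⟨by simpa using hfin.lt_top⟩
  have hlim := tendsto_gaussEnergy_lintegral_fourierDensity h (volume.restrict U)
  rw [setLIntegral_congr_fun hU.measurableSet (g := 0) fun u hu => by simp [hμU u hu],
    lintegral_zero_fun] at hlim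
  have hmass := gaussMass_mul_le_liminf_gaussEnergy μ hU
  rw [hlim.liminf_eq] at hmass
  exact (mul_eq_zero.1 (le_antisymm hmass zero_le)).resolve_left gaussMass_ne_zero

end FourierDensity

/-- The product of the continuous densities lives on the open set where both are nonzero, which is
contained in `C ∩ D`. -/
theorem tendsto_gaussEnergy_of_integrable_charFun {μ ν : Measure F} [IsFiniteMeasure μ]
    [IsFiniteMeasure ν] (hμ : Integrable (charFun μ)) (hν : Integrable (charFun ν))
    {C D : Set F} (hC : IsCompact C) (hμC : μ Cᶜ = 0) (hD : IsClosed D) (hνD : ν Dᶜ = 0)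
    (hCD : interior (C ∩ D) = ∅) :
    Tendsto (fun a => gaussEnergy a μ ν) (𝓝[>] 0) (𝓝 0) := by
  set U : Set F := {u | fourierDensity μ u ≠ 0}
  have hU : IsOpen U := isOpen_ne_fun (continuous_fourierDensity hμ) continuous_const
  have hUC : U ⊆ C := fun u hu => by
    by_contra hcon
    exact hu (fourierDensity_eq_zero_of_notMem hμ hC.isClosed hμC hcon)
  have hνU : ν U = 0 := by
    refine measure_eq_zero_of_fourierDensity_eq_zero hν hU
      (ne_top_of_le_ne_top hC.measure_lt_top.ne (measure_mono hUC)) fun u hu => ?_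
    by_contra hne
    have hsub : U ∩ {v | fourierDensity ν v ≠ 0} ⊆ interior (C ∩ D) := by
      refine interior_maximal (fun v hv => ⟨hUC hv.1, ?_⟩)
        (hU.inter (isOpen_ne_fun (continuous_fourierDensity hν) continuous_const))
      by_contra hcon
      exact hv.2 (fourierDensity_eq_zero_of_notMem hν hD hνD hcon)
    rw [hCD] at hsub
    exact hsub ⟨hu, hne⟩
  have hzero : ∫⁻ u, ‖fourierDensity μ u‖ₑ ∂ν = 0 := by
    rw [lintegral_eq_zero_iff (continuous_fourierDensity hμ).enorm.measurable]
    filter_upwards [measure_eq_zero_iff_ae_notMem.1 hνU] with u hu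
    simpa [U] using hu
  exact hzero ▸ tendsto_gaussEnergy_lintegral_fourierDensity hμ ν

end Vanishing

section DimH

theorem exists_nat_measure_inter_setOf_le_ne_zero {X : Type*} [MeasurableSpace X] {ν : Measure X}
    {φ : X → ℝ≥0∞} (hφ : Measurable φ) (hint : ∫⁻ x, φ x ∂ν ≠ ∞) {S : Set X} (hS : ν S ≠ 0) :
    ∃ N : ℕ, ν (S ∩ {x | φ x ≤ N}) ≠ 0 := by
  by_contra! hcon
  refine hS (measure_mono_null (t := (⋃ N : ℕ, S ∩ {x | φ x ≤ N}) ∪ {x | ¬ φ x < ∞})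
    (fun x hx => ?_) (measure_union_null (measure_iUnion_null hcon) (ae_lt_top hφ hint)))
  by_cases hx_top : φ x < ∞
  · obtain ⟨N, hN⟩ := ENNReal.exists_nat_gt hx_top.ne
    exact Or.inl (Set.mem_iUnion.2 ⟨N, hx, hN.le⟩)
  · exact Or.inr hx_top

variable {X : Type*} [EMetricSpace X] [MeasurableSpace X] [BorelSpace X] {ν : Measure X}
  {t : ℝ}

theorem measure_mul_ediam_rpow_neg_le_lintegral (ht : 0 < t) {s : Set X} {x : X} (hx : x ∈ s) :
    ν s * Metric.ediam s ^ (-t) ≤ ∫⁻ y, edist x y ^ (-t) ∂ν :=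
  calc ν s * Metric.ediam s ^ (-t)
      ≤ ν (Metric.closedEBall x (Metric.ediam s)) * Metric.ediam s ^ (-t) := by
        gcongr
        exact fun y hy => Metric.edist_le_ediam_of_mem hy hx
    _ = ∫⁻ _ in Metric.closedEBall x (Metric.ediam s), Metric.ediam s ^ (-t) ∂ν := by
        rw [setLIntegral_const, mul_comm]
    _ ≤ ∫⁻ y in Metric.closedEBall x (Metric.ediam s), edist x y ^ (-t) ∂ν := by
        refine setLIntegral_mono (by fun_prop) fun y hy => ?_
        rw [ENNReal.rpow_neg, ENNReal.rpow_neg]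
        gcongr
        rw [edist_comm]
        exact hy
    _ ≤ ∫⁻ y, edist x y ^ (-t) ∂ν := setLIntegral_le_lintegral _ _

theorem inv_smul_restrict_le_hausdorffMeasure (ht : 0 < t) {T : Set X} (hT : MeasurableSet T)
    {N : ℝ≥0∞} (hN0 : N ≠ 0) (hNtop : N ≠ ∞)
    (h : ∀ x ∈ T, ∫⁻ y, edist x y ^ (-t) ∂ν ≤ N) : N⁻¹ • ν.restrict T ≤ μH[t] := by
  refine Measure.le_hausdorffMeasure t _ 1 one_pos fun s hs => ?_
  rw [Measure.smul_apply, smul_eq_mul, Measure.restrict_apply' hT]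
  rcases (s ∩ T).eq_empty_or_nonempty with hempty | ⟨x, hxs, hxT⟩
  · simp [hempty]
  have hdiam : Metric.ediam s ^ t ≠ ∞ :=
    ENNReal.rpow_ne_top_of_nonneg ht.le (ne_top_of_le_ne_top ENNReal.one_ne_top hs)
  rw [mul_comm, ← div_eq_mul_inv, ENNReal.div_le_iff_le_mul (Or.inl hN0) (Or.inl hNtop),
    mul_comm, ← ENNReal.div_le_iff_le_mul (Or.inr hNtop) (Or.inl hdiam), div_eq_mul_inv,
    ← ENNReal.rpow_neg]
  calc ν (s ∩ T) * Metric.ediam s ^ (-t) ≤ ν s * Metric.ediam s ^ (-t) := by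
        gcongr; exact Set.inter_subset_left
    _ ≤ ∫⁻ y, edist x y ^ (-t) ∂ν := measure_mul_ediam_rpow_neg_le_lintegral ht hxs
    _ ≤ N := h x hxT

theorem le_dimH_of_energy_ne_top [SecondCountableTopology X] [SFinite ν] (ht : 0 < t)
    (hν : energy t ν ≠ ∞) {S : Set X} (hS : MeasurableSet S) (hpos : ν S ≠ 0) :
    ENNReal.ofReal t ≤ dimH S := by
  have hmeas : Measurable fun x => ∫⁻ y, edist x y ^ (-t) ∂ν :=
    (by fun_prop : Measurable fun z : X × X => edist z.1 z.2 ^ (-t)).lintegral_prod_right'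
  obtain ⟨N, hN⟩ := exists_nat_measure_inter_setOf_le_ne_zero hmeas hν hpos
  set T := S ∩ {x | ∫⁻ y, edist x y ^ (-t) ∂ν ≤ N}
  have hle := inv_smul_restrict_le_hausdorffMeasure (N := N + 1) ht
    (hS.inter (measurableSet_le hmeas measurable_const)) (by simp) (by finiteness)
    fun x (hx : x ∈ T) => hx.2.trans le_self_add
  have hT := hle T
  rw [Measure.smul_apply, Measure.restrict_apply_self, smul_eq_mul] at hT
  refine le_trans ?_ (dimH_mono (Set.inter_subset_left : T ⊆ S))
  refine le_dimH_of_hausdorffMeasure_ne_zero (d := t.toNNReal) ?_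
  rw [Real.coe_toNNReal t ht.le]
  exact ((ENNReal.mul_pos (ENNReal.inv_ne_zero.2 (by finiteness)) hN).trans_le hT).ne'

end DimH

/-! ### Gaussian random linear maps -/

section RandomMap

/-- The space of `m`-tuples of vectors of `ℝⁿ`, that is, of linear maps from `ℝⁿ` to `ℝᵐ`, with
its Hilbert–Schmidt norm. -/
abbrev Tuples (n m : ℕ) : Type := PiLp 2 fun _ : Fin m => E n

variable {n m : ℕ}

/-- The linear map from `ℝⁿ` to `ℝᵐ` with the given rows. -/
noncomputable def lin (ω : Tuples n m) : E n →L[ℝ] E m :=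
  LinearMap.toContinuousLinearMap
    { toFun := fun x => WithLp.toLp 2 fun i => inner ℝ (ω i) x
      map_add' := fun x y => by ext i; simp [inner_add_right]
      map_smul' := fun c x => by ext i; simp [inner_smul_right] }

theorem lin_apply (ω : Tuples n m) (x : E n) (i : Fin m) : lin ω x i = inner ℝ (ω i) x := rfl

theorem continuous_lin_apply : Continuous fun z : Tuples n m × E n => lin z.1 z.2 := by
  refine (PiLp.continuous_toLp 2 _).comp (continuous_pi fun i => ?_)
  fun_prop

instance isProbabilityMeasure_map_lin (μ : Measure (E n)) [IsProbabilityMeasure μ]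
    (ω : Tuples n m) : IsProbabilityMeasure (μ.map (lin ω)) :=
  Measure.isProbabilityMeasure_map (lin ω).continuous.aemeasurable

theorem inner_lin_left (ω : Tuples n m) (x : E n) (ξ : E m) :
    inner ℝ (lin ω x) ξ = inner ℝ x (∑ i, ξ i • ω i) := by
  rw [PiLp.inner_apply, inner_sum]
  refine Finset.sum_congr rfl fun i _ => ?_
  rw [lin_apply, inner_smul_right, real_inner_comm x]
  rfl

theorem inner_lin_eq_inner_toLp_smul (ω : Tuples n m) (x : E n) (ξ : E m) :
    inner ℝ (lin ω x) ξ = inner ℝ ω (WithLp.toLp 2 fun i => ξ i • x : Tuples n m) := by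
  simp [PiLp.inner_apply, lin_apply, inner_smul_right]

theorem norm_toLp_smul_sq (x : E n) (ξ : E m) :
    ‖(WithLp.toLp 2 fun i => ξ i • x : Tuples n m)‖ ^ 2 = ‖ξ‖ ^ 2 * ‖x‖ ^ 2 := by
  rw [PiLp.norm_sq_eq_of_L2, EuclideanSpace.norm_sq_eq, Finset.sum_mul]
  simp [norm_smul, mul_pow]

/-- The law of the random linear map from `ℝⁿ` to `ℝᵐ` with independent standard Gaussian
entries. -/
noncomputable abbrev gaussLaw (n m : ℕ) : Measure (Tuples n m) :=
  ProbabilityTheory.stdGaussian (Tuples n m)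

theorem integral_cexp_inner_lin (x : E n) (ξ : E m) :
    ∫ ω, Complex.exp (Complex.I * inner ℝ (lin ω x) ξ) ∂(gaussLaw n m) =
      (Real.exp (-(‖ξ‖ ^ 2 * ‖x‖ ^ 2 / 2)) : ℂ) := by
  have h := ProbabilityTheory.charFun_stdGaussian (WithLp.toLp 2 fun i => ξ i • x : Tuples n m)
  rw [charFun_apply, ← Complex.ofReal_pow, norm_toLp_smul_sq] at h
  simp_rw [← inner_lin_eq_inner_toLp_smul, mul_comm _ Complex.I] at h
  rw [h]
  push_cast
  congr 1
  ring

theorem charFun_map_lin (μ : Measure (E n)) (ω : Tuples n m) (ξ : E m) :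
    charFun (μ.map (lin ω)) ξ = charFun μ (∑ i, ξ i • ω i) := by
  rw [charFun_apply, charFun_apply, integral_map (lin ω).continuous.aemeasurable
    (Continuous.aestronglyMeasurable (by fun_prop))]
  simp only [inner_lin_left]

theorem sq_norm_charFun_map_lin (μ : Measure (E n)) [IsFiniteMeasure μ] (ω : Tuples n m)
    (ξ : E m) : ((‖charFun (μ.map (lin ω)) ξ‖ ^ 2 : ℝ) : ℂ) =
      ∫ z, Complex.exp (Complex.I * inner ℝ (lin ω (z.1 - z.2)) ξ) ∂(μ.prod μ) := by
  rw [charFun_map_lin, ← Complex.normSq_eq_norm_sq, ← Complex.mul_conj, charFun_mul_conj_charFun]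
  simp only [inner_lin_left]

theorem measurable_charFun_map_lin (μ : Measure (E n)) [IsFiniteMeasure μ] :
    Measurable fun z : Tuples n m × E m => charFun (μ.map (lin z.1)) z.2 := by
  simp only [charFun_map_lin]
  exact measurable_charFun.comp (by fun_prop)

theorem integrable_cexp_inner_lin_sub (ρ : Measure (Tuples n m × (E n × E n)))
    [IsFiniteMeasure ρ] (ξ : E m) :
    Integrable (Function.uncurry fun (ω : Tuples n m) (z : E n × E n) =>
      Complex.exp (Complex.I * inner ℝ (lin ω (z.1 - z.2)) ξ)) ρ := by
  have hlin : Continuous fun y : Tuples n m × (E n × E n) => lin y.1 (y.2.1 - y.2.2) :=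
    continuous_lin_apply.comp (by fun_prop : Continuous fun y : Tuples n m × (E n × E n) =>
      (y.1, y.2.1 - y.2.2))
  have hexp : Continuous (Function.uncurry fun (ω : Tuples n m) (z : E n × E n) =>
      Complex.exp (Complex.I * inner ℝ (lin ω (z.1 - z.2)) ξ)) := by
    simp only [Function.uncurry_def]
    fun_prop
  refine Integrable.of_bound hexp.aestronglyMeasurable 1 (.of_forall fun z => ?_)
  simp [Function.uncurry_def, Complex.norm_exp]

theorem integral_sq_norm_charFun_map_lin (μ : Measure (E n)) [IsFiniteMeasure μ] (ξ : E m) :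
    ∫ ω, ‖charFun (μ.map (lin ω)) ξ‖ ^ 2 ∂(gaussLaw n m) =
      ∫ z, Real.exp (-(‖ξ‖ ^ 2 * ‖z.1 - z.2‖ ^ 2 / 2)) ∂(μ.prod μ) := by
  rw [← Complex.ofReal_inj, ← integral_complex_ofReal, ← integral_complex_ofReal]
  simp_rw [sq_norm_charFun_map_lin]
  rw [integral_integral_swap (integrable_cexp_inner_lin_sub _ ξ)]
  simp_rw [integral_cexp_inner_lin]

theorem lintegral_sq_enorm_charFun_map_lin (μ : Measure (E n)) [IsFiniteMeasure μ] (ξ : E m) :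
    ∫⁻ ω, ‖charFun (μ.map (lin ω)) ξ‖ₑ ^ 2 ∂(gaussLaw n m) =
      ∫⁻ z, ENNReal.ofReal (Real.exp (-(‖ξ‖ ^ 2 * ‖z.1 - z.2‖ ^ 2 / 2))) ∂(μ.prod μ) := by
  have hsq : Integrable (fun ω : Tuples n m => ‖charFun (μ.map (lin ω)) ξ‖ ^ 2)
      (gaussLaw n m) := by
    have hmeas : Measurable fun ω : Tuples n m => charFun (μ.map (lin ω)) ξ :=
      (measurable_charFun_map_lin μ).of_uncurry_right
    refine Integrable.of_bound (hmeas.norm.pow_const 2).aestronglyMeasurable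
      (μ.real Set.univ ^ 2) (.of_forall fun ω => ?_)
    rw [Real.norm_of_nonneg (by positivity), charFun_map_lin]
    exact pow_le_pow_left₀ (norm_nonneg _) (norm_charFun_le _) 2
  have hexp : Integrable (fun z : E n × E n => Real.exp (-(‖ξ‖ ^ 2 * ‖z.1 - z.2‖ ^ 2 / 2)))
      (μ.prod μ) := by
    refine Integrable.of_bound (Continuous.aestronglyMeasurable (by fun_prop)) 1
      (.of_forall fun z => ?_)
    rw [Real.norm_of_nonneg (Real.exp_nonneg _), Real.exp_le_one_iff]
    exact neg_nonpos.2 (by positivity)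
  rw [← ofReal_integral_eq_lintegral_ofReal hexp (.of_forall fun _ => Real.exp_nonneg _),
    ← integral_sq_norm_charFun_map_lin,
    ofReal_integral_eq_lintegral_ofReal hsq (.of_forall fun _ => by positivity)]
  refine lintegral_congr fun ω => ?_
  rw [ENNReal.ofReal_pow (norm_nonneg _), ofReal_norm]

section RieszGauss

variable {F : Type*} [NormedAddCommGroup F] [InnerProductSpace ℝ F] [FiniteDimensional ℝ F]
  [MeasurableSpace F] [BorelSpace F]

theorem lintegral_exp_mul_rpow_ne_top [Nontrivial F] {p : ℝ} (hp : 0 < p) :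
    ∫⁻ ξ : F, ENNReal.ofReal (Real.exp (-(‖ξ‖ ^ 2 / 2))) *
      ‖ξ‖ₑ ^ (p - Module.finrank ℝ F) ≠ ∞ := by
  have hint : Integrable fun ξ : F =>
      Real.exp (-(‖ξ‖ ^ 2 / 2)) * ‖ξ‖ ^ (p - Module.finrank ℝ F) := by
    refine (integrable_fun_norm_addHaar volume
      (f := fun y : ℝ => Real.exp (-(y ^ 2 / 2)) * y ^ (p - Module.finrank ℝ F))).2 ?_
    refine (integrableOn_rpow_mul_exp_neg_mul_sq (b := 1 / 2) (by norm_num)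
      (s := p - 1) (by linarith)).congr_fun (fun y (hy : 0 < y) => ?_) measurableSet_Ioi
    have hd : 1 ≤ Module.finrank ℝ F := Module.finrank_pos
    simp only [smul_eq_mul]
    rw [← Real.rpow_natCast y (_ - 1), Nat.cast_sub hd, mul_left_comm, ← Real.rpow_add hy, mul_comm]
    congr 2 <;> (push_cast; ring)
  refine ne_of_eq_of_ne (lintegral_congr_ae ?_) hint.lintegral_lt_top.ne
  filter_upwards [Measure.ae_ne volume (0 : F)] with ξ hξ
  rw [ENNReal.ofReal_mul (Real.exp_nonneg _), ← ENNReal.ofReal_rpow_of_pos (norm_pos_iff.2 hξ),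
    ofReal_norm]

theorem lintegral_exp_mul_rpow (p : ℝ) {r : ℝ} (hr : 0 < r) :
    ∫⁻ ξ : F, ENNReal.ofReal (Real.exp (-(‖ξ‖ ^ 2 * r ^ 2 / 2))) *
      ‖ξ‖ₑ ^ (p - Module.finrank ℝ F) = ENNReal.ofReal r ^ (-p) *
        ∫⁻ ξ : F, ENNReal.ofReal (Real.exp (-(‖ξ‖ ^ 2 / 2))) *
          ‖ξ‖ₑ ^ (p - Module.finrank ℝ F) := by
  set d : ℝ := (Module.finrank ℝ F : ℝ) with hd
  have hr0 : ENNReal.ofReal r ≠ 0 := by simpa using hr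
  have hscale : ∀ ξ : F, ENNReal.ofReal (Real.exp (-(‖r • ξ‖ ^ 2 / 2))) * ‖r • ξ‖ₑ ^ (p - d) =
      ENNReal.ofReal r ^ (p - d) *
        (ENNReal.ofReal (Real.exp (-(‖ξ‖ ^ 2 * r ^ 2 / 2))) * ‖ξ‖ₑ ^ (p - d)) := fun ξ => by
    rw [enorm_smul, Real.enorm_eq_ofReal hr.le, norm_smul, Real.norm_of_nonneg hr.le, mul_pow,
      ENNReal.mul_rpow_of_ne_top ENNReal.ofReal_ne_top enorm_ne_top, mul_comm (r ^ 2),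
      mul_left_comm]
  have hcancel : ENNReal.ofReal r ^ (-p) * (ENNReal.ofReal r ^ d * ENNReal.ofReal r ^ (p - d)) =
      1 := by
    rw [← ENNReal.rpow_add _ _ hr0 ENNReal.ofReal_ne_top,
      ← ENNReal.rpow_add _ _ hr0 ENNReal.ofReal_ne_top]
    simp
  rw [← ofReal_pow_mul_lintegral_comp_smul hr (g := fun ξ : F =>
    ENNReal.ofReal (Real.exp (-(‖ξ‖ ^ 2 / 2))) * ‖ξ‖ₑ ^ (p - d)) (by fun_prop),
    lintegral_congr hscale, lintegral_const_mul' _ _ (by finiteness),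
    ENNReal.ofReal_pow hr.le, ← ENNReal.rpow_natCast, ← hd, ← mul_assoc (_ ^ d),
    ← mul_assoc (_ ^ (-p)), hcancel, one_mul]

end RieszGauss

theorem measurable_fourierEnergy_map_lin (p : ℝ) (μ : Measure (E n)) [IsFiniteMeasure μ] :
    Measurable fun ω : Tuples n m => fourierEnergy p (μ.map (lin ω)) := by
  have := measurable_charFun_map_lin (m := m) μ
  refine Measurable.lintegral_prod_right' (f := fun z : Tuples n m × E m =>
    ‖charFun (μ.map (lin z.1)) z.2‖ₑ ^ 2 * ‖z.2‖ₑ ^ (p - Module.finrank ℝ (E m))) ?_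
  fun_prop

theorem ae_norm_sub_pos_of_energy_ne_top {p : ℝ} (hp : 0 < p) {μ : Measure (E n)} [SFinite μ]
    (hμ : energy p μ ≠ ∞) : ∀ᵐ z ∂(μ.prod μ), 0 < ‖z.1 - z.2‖ := by
  rw [energy_eq_lintegral_prod] at hμ
  filter_upwards [ae_lt_top (by fun_prop) hμ] with z hz
  refine norm_pos_iff.2 fun hzero => hz.ne ?_
  rw [hzero, enorm_zero, ENNReal.zero_rpow_of_neg (by linarith)]

theorem lintegral_fourierEnergy_map_lin {p : ℝ} (hp : 0 < p) {μ : Measure (E n)}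
    [IsFiniteMeasure μ] (hμ : energy p μ ≠ ∞) :
    ∫⁻ ω, fourierEnergy p (μ.map (lin ω)) ∂(gaussLaw n m) =
      energy p μ * ∫⁻ ξ : E m, ENNReal.ofReal (Real.exp (-(‖ξ‖ ^ 2 / 2))) *
        ‖ξ‖ₑ ^ (p - Module.finrank ℝ (E m)) := by
  have hmeas := measurable_charFun_map_lin (m := m) μ
  set d : ℝ := (Module.finrank ℝ (E m) : ℝ)
  calc ∫⁻ ω, fourierEnergy p (μ.map (lin ω)) ∂(gaussLaw n m)
      = ∫⁻ ξ, (∫⁻ ω, ‖charFun (μ.map (lin ω)) ξ‖ₑ ^ 2 * ‖ξ‖ₑ ^ (p - d) ∂(gaussLaw n m)) :=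
        lintegral_lintegral_swap (by fun_prop)
    _ = ∫⁻ ξ : E m, (∫⁻ z, ENNReal.ofReal (Real.exp (-(‖ξ‖ ^ 2 * ‖z.1 - z.2‖ ^ 2 / 2))) *
          ‖ξ‖ₑ ^ (p - d) ∂(μ.prod μ)) := lintegral_congr fun ξ => by
        rw [lintegral_mul_const _ (hmeas.of_uncurry_right.enorm.pow_const 2),
          lintegral_mul_const _ (by fun_prop), lintegral_sq_enorm_charFun_map_lin]
    _ = ∫⁻ z, (∫⁻ ξ : E m, ENNReal.ofReal (Real.exp (-(‖ξ‖ ^ 2 * ‖z.1 - z.2‖ ^ 2 / 2))) *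
          ‖ξ‖ₑ ^ (p - d)) ∂(μ.prod μ) := lintegral_lintegral_swap (by fun_prop)
    _ = ∫⁻ z, ‖z.1 - z.2‖ₑ ^ (-p) * (∫⁻ ξ : E m,
          ENNReal.ofReal (Real.exp (-(‖ξ‖ ^ 2 / 2))) * ‖ξ‖ₑ ^ (p - d)) ∂(μ.prod μ) := by
        refine lintegral_congr_ae ((ae_norm_sub_pos_of_energy_ne_top hp hμ).mono fun z hz => ?_)
        simp only
        rw [lintegral_exp_mul_rpow p hz, ofReal_norm]
    _ = _ := by rw [lintegral_mul_const _ (by fun_prop), energy_eq_lintegral_prod]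

theorem lintegral_fourierEnergy_map_lin_ne_top [NeZero m] {p : ℝ} (hp : 0 < p)
    {μ : Measure (E n)} [IsFiniteMeasure μ] (hμ : energy p μ ≠ ∞) :
    ∫⁻ ω, fourierEnergy p (μ.map (lin ω)) ∂(gaussLaw n m) ≠ ∞ := by
  rw [lintegral_fourierEnergy_map_lin hp hμ]
  exact ENNReal.mul_ne_top hμ (lintegral_exp_mul_rpow_ne_top hp)

theorem ae_fourierEnergy_map_lin_ne_top [NeZero m] {p : ℝ} (hp : 0 < p) {μ : Measure (E n)}
    [IsFiniteMeasure μ] (hμ : energy p μ ≠ ∞) :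
    ∀ᵐ ω ∂(gaussLaw n m), fourierEnergy p (μ.map (lin ω)) ≠ ∞ :=
  (ae_lt_top (measurable_fourierEnergy_map_lin p μ)
    (lintegral_fourierEnergy_map_lin_ne_top hp hμ)).mono fun _ h => h.ne

end RandomMap

/-! ### The mean energy of random images -/

section MeanEnergy

open Filter

variable {n m : ℕ}

theorem gaussEnergy_map_lin (a : ℝ) (ω : Tuples n m) (μ ν : Measure (E n)) [SFinite μ]
    [SFinite ν] : gaussEnergy a (μ.map (lin ω)) (ν.map (lin ω)) =
      ∫⁻ z, ENNReal.ofReal (gaussKernel a (lin ω (z.1 - z.2))) ∂(μ.prod ν) := by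
  have hlin := (lin ω).continuous.measurable
  rw [gaussEnergy, Measure.map_prod_map _ _ hlin hlin,
    lintegral_map (measurable_ofReal_gaussKernel_sub a) (hlin.prodMap hlin)]
  simp only [Prod.map_fst, Prod.map_snd, map_sub]

theorem integral_gaussKernel_lin {a : ℝ} (ha : 0 < a) (x : E n) :
    ∫ ω, gaussKernel a (lin ω x) ∂(gaussLaw n m) = gaussKernel (a + ‖x‖ ^ 2 / 2) (0 : E m) := by
  have hint : Integrable (Function.uncurry fun (ω : Tuples n m) (ξ : E m) =>
      Complex.exp (-a * ‖ξ‖ ^ 2 + Complex.I * inner ℝ (lin ω x) ξ))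
      ((gaussLaw n m).prod volume) := by
    have hlin : Continuous fun y : Tuples n m × E m => lin y.1 x :=
      continuous_lin_apply.comp (by fun_prop : Continuous fun y : Tuples n m × E m => (y.1, x))
    refine Integrable.mono' ((integrable_exp_neg_mul_sq_norm (F := E m) ha).comp_snd
      (gaussLaw n m)) (Continuous.aestronglyMeasurable ?_)
      (.of_forall fun z => (norm_cexp_neg_mul_sq_norm_add a z.2 _).le)
    simp only [Function.uncurry_def]
    fun_prop
  rw [← Complex.ofReal_inj, ← integral_complex_ofReal]
  simp_rw [← integral_cexp_eq_gaussKernel ha]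
  rw [integral_integral_swap hint, ← integral_cexp_eq_gaussKernel (by positivity)]
  refine integral_congr_ae (.of_forall fun ξ => ?_)
  simp only [Complex.exp_add]
  rw [integral_const_mul, integral_cexp_inner_lin]
  push_cast
  rw [← Complex.exp_add, ← Complex.exp_add]
  congr 1
  simp only [inner_zero_left, Complex.ofReal_zero]
  ring

theorem gaussKernel_zero_pos {F : Type*} [NormedAddCommGroup F] [InnerProductSpace ℝ F] {a : ℝ}
    (ha : 0 < a) : 0 < gaussKernel a (0 : F) := by
  unfold gaussKernel
  positivity

theorem gaussKernel_zero_anti {F : Type*} [NormedAddCommGroup F] [InnerProductSpace ℝ F] {a b : ℝ}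
    (ha : 0 < a) (hab : a ≤ b) : gaussKernel b (0 : F) ≤ gaussKernel a (0 : F) := by
  have hb : 0 < b := ha.trans_le hab
  simp only [gaussKernel, norm_zero, ne_eq, OfNat.ofNat_ne_zero, not_false_eq_true, zero_pow,
    neg_zero, zero_div, Real.exp_zero, mul_one]
  gcongr

theorem lintegral_gaussKernel_lin {a : ℝ} (ha : 0 < a) (x : E n) :
    ∫⁻ ω, ENNReal.ofReal (gaussKernel a (lin ω x)) ∂(gaussLaw n m) =
      ENNReal.ofReal (gaussKernel (a + ‖x‖ ^ 2 / 2) (0 : E m)) := by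
  have hmean := integral_gaussKernel_lin (m := m) ha x
  rw [← hmean, ofReal_integral_eq_lintegral_ofReal (Integrable.of_integral_ne_zero ?_)
    (.of_forall fun _ => gaussKernel_nonneg ha _)]
  exact hmean ▸ (gaussKernel_zero_pos (by positivity)).ne'

theorem measurable_gaussKernel_lin_sub (a : ℝ) : Measurable fun z : Tuples n m × (E n × E n) =>
    ENNReal.ofReal (gaussKernel a (lin z.1 (z.2.1 - z.2.2))) :=
  ((continuous_gaussKernel a).comp (continuous_lin_apply.comp (by fun_prop :
    Continuous fun y : Tuples n m × (E n × E n) => (y.1, y.2.1 - y.2.2)))).measurable.ennreal_ofReal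

theorem measurable_gaussEnergy_map_lin (a : ℝ) (μ ν : Measure (E n)) [SFinite μ] [SFinite ν] :
    Measurable fun ω : Tuples n m => gaussEnergy a (μ.map (lin ω)) (ν.map (lin ω)) := by
  simp only [gaussEnergy_map_lin]
  exact (measurable_gaussKernel_lin_sub a).lintegral_prod_right'

theorem lintegral_gaussEnergy_map_lin {a : ℝ} (ha : 0 < a) (μ ν : Measure (E n)) [SFinite μ]
    [SFinite ν] :
    ∫⁻ ω, gaussEnergy a (μ.map (lin ω)) (ν.map (lin ω)) ∂(gaussLaw n m) =
      ∫⁻ z, ENNReal.ofReal (gaussKernel (a + ‖z.1 - z.2‖ ^ 2 / 2) (0 : E m)) ∂(μ.prod ν) := by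
  simp only [gaussEnergy_map_lin]
  rw [lintegral_lintegral_swap (measurable_gaussKernel_lin_sub a).aemeasurable]
  simp only [lintegral_gaussKernel_lin ha]

theorem exists_le_lintegral_gaussEnergy_map_lin (m : ℕ) (μ ν : Measure (E n)) [SFinite μ]
    [SFinite ν] [NeZero μ] [NeZero ν] :
    ∃ c ≠ 0, ∀ a : ℝ, 0 < a → a ≤ 1 →
      c ≤ ∫⁻ ω, gaussEnergy a (μ.map (lin ω)) (ν.map (lin ω)) ∂(gaussLaw n m) := by
  refine ⟨∫⁻ z, ENNReal.ofReal (gaussKernel (1 + ‖z.1 - z.2‖ ^ 2 / 2) (0 : E m)) ∂(μ.prod ν),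
    ?_, fun a ha ha1 => ?_⟩
  · have hpos : ∀ z : E n × E n,
        ENNReal.ofReal (gaussKernel (1 + ‖z.1 - z.2‖ ^ 2 / 2) (0 : E m)) ≠ 0 := fun z =>
      (ENNReal.ofReal_pos.2 (gaussKernel_zero_pos (by positivity))).ne'
    rw [← pos_iff_ne_zero, lintegral_pos_iff_support (by unfold gaussKernel; fun_prop),
      Function.support_eq_univ hpos]
    simp [← Set.univ_prod_univ, Measure.prod_prod, NeZero.ne]
  · rw [lintegral_gaussEnergy_map_lin ha]
    exact lintegral_mono fun z => ENNReal.ofReal_le_ofReal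
      (gaussKernel_zero_anti (by positivity) (by gcongr))

/-- The mean of the Gaussian energy stays away from zero, while the Fourier energies dominate
it. -/
theorem not_ae_tendsto_gaussEnergy_map_lin [NeZero m] {μ ν : Measure (E n)}
    [IsProbabilityMeasure μ] [IsProbabilityMeasure ν] {s t : ℝ} (hs : 0 < s) (ht : 0 < t)
    (hst : s + t = 2 * m) (hμ : energy s μ ≠ ∞) (hν : energy t ν ≠ ∞) :
    ¬ ∀ᵐ ω ∂(gaussLaw n m),
      Tendsto (fun a => gaussEnergy a (μ.map (lin ω)) (ν.map (lin ω))) (𝓝[>] 0) (𝓝 0) := by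
  intro hcon
  have hst' : s + t = 2 * Module.finrank ℝ (E m) := by simpa using hst
  have hlim : Tendsto (fun a => ∫⁻ ω, gaussEnergy a (μ.map (lin ω)) (ν.map (lin ω))
      ∂(gaussLaw n m)) (𝓝[>] 0) (𝓝 (∫⁻ _, 0 ∂(gaussLaw n m))) := by
    refine tendsto_lintegral_filter_of_dominated_convergence
      (fun ω => fourierEnergy s (μ.map (lin ω)) + fourierEnergy t (ν.map (lin ω)))
      (.of_forall fun a => measurable_gaussEnergy_map_lin a μ ν) ?_ ?_ hcon
    · filter_upwards [self_mem_nhdsWithin] with a ha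
      exact .of_forall fun ω => by
        simpa using (gaussEnergy_le ha (μ.map (lin ω)) (ν.map (lin ω))).trans
          (lintegral_charFun_mul_le hst' one_ne_zero ENNReal.one_ne_top _ _)
    · rw [lintegral_add_left (measurable_fourierEnergy_map_lin s μ)]
      exact ENNReal.add_ne_top.2 ⟨lintegral_fourierEnergy_map_lin_ne_top hs hμ,
        lintegral_fourierEnergy_map_lin_ne_top ht hν⟩
  rw [lintegral_zero] at hlim
  obtain ⟨c, hc, hle⟩ := exists_le_lintegral_gaussEnergy_map_lin m μ ν
  refine hc (le_zero_iff.1 (ge_of_tendsto hlim ?_))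
  filter_upwards [Ioc_mem_nhdsGT one_pos] with a ha using hle a ha.1 ha.2

theorem enorm_charFun_le_add {F : Type*} [NormedAddCommGroup F] [InnerProductSpace ℝ F]
    [MeasurableSpace F] (μ : Measure F) [IsProbabilityMeasure μ] {q : ℝ} (hq : 0 ≤ q) (ξ : F) :
    ‖charFun μ ξ‖ₑ ≤
      ‖charFun μ ξ‖ₑ ^ 2 * ‖ξ‖ₑ ^ q + ENNReal.ofReal (((1 + ‖ξ‖) / 2) ^ (-q)) := by
  rcases le_total ‖ξ‖ 1 with hξ | hξ
  · refine le_add_left ?_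
    rw [← ofReal_norm]
    exact ENNReal.ofReal_le_ofReal ((norm_charFun_le_one ξ).trans
      (Real.one_le_rpow_of_pos_of_le_one_of_nonpos (by positivity) (by linarith) (by linarith)))
  · have hpos : 0 < ‖ξ‖ := by linarith
    have henorm : ‖ξ‖ₑ ≠ 0 := by simpa using hpos
    have hsplit := mul_le_mul_sq_add_inv_mul_sq (x := ‖charFun μ ξ‖ₑ) (y := 1) (c := ‖ξ‖ₑ ^ q)
      (by simp [henorm]) (by finiteness)
    rw [mul_one, one_pow, mul_one, ← ENNReal.rpow_neg, mul_comm] at hsplit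
    refine hsplit.trans ?_
    gcongr
    rw [← ofReal_norm, ENNReal.ofReal_rpow_of_pos hpos]
    exact ENNReal.ofReal_le_ofReal
      (Real.rpow_le_rpow_of_nonpos (by positivity) (by linarith) (by linarith))

theorem integrable_charFun_of_fourierEnergy_ne_top {F : Type*} [NormedAddCommGroup F]
    [InnerProductSpace ℝ F] [FiniteDimensional ℝ F] [MeasurableSpace F] [BorelSpace F]
    {μ : Measure F} [IsProbabilityMeasure μ] {s : ℝ} (hs : 2 * Module.finrank ℝ F < s)
    (h : fourierEnergy s μ ≠ ∞) : Integrable (charFun μ) := by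
  have hmeas := measurable_charFun (μ := μ)
  have hint : Integrable fun ξ : F => ((1 + ‖ξ‖) / 2) ^ (-(s - Module.finrank ℝ F)) := by
    refine ((integrable_one_add_norm (by linarith)).div_const _).congr
      (.of_forall fun ξ => (Real.div_rpow (by positivity) zero_le_two _).symm)
  refine ⟨hmeas.aestronglyMeasurable, ?_⟩
  calc ∫⁻ ξ, ‖charFun μ ξ‖ₑ
      ≤ fourierEnergy s μ +
        ∫⁻ ξ : F, ENNReal.ofReal (((1 + ‖ξ‖) / 2) ^ (-(s - Module.finrank ℝ F))) := by
        rw [fourierEnergy, ← lintegral_add_left (by fun_prop)]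
        exact lintegral_mono (enorm_charFun_le_add μ (by linarith))
    _ < ∞ := ENNReal.add_lt_top.2 ⟨h.lt_top, hint.lintegral_lt_top⟩

end MeanEnergy

/-! ### Gaussian random planes -/

section Grassmannian

variable {n m : ℕ}

theorem rotate_rotate (g h : OrthGroup n) (V : Grass n m) :
    rotate g (rotate h V) = rotate (g * h) V := by
  refine Subtype.ext ?_
  simp only [rotate, ← Submodule.map_comp]
  congr 1

theorem exists_rotate_eq (V W : Grass n m) : ∃ g : OrthGroup n, rotate g V = W := by
  let e : V.1 ≃ₗᵢ[ℝ] W.1 := ((stdOrthonormalBasis ℝ V.1).reindex (finCongr V.2)).equiv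
    ((stdOrthonormalBasis ℝ W.1).reindex (finCongr W.2)) (Equiv.refl _)
  let g : E n ≃ₗᵢ[ℝ] E n :=
    (W.1.subtypeₗᵢ.comp e.toLinearIsometry).extend.toLinearIsometryEquiv rfl
  have hg : ∀ v : V.1, g v = e v := LinearIsometry.extend_apply _
  refine ⟨Unitary.linearIsometryEquiv.symm g, Subtype.ext ?_⟩
  simp only [rotate, MulEquiv.apply_symm_apply]
  refine le_antisymm ?_ fun w hw => ?_
  · rintro _ ⟨v, hv, rfl⟩
    exact (hg ⟨v, hv⟩).symm ▸ (e ⟨v, hv⟩).2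
  · refine ⟨e.symm ⟨w, hw⟩, (e.symm ⟨w, hw⟩).2, (hg _).trans ?_⟩
    rw [LinearIsometryEquiv.apply_symm_apply]

theorem haarO_setOf_rotate_mem_eq_zero {hm : m ≤ n} {S : Set (Grass n m)} (hS : MeasurableSet S)
    (h : gammaMeas hm S = 0) (V : Grass n m) : haarO n {g | rotate g V ∈ S} = 0 := by
  obtain ⟨h₀, rfl⟩ := exists_rotate_eq (coordPlane hm) V
  rw [gammaMeas, Measure.map_apply (continuous_rotate _).measurable hS] at h
  have hhaar : (haarO n).IsHaarMeasure := by unfold haarO; infer_instance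
  have hmap := Measure.isMulInvariant_eq_smul_of_compactSpace ((haarO n).map (· * h₀)) (haarO n)
  simp only [rotate_rotate]
  change haarO n ((· * h₀) ⁻¹' ((fun g => rotate g (coordPlane hm)) ⁻¹' S)) = 0
  rw [← Measure.map_apply (measurable_mul_const h₀) ((continuous_rotate _).measurable hS), hmap,
    Measure.smul_apply, h, smul_zero]

/-- The action of the orthogonal group on tuples of vectors, which corresponds to `L ↦ L g⁻¹` on
linear maps. -/
noncomputable def rotateRows (g : OrthGroup n) (ω : Tuples n m) : Tuples n m :=
  WithLp.toLp 2 fun i => (g : E n →L[ℝ] E n) (ω i)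

theorem map_rotateRows_gaussLaw (g : OrthGroup n) :
    (gaussLaw n m).map (rotateRows g) = gaussLaw n m :=
  ProbabilityTheory.stdGaussian_map (LinearIsometryEquiv.piLpCongrRight 2
    fun _ : Fin m => Unitary.linearIsometryEquiv g)

theorem continuous_rotateRows :
    Continuous fun z : OrthGroup n × Tuples n m => rotateRows z.1 z.2 := by
  refine (PiLp.continuous_toLp 2 _).comp (continuous_pi fun i => ?_)
  exact (continuous_subtype_val.comp continuous_fst).clm_apply (by fun_prop)

theorem lin_rotateRows_apply (g : OrthGroup n) (ω : Tuples n m) (x : E n) :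
    lin (rotateRows g ω) (Unitary.linearIsometryEquiv g x) = lin ω x := by
  ext i
  rw [lin_apply, lin_apply]
  exact (Unitary.linearIsometryEquiv g).inner_map_map (ω i) x

/-- The orthogonal complement of the kernel of a linear map, that is, the span of its rows. For
the Gaussian random linear map this is a random plane with law `γ_{n,m}`. -/
noncomputable def rowSpace (ω : Tuples n m) : Submodule ℝ (E n) :=
  (lin ω).kerᗮ

theorem ker_lin_rotateRows (g : OrthGroup n) (ω : Tuples n m) :
    (lin (rotateRows g ω)).ker = (lin ω).ker.map
      ((Unitary.linearIsometryEquiv g).toLinearEquiv : E n →ₗ[ℝ] E n) := by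
  ext x
  constructor
  · intro hx
    obtain ⟨y, rfl⟩ := (Unitary.linearIsometryEquiv g).surjective x
    exact ⟨y, (lin_rotateRows_apply g ω y).symm.trans hx, rfl⟩
  · rintro ⟨y, hy, rfl⟩
    exact (lin_rotateRows_apply g ω y).trans hy

theorem rowSpace_rotateRows (g : OrthGroup n) (ω : Tuples n m) :
    rowSpace (rotateRows g ω) = (rowSpace ω).map
      ((Unitary.linearIsometryEquiv g).toLinearEquiv : E n →ₗ[ℝ] E n) := by
  rw [rowSpace, ker_lin_rotateRows, rowSpace]
  exact (Submodule.map_orthogonal_equiv _ _).symm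

theorem finrank_rowSpace_eq_iff (ω : Tuples n m) :
    Module.finrank ℝ (rowSpace ω) = m ↔ Function.Surjective (lin ω) := by
  have hcompl := Submodule.finrank_add_finrank_orthogonal (lin ω).ker
  have hnullity := LinearMap.finrank_range_add_finrank_ker (lin ω : E n →ₗ[ℝ] E m)
  have hrank : Module.finrank ℝ (rowSpace ω) = Module.finrank ℝ (lin ω).range := by
    rw [rowSpace]; omega
  have hsurj : Function.Surjective (lin ω) ↔ (lin ω).range = ⊤ := LinearMap.range_eq_top.symm
  rw [hrank, hsurj]
  refine ⟨fun h => Submodule.eq_top_of_finrank_eq (by simpa using h), fun h => ?_⟩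
  rw [h, finrank_top, finrank_euclideanSpace_fin]

/-- The Gram operator `L L*` of the linear map `L` with the given rows. -/
noncomputable def gram (ω : Tuples n m) : E m →L[ℝ] E m :=
  (lin ω).comp (lin ω).adjoint

theorem isUnit_gram_iff (ω : Tuples n m) : IsUnit (gram ω) ↔ Function.Surjective (lin ω) := by
  rw [ContinuousLinearMap.isUnit_iff_bijective]
  refine ⟨fun h => Function.Surjective.of_comp h.2, fun hsurj => ?_⟩
  have hinj : Function.Injective (gram ω) := by
    refine (injective_iff_map_eq_zero _).2 fun y hy => ?_
    have hadj : (lin ω).adjoint y = 0 := by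
      rw [← inner_self_eq_zero (𝕜 := ℝ), ContinuousLinearMap.adjoint_inner_left]
      change inner ℝ y (gram ω y) = 0
      rw [hy, inner_zero_right]
    obtain ⟨x, rfl⟩ := hsurj y
    rw [← inner_self_eq_zero (𝕜 := ℝ), ← ContinuousLinearMap.adjoint_inner_left, hadj,
      inner_zero_left]
  exact ⟨hinj, (LinearMap.injective_iff_surjective (f := (gram ω : E m →ₗ[ℝ] E m))).1 hinj⟩

theorem starProjection_rowSpace {ω : Tuples n m} (h : Function.Surjective (lin ω)) :
    (rowSpace ω).starProjection =
      (lin ω).adjoint.comp ((Ring.inverse (gram ω)).comp (lin ω)) := by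
  ext1 x
  refine Submodule.eq_starProjection_of_mem_orthogonal ?_ ?_
  · refine (Submodule.mem_orthogonal _ _).2 fun k hk => ?_
    rw [ContinuousLinearMap.comp_apply, ContinuousLinearMap.adjoint_inner_right,
      show lin ω k = 0 from hk, inner_zero_left]
  · rw [rowSpace, Submodule.orthogonal_orthogonal]
    change lin ω (x - _) = 0
    rw [map_sub, sub_eq_zero]
    exact (DFunLike.congr_fun (Ring.mul_inverse_cancel _ ((isUnit_gram_iff ω).2 h))
      (lin ω x)).symm

theorem continuous_lin : Continuous (lin : Tuples n m → E n →L[ℝ] E m) :=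
  continuous_clm_apply.2 fun _ => continuous_lin_apply.comp (continuous_id.prodMk continuous_const)

theorem continuous_adjoint_lin : Continuous fun ω : Tuples n m => (lin ω).adjoint :=
  (ContinuousLinearMap.adjoint (𝕜 := ℝ) (E := E n) (F := E m)).continuous.comp continuous_lin

theorem continuous_gram : Continuous (gram : Tuples n m → E m →L[ℝ] E m) :=
  continuous_lin.clm_comp continuous_adjoint_lin

theorem isOpen_setOf_surjective_lin : IsOpen {ω : Tuples n m | Function.Surjective (lin ω)} := by
  simp only [← isUnit_gram_iff]
  exact Units.isOpen.preimage continuous_gram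

theorem continuousOn_starProjection_rowSpace :
    ContinuousOn (fun ω : Tuples n m => (rowSpace ω).starProjection)
      {ω | Function.Surjective (lin ω)} := by
  refine ContinuousOn.congr ?_ fun ω hω => starProjection_rowSpace hω
  refine continuous_adjoint_lin.continuousOn.clm_comp
    (ContinuousOn.clm_comp (fun ω hω => ?_) continuous_lin.continuousOn)
  obtain ⟨u, hu⟩ := (isUnit_gram_iff ω).2 hω
  have hinv := NormedRing.inverse_continuousAt u
  rw [hu] at hinv
  exact (hinv.comp continuous_gram.continuousAt).continuousWithinAt

theorem measurableSet_setOf_rowSpace_mem {S : Set (Grass n m)} (hS : MeasurableSet S) :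
    MeasurableSet {ω : Tuples n m | ∃ V ∈ S, V.1 = rowSpace ω} := by
  have hcomap : measurableSpace_grass n m = MeasurableSpace.comap
      (fun V : Grass n m => V.1.starProjection) (borel (E n →L[ℝ] E n)) := borel_comap
  rw [hcomap] at hS
  obtain ⟨T, hT, rfl⟩ := hS
  rw [← BorelSpace.measurable_eq (α := E n →L[ℝ] E n)] at hT
  set G : Set (Tuples n m) := {ω | Function.Surjective (lin ω)}
  have himage : {ω : Tuples n m | ∃ V ∈ (fun V : Grass n m => V.1.starProjection) ⁻¹' T,
      V.1 = rowSpace ω} =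
      Subtype.val '' (G.domRestrict (fun ω => (rowSpace ω).starProjection) ⁻¹' T) := by
    ext ω
    constructor
    · rintro ⟨V, hV, hVω⟩
      refine ⟨⟨ω, (finrank_rowSpace_eq_iff ω).1 (hVω ▸ V.2)⟩, ?_, rfl⟩
      change (rowSpace ω).starProjection ∈ T
      rwa [← hVω]
    · rintro ⟨⟨ω', hω'⟩, hT', rfl⟩
      exact ⟨⟨rowSpace ω', (finrank_rowSpace_eq_iff ω').2 hω'⟩, hT', rfl⟩
  rw [himage]
  exact isOpen_setOf_surjective_lin.measurableSet.subtype_image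
    ((continuousOn_iff_continuous_domRestrict.1
      continuousOn_starProjection_rowSpace).measurable hT)

theorem haarO_setOf_rowSpace_rotateRows_mem_eq_zero {hm : m ≤ n} {S : Set (Grass n m)}
    (hS : MeasurableSet S) (h : gammaMeas hm S = 0) (ω : Tuples n m) :
    haarO n {g | ∃ V ∈ S, V.1 = rowSpace (rotateRows g ω)} = 0 := by
  by_cases hω : Module.finrank ℝ (rowSpace ω) = m
  · refine measure_mono_null ?_ (haarO_setOf_rotate_mem_eq_zero hS h ⟨rowSpace ω, hω⟩)
    rintro g ⟨V, hV, hVω⟩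
    have hrot : rotate g ⟨rowSpace ω, hω⟩ = V :=
      Subtype.ext (by rw [hVω, rowSpace_rotateRows]; rfl)
    rwa [Set.mem_ofPred_eq, hrot]
  · refine measure_mono_null (t := ∅) ?_ measure_empty
    rintro g ⟨V, -, hVω⟩
    have hrank : Module.finrank ℝ (rowSpace (rotateRows g ω)) = m := hVω ▸ V.2
    exact hω (by rwa [rowSpace_rotateRows, LinearEquiv.finrank_map_eq] at hrank)

theorem gaussLaw_eq_lintegral_haarO {B : Set (Tuples n m)} (hB : MeasurableSet B) :
    gaussLaw n m B = ∫⁻ ω, haarO n {g | rotateRows g ω ∈ B} ∂(gaussLaw n m) := by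
  have hmeas : MeasurableSet {z : OrthGroup n × Tuples n m | rotateRows z.1 z.2 ∈ B} :=
    continuous_rotateRows.measurable hB
  have hinv : ∀ g : OrthGroup n, gaussLaw n m {ω | rotateRows g ω ∈ B} = gaussLaw n m B :=
    fun g => by
      conv_rhs => rw [← map_rotateRows_gaussLaw g, Measure.map_apply (f := rotateRows g)
        (continuous_rotateRows.comp (.prodMk_right g)).measurable hB]
      rfl
  calc gaussLaw n m B = ∫⁻ g, gaussLaw n m {ω | rotateRows g ω ∈ B} ∂(haarO n) := by
        simp only [hinv, lintegral_const, measure_univ, mul_one]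
    _ = ((haarO n).prod (gaussLaw n m)) {z | rotateRows z.1 z.2 ∈ B} :=
        (Measure.prod_apply hmeas).symm
    _ = ∫⁻ ω, haarO n {g | rotateRows g ω ∈ B} ∂(gaussLaw n m) := Measure.prod_apply_symm hmeas

theorem ae_forall_eq_rowSpace_notMem {hm : m ≤ n} {S : Set (Grass n m)}
    (h : gammaMeas hm S = 0) :
    ∀ᵐ ω ∂(gaussLaw n m), ∀ V : Grass n m, V.1 = rowSpace ω → V ∉ S := by
  set S' := toMeasurable (gammaMeas hm) S
  have hS' : MeasurableSet S' := measurableSet_toMeasurable _ _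
  have hnull : gaussLaw n m {ω | ∃ V ∈ S', V.1 = rowSpace ω} = 0 := by
    rw [gaussLaw_eq_lintegral_haarO (measurableSet_setOf_rowSpace_mem hS')]
    simp only [Set.mem_ofPred_eq, haarO_setOf_rowSpace_rotateRows_mem_eq_zero hS'
      ((measure_toMeasurable S).trans h), lintegral_zero]
  filter_upwards [measure_eq_zero_iff_ae_notMem.1 hnull] with ω hω V hV hVS
  exact hω ⟨V, subset_toMeasurable _ _ hVS, hV⟩

theorem lin_orthogonalProjectionOnto {ω : Tuples n m} {V : Grass n m} (hV : V.1 = rowSpace ω)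
    (x : E n) : lin ω (V.1.orthogonalProjectionOnto x : E n) = lin ω x := by
  have hker : x - V.1.starProjection x ∈ (lin ω).ker := by
    have horth : V.1ᗮ = (lin ω).ker := by rw [hV, rowSpace, Submodule.orthogonal_orthogonal]
    exact horth ▸ Submodule.sub_starProjection_mem_orthogonal x
  have hzero : lin ω (x - V.1.starProjection x) = 0 := hker
  rw [map_sub, sub_eq_zero] at hzero
  exact hzero.symm

theorem exists_equiv_image_proj {ω : Tuples n m} {V : Grass n m} (hV : V.1 = rowSpace ω) :
    ∃ e : V.1 ≃L[ℝ] E m, ∀ A : Set (E n), e '' proj V A = lin ω '' A := by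
  have hproj := lin_orthogonalProjectionOnto hV
  let f : V.1 →ₗ[ℝ] E m := (lin ω : E n →ₗ[ℝ] E m) ∘ₗ V.1.subtype
  have hf : Function.Surjective f := fun y => by
    obtain ⟨x, rfl⟩ := (finrank_rowSpace_eq_iff ω).1 (hV ▸ V.2) y
    exact ⟨V.1.orthogonalProjectionOnto x, hproj x⟩
  have hrank : Module.finrank ℝ V.1 = Module.finrank ℝ (E m) :=
    V.2.trans finrank_euclideanSpace_fin.symm
  let e : V.1 ≃ₗ[ℝ] E m := LinearEquiv.ofBijective f
    ⟨(LinearMap.injective_iff_surjective_of_finrank_eq_finrank hrank).2 hf, hf⟩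
  refine ⟨e.toContinuousLinearEquiv, fun A => ?_⟩
  rw [proj, Set.image_image]
  exact Set.image_congr fun x _ => hproj x

end Grassmannian

/-! ### Intersections of projections -/

section Intersections

open Filter

variable {n m : ℕ}

theorem energy_ne_top_of_le {X : Type*} [PseudoEMetricSpace X] [MeasurableSpace X] {p s : ℝ}
    (hp : 0 ≤ p) (hps : p ≤ s) {μ : Measure X} [IsFiniteMeasure μ] (h : energy s μ ≠ ∞) :
    energy p μ ≠ ∞ := by
  have hkernel : ∀ x y : X, edist x y ^ (-p) ≤ 1 + edist x y ^ (-s) := fun x y => by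
    rcases le_total (edist x y) 1 with hxy | hxy
    · exact le_add_left (ENNReal.rpow_le_rpow_of_exponent_ge hxy (neg_le_neg hps))
    · refine le_add_right ?_
      rw [ENNReal.rpow_neg, ENNReal.inv_le_one]
      simpa using ENNReal.rpow_le_rpow hxy hp
  have hle : energy p μ ≤ ∫⁻ _, μ Set.univ ∂μ + energy s μ := by
    calc energy p μ ≤ ∫⁻ x, (μ Set.univ + ∫⁻ y, edist x y ^ (-s) ∂μ) ∂μ := by
          refine lintegral_mono fun x => (lintegral_mono (hkernel x)).trans_eq ?_
          rw [lintegral_add_left measurable_const, lintegral_one]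
      _ = _ := lintegral_add_left measurable_const _
  refine ne_top_of_le_ne_top (ENNReal.add_ne_top.2 ⟨?_, h⟩) hle
  rw [lintegral_const]
  finiteness

theorem energy_ne_top_of_fourierEnergy_ne_top {F : Type*} [NormedAddCommGroup F]
    [InnerProductSpace ℝ F] [FiniteDimensional ℝ F] [MeasurableSpace F] [BorelSpace F]
    [Nontrivial F] {μ : Measure F} [IsFiniteMeasure μ] {p : ℝ} (hp : 0 < p)
    (hpd : p < Module.finrank ℝ F) (h : fourierEnergy p μ ≠ ∞) : energy p μ ≠ ∞ := by
  obtain ⟨C, hC, -, hfourier⟩ := exists_fourierEnergy_eq (F := F) hp hpd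
  rw [hfourier] at h
  exact fun htop => h (by rw [htop, ENNReal.mul_top hC])

theorem ae_surjective_lin [NeZero m] {μ : Measure (E n)} [IsProbabilityMeasure μ]
    (hμ : energy m μ ≠ ∞) : ∀ᵐ ω ∂(gaussLaw n m), Function.Surjective (lin ω) := by
  filter_upwards [ae_fourierEnergy_map_lin_ne_top (Nat.cast_pos.2 (NeZero.pos m)) hμ] with ω hω
  have hac : μ.map (lin ω) ≪ volume :=
    absolutelyContinuous_of_fourierEnergy_ne_top (by rwa [finrank_euclideanSpace_fin])
  have hrange : lin ω ⁻¹' ((lin ω).range : Set (E m)) = Set.univ :=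
    Set.eq_univ_of_forall fun x => ⟨x, rfl⟩
  by_contra hsurj
  have hnull := hac (Measure.addHaar_submodule volume (lin ω).range
    fun htop => hsurj (LinearMap.range_eq_top.1 htop))
  rw [Measure.map_apply (lin ω).continuous.measurable
    (Submodule.closed_of_finiteDimensional _).measurableSet,
    hrange, measure_univ] at hnull
  exact one_ne_zero hnull

theorem map_lin_compl_image {μ : Measure (E n)} {K : Set (E n)} (hK : IsCompact K)
    (hμK : μ Kᶜ = 0) (ω : Tuples n m) : μ.map (lin ω) (lin ω '' K)ᶜ = 0 := by
  rw [Measure.map_apply (lin ω).continuous.measurable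
    (hK.image (lin ω).continuous).measurableSet.compl]
  exact measure_mono_null (fun x hx hxK => hx ⟨x, hxK, rfl⟩) hμK

/-- The hypothesis `h` says that the planes outside `S` contribute nothing to the mutual energy of
the projections of suitable measures on `A` and `B`. -/
theorem gammaMeas_pos_of_forall_tendsto [NeZero m] (hm : m ≤ n) {A B : Set (E n)}
    (hA : AnalyticSet A) (hB : AnalyticSet B) {p q t : ℝ} (ht : 0 < t) (htm : t ≤ m)
    (htp : 2 * m - t ≤ p) (htq : t ≤ q) (hpA : ENNReal.ofReal p < dimH A)
    (hqB : ENNReal.ofReal q < dimH B) {S : Set (Grass n m)}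
    (h : ∀ V ∉ S, ∀ (e : V.1 ≃L[ℝ] E m) (μ ν : Measure (E m)) [IsProbabilityMeasure μ]
      [IsProbabilityMeasure ν] (C D : Set (E m)), IsCompact C → μ Cᶜ = 0 → IsCompact D →
      ν Dᶜ = 0 → C ∩ D ⊆ e '' (proj V A ∩ proj V B) → fourierEnergy p μ ≠ ∞ →
      fourierEnergy q ν ≠ ∞ → fourierEnergy t ν ≠ ∞ →
      Tendsto (fun a => gaussEnergy a μ ν) (𝓝[>] 0) (𝓝 0)) :
    0 < gammaMeas hm S := by
  have hm0 : (0 : ℝ) < m := Nat.cast_pos.2 (NeZero.pos m)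
  have hp : 0 < p := by linarith
  have hq : 0 < q := by linarith
  obtain ⟨K, hKA, hK, μ, _, hμK, hμ⟩ := exists_measure_energy_ne_top hp hA hpA
  obtain ⟨L, hLB, hL, ν, _, hνL, hν⟩ := exists_measure_energy_ne_top hq hB hqB
  have hνt := energy_ne_top_of_le ht.le htq hν
  refine pos_iff_ne_zero.2 fun hzero => not_ae_tendsto_gaussEnergy_map_lin (m := m)
    (by linarith : 0 < 2 * (m : ℝ) - t) ht (by ring)
    (energy_ne_top_of_le (by linarith) htp hμ) hνt ?_
  filter_upwards [ae_forall_eq_rowSpace_notMem hzero,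
    ae_surjective_lin (energy_ne_top_of_le hm0.le (by linarith) hμ),
    ae_fourierEnergy_map_lin_ne_top hp hμ, ae_fourierEnergy_map_lin_ne_top hq hν,
    ae_fourierEnergy_map_lin_ne_top ht hνt] with ω hS hsurj hμω hνω hνtω
  let V : Grass n m := ⟨rowSpace ω, (finrank_rowSpace_eq_iff ω).2 hsurj⟩
  obtain ⟨e, he⟩ := exists_equiv_image_proj (V := V) rfl
  refine h V (hS V rfl) e _ _ (lin ω '' K) (lin ω '' L) (hK.image (lin ω).continuous)
    (map_lin_compl_image hK hμK ω) (hL.image (lin ω).continuous) (map_lin_compl_image hL hνL ω)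
    ?_ hμω hνω hνtω
  rw [Set.image_inter e.injective, he, he]
  exact Set.inter_subset_inter (Set.image_mono hKA) (Set.image_mono hLB)

theorem gammaMeas_pos_of_forall_mem (hm : m ≤ n) {S : Set (Grass n m)} (h : ∀ V, V ∈ S) :
    0 < gammaMeas hm S := by
  rw [Set.eq_univ_of_forall h, measure_univ]
  exact one_pos

theorem proj_inter_proj_eq_univ (V : Grass n 0) {A B : Set (E n)} (hA : 0 < dimH A)
    (hB : 0 < dimH B) : proj V A ∩ proj V B = Set.univ := by
  have hV : Subsingleton V.1 := Module.finrank_zero_iff.1 V.2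
  have hproj : ∀ {S : Set (E n)}, 0 < dimH S → proj V S = Set.univ := fun {S} hS =>
    Set.Nonempty.eq_univ (Set.Nonempty.image _ (Set.nonempty_iff_ne_empty.2 fun hempty =>
      hS.ne' (hempty ▸ dimH_empty)))
  rw [hproj hA, hproj hB, Set.inter_univ]

theorem volume_image_eq_zero {V : Grass n m} (e : V.1 ≃L[ℝ] E m) {S : Set V.1}
    (h : μH[(m : ℝ)] S = 0) : volume (e '' S) = 0 := by
  have hhaar : (μH[(m : ℝ)] : Measure (E m)).IsAddHaarMeasure := by
    have := isAddHaarMeasure_hausdorffMeasure (E := E m)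
    rwa [finrank_euclideanSpace_fin] at this
  refine Measure.absolutelyContinuous_isAddHaarMeasure volume (μH[(m : ℝ)] : Measure (E m)) ?_
  have hle := e.lipschitz.hausdorffMeasure_image_le (Nat.cast_nonneg m) S
  rwa [h, mul_zero, nonpos_iff_eq_zero] at hle

theorem gammaMeas_hausdorffMeasure_pos (hm : m ≤ n) {A B : Set (E n)} (hA : AnalyticSet A)
    (hB : AnalyticSet B) (hAd : (m : ℝ≥0∞) < dimH A) (hBd : (m : ℝ≥0∞) < dimH B) :
    0 < gammaMeas hm {V | 0 < μH[(m : ℝ)] (proj V A ∩ proj V B)} := by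
  obtain rfl | hm0 := eq_zero_or_neZero m
  · refine gammaMeas_pos_of_forall_mem hm fun V => ?_
    change 0 < μH[((0 : ℕ) : ℝ)] (proj V A ∩ proj V B)
    rw [proj_inter_proj_eq_univ V (by simpa using hAd) (by simpa using hBd), Nat.cast_zero]
    exact one_pos.trans_le (Measure.one_le_hausdorffMeasure_zero_of_nonempty Set.univ_nonempty)
  have hmpos : (0 : ℝ) < m := Nat.cast_pos.2 (NeZero.pos m)
  have hm2 : (m : ℝ≥0∞) < ENNReal.ofReal (2 * m) := ENNReal.natCast_lt_ofReal.2 (by linarith)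
  obtain ⟨p, -, hmp, hp⟩ := ENNReal.lt_iff_exists_real_btwn.1 (lt_min hAd hm2)
  have hpm : (m : ℝ) < p := ENNReal.natCast_lt_ofReal.1 hmp
  have hp2 : p < 2 * m := (ENNReal.ofReal_lt_ofReal_iff (by linarith)).1 (lt_min_iff.1 hp).2
  have hdim : (Module.finrank ℝ (E m) : ℝ) = m := by rw [finrank_euclideanSpace_fin]
  refine gammaMeas_pos_of_forall_tendsto hm hA hB (p := p) (q := m) (t := 2 * m - p)
    (by linarith) (by linarith) (by linarith) (by linarith) (lt_min_iff.1 hp).1 (by simpa)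
    fun V hV e μ ν _ _ C D hC hμC _ hνD hCD hμ hνm hν => ?_
  have hnull : ν (C ∩ D) = 0 := absolutelyContinuous_of_fourierEnergy_ne_top (by rwa [hdim])
    (measure_mono_null hCD (volume_image_eq_zero e (by simpa using hV)))
  exact tendsto_gaussEnergy_of_energy_ne_top (by rw [hdim]; ring) (by linarith) (by linarith) hμ
    (energy_ne_top_of_fourierEnergy_ne_top (by linarith) (by linarith) hν) hC.isClosed hμC
    ((measure_inter_conull hνD).symm.trans hnull)

theorem gammaMeas_interior_pos (hm : m ≤ n) {A B : Set (E n)} (hA : AnalyticSet A)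
    (hB : AnalyticSet B) (hAd : (2 * m : ℝ≥0∞) < dimH A) (hBd : (2 * m : ℝ≥0∞) < dimH B) :
    0 < gammaMeas hm {V | (interior (proj V A ∩ proj V B)).Nonempty} := by
  obtain rfl | hm0 := eq_zero_or_neZero m
  · refine gammaMeas_pos_of_forall_mem hm fun V => ?_
    change (interior (proj V A ∩ proj V B)).Nonempty
    rw [proj_inter_proj_eq_univ V (by simpa using hAd) (by simpa using hBd), interior_univ]
    exact Set.univ_nonempty
  have hmpos : (0 : ℝ) < m := Nat.cast_pos.2 (NeZero.pos m)
  obtain ⟨p, -, hmp, hp⟩ := ENNReal.lt_iff_exists_real_btwn.1 (lt_min hAd hBd)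
  have hpm : 2 * (m : ℝ) < p := by
    exact_mod_cast ENNReal.natCast_lt_ofReal.1 (by exact_mod_cast hmp : ((2 * m : ℕ) : ℝ≥0∞) < _)
  refine gammaMeas_pos_of_forall_tendsto hm hA hB (p := p) (q := p) hmpos le_rfl
    (by linarith) (by linarith) (lt_min_iff.1 hp).1 (lt_min_iff.1 hp).2
    fun V hV e μ ν _ _ C D hC hμC hD hνD hCD hμ hν _ => ?_
  have hint : ∀ {ρ : Measure (E m)} [IsProbabilityMeasure ρ], fourierEnergy p ρ ≠ ∞ →
      Integrable (charFun ρ) :=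
    integrable_charFun_of_fourierEnergy_ne_top (by rwa [finrank_euclideanSpace_fin])
  refine tendsto_gaussEnergy_of_integrable_charFun (hint hμ) (hint hν) hC hμC hD.isClosed hνD
    (Set.subset_empty_iff.1 ((interior_mono hCD).trans_eq ?_))
  rw [← e.coe_toHomeomorph, ← e.toHomeomorph.image_interior, Set.not_nonempty_iff_eq_empty.1 hV,
    Set.image_empty]

theorem exists_exponent {a b : ℝ≥0∞} (ha : a ≠ ∞) (hbm : b ≤ m) (hab : (2 * m : ℝ≥0∞) < a + b)
    (hb : b ≠ 0) {ε : ℝ} (hε : 0 < ε) :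
    ∃ t : ℝ, 0 < t ∧ ENNReal.ofReal t < b ∧ ENNReal.ofReal (2 * m - t) < a ∧
      b < ENNReal.ofReal t + ENNReal.ofReal ε := by
  lift a to NNReal using ha
  lift b to NNReal using ne_top_of_le_ne_top (ENNReal.natCast_ne_top m) hbm
  have hbpos : (0 : ℝ) < b := by simpa [pos_iff_ne_zero] using hb
  have hbm' : (b : ℝ) ≤ m := by exact_mod_cast hbm
  have hab' : 2 * (m : ℝ) < a + b := by exact_mod_cast hab
  obtain ⟨t, ht, htb⟩ : ∃ t : ℝ, max (max (b - ε) 0) (2 * m - a) < t ∧ t < b :=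
    exists_between (max_lt (max_lt (by linarith) hbpos) (by linarith))
  simp only [max_lt_iff] at ht
  obtain ⟨⟨htε, ht0⟩, hta⟩ := ht
  have hlt {r : ℝ} {x : NNReal} (hr : 0 ≤ r) : ENNReal.ofReal r < x ↔ r < x := by
    rw [← ENNReal.ofReal_coe_nnreal, ENNReal.ofReal_lt_ofReal_iff_of_nonneg hr]
  refine ⟨t, ht0, (hlt ht0.le).2 htb, (hlt (by linarith)).2 (by linarith), ?_⟩
  rw [← ENNReal.ofReal_add ht0.le hε.le, ← ENNReal.ofReal_coe_nnreal,
    ENNReal.ofReal_lt_ofReal_iff_of_nonneg hbpos.le]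
  linarith

theorem gammaMeas_dimH_pos (hm : m ≤ n) {A B : Set (E n)} (hA : AnalyticSet A)
    (hB : AnalyticSet B) (hBd : dimH B ≤ (m : ℝ≥0∞)) (hAB : (2 * m : ℝ≥0∞) < dimH A + dimH B)
    {ε : ℝ} (hε : 0 < ε) :
    0 < gammaMeas hm {V | dimH B < dimH (proj V A ∩ proj V B) + ENNReal.ofReal ε} := by
  rcases eq_or_ne (dimH B) 0 with hB0 | hB0
  · refine gammaMeas_pos_of_forall_mem hm fun V => ?_
    change dimH B < _
    exact hB0.trans_lt ((ENNReal.ofReal_pos.2 hε).trans_le le_add_self)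
  have hm0 : NeZero m := ⟨by rintro rfl; exact hB0 (by simpa using hBd)⟩
  obtain ⟨t, ht, htB, htA, hBt⟩ := exists_exponent (Real.dimH_ne_top A) hBd hAB hB0 hε
  have htm : t < m := by
    rw [← ENNReal.ofReal_natCast] at hBd
    exact (ENNReal.ofReal_lt_ofReal_iff_of_nonneg ht.le).1 (htB.trans_le hBd)
  have hdim : (Module.finrank ℝ (E m) : ℝ) = m := by rw [finrank_euclideanSpace_fin]
  refine gammaMeas_pos_of_forall_tendsto hm hA hB (p := 2 * m - t) (q := t) ht htm.le
    le_rfl le_rfl htA htB fun V hV e μ ν _ _ C D hC hμC hD hνD hCD hμ _ hν => ?_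
  have henergy := energy_ne_top_of_fourierEnergy_ne_top ht (by rwa [hdim]) hν
  have hnull : ν (C ∩ D) = 0 := by
    by_contra hpos
    refine hV (hBt.trans_le (add_le_add_left ?_ _))
    calc ENNReal.ofReal t ≤ dimH (C ∩ D) :=
          le_dimH_of_energy_ne_top ht henergy (hC.measurableSet.inter hD.measurableSet) hpos
      _ ≤ dimH (e '' (proj V A ∩ proj V B)) := dimH_mono hCD
      _ = dimH (proj V A ∩ proj V B) := e.dimH_image _
  exact tendsto_gaussEnergy_of_energy_ne_top (by rw [hdim]; ring) ht (by rwa [hdim]) hμ henergy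
    hC.isClosed hμC ((measure_inter_conull hνD).symm.trans hnull)

end Intersections

end ProjInter

theorem theorem1p1_general (n m : ℕ) (hm : m ≤ n) (A B : Set (EuclideanSpace ℝ (Fin n)))
    (hA : AnalyticSet A) (hB : AnalyticSet B) :
    ((m : ℝ≥0∞) < dimH A → (m : ℝ≥0∞) < dimH B →
      0 < ProjInter.gammaMeas hm {V | 0 < Measure.hausdorffMeasure (m : ℝ)
        (ProjInter.proj V A ∩ ProjInter.proj V B)}) ∧
    ((2 * m : ℝ≥0∞) < dimH A → (2 * m : ℝ≥0∞) < dimH B →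
      0 < ProjInter.gammaMeas hm
        {V | (interior (ProjInter.proj V A ∩ ProjInter.proj V B)).Nonempty}) ∧
    (dimH B ≤ (m : ℝ≥0∞) → (2 * m : ℝ≥0∞) < dimH A + dimH B →
      ∀ ε : ℝ, 0 < ε → 0 < ProjInter.gammaMeas hm
        {V | dimH B < dimH (ProjInter.proj V A ∩ ProjInter.proj V B) + ENNReal.ofReal ε}) :=
  ⟨ProjInter.gammaMeas_hausdorffMeasure_pos hm hA hB, ProjInter.gammaMeas_interior_pos hm hA hB,
    fun hBm hAB _ hε => ProjInter.gammaMeas_dimH_pos hm hA hB hBm hAB hε⟩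

theorem theorem1p1 (n m : ℕ) (hm : m ≤ n) (A B : Set (EuclideanSpace ℝ (Fin n)))
    (hA : MeasurableSet A) (hB : MeasurableSet B) :
    ((m : ℝ≥0∞) < dimH A → (m : ℝ≥0∞) < dimH B →
      0 < ProjInter.gammaMeas hm {V | 0 < Measure.hausdorffMeasure (m : ℝ)
        (ProjInter.proj V A ∩ ProjInter.proj V B)}) ∧
    ((2 * m : ℝ≥0∞) < dimH A → (2 * m : ℝ≥0∞) < dimH B →
      0 < ProjInter.gammaMeas hm
        {V | (interior (ProjInter.proj V A ∩ ProjInter.proj V B)).Nonempty}) ∧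
    ((m : ℝ≥0∞) < dimH A → dimH B ≤ (m : ℝ≥0∞) → (2 * m : ℝ≥0∞) < dimH A + dimH B →
      ∀ ε : ℝ, 0 < ε → 0 < ProjInter.gammaMeas hm
        {V | dimH B < dimH (ProjInter.proj V A ∩ ProjInter.proj V B) + ENNReal.ofReal ε}) :=
  have h := theorem1p1_general n m hm A B hA.analyticSet hB.analyticSet
  ⟨h.1, h.2.1, fun _ => h.2.2⟩
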